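/- Let $n\ge 2$ and let $W$ be the Coxeter group of type $\tilde A_{n-1}$, realised as the group of all permutations $w$ of $\mathbb Z$ with $w(x+n)=w(x)+n$ for all $x$ and $\sum_{x=1}^n (w(x)-x)=0$, with Coxeter generators $s_i=(i,i+1)$ for $1\le i\le n$ (the permutation exchanging $i+kn$ and $i+1+kn$ for every $k\in\mathbb Z$). Let $R$ be the set of reflections (conjugates of the $s_i$), and let $l_R(w)$ be the least number of factors in an expression of $w$ as a product of reflections. A Coxeter element is a product $c$ of $s_1,\dots,s_n$, each taken once, in some order. Let $P_c$ be the set of $p\in W$ such that $c=pq$ for some $q$ with $l_R(c)=l_R(p)+l_R(q)$. The dual monoid $M(P_c)$ is the monoid with generators $\underline w$ $(w\in P_c)$ and relations $\underline 1=1$ and $\underline{w}\,\underline{w'}=\underline{ww'}$ whenever $w,w',ww'\in P_c$ and $l_R(ww')=l_R(w)+l_R(w')$. Let $X$ (resp. $\Xi$) be the set of $x\in\mathbb Z$ such that $c^k(x)=x+n$ (resp. $c^k(x)=x-n$) for some $k\ge 1$. Conjugation by $\underline c$ is the automorphism of $M(P_c)$ sending $\underline w$ to $\underline{cwc^{-1}}$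 for $w\in P_c$. (1) The map $c\mapsto\{|X\cap[1,n]|,|\Xi\cap[1,n]|\}$ (as a multiset) induces a well-defined bijection from the set of isomorphism classes of the monoids $M(P_c)$, where $c$ runs over the Coxeter elements of $W$, onto the set of partitions of $n$ into two (positive) parts. (2) Let $c$ be a Coxeter element, let $r\in R\cap P_c$, and let $i\ne j$ be integers with $r(i)=j$ (so that $r=(i,j)$). The orbit of the atom $\underline r$ of $M(P_c)$ under the powers of conjugation by $\underline c$ is finite of cardinality $|X\cap[1,n]|$ if $i,j\in X$; it is finite of cardinality $|\Xi\cap[1,n]|$ if $i,j\in\Xi$; and it is infinite if $i\in X$ and $j\in\Xi$. -/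

import Mathlib

/-! ## Dual monoids of a group with a generating set -/

section DualMonoid

variable {G : Type*} [Group G]

/-- The length `l_R(g)`: the least number of factors in an expression of `g` as a product of
elements of `R`. -/
noncomputable def genLength (R : Set G) (g : G) : ℕ :=
  sInf {k | ∃ l : List G, (∀ r ∈ l, r ∈ R) ∧ l.prod = g ∧ l.length = k}

/-- The set `P_c` of divisors of `c`: the `p` with `c = p q` and `l_R(c) = l_R(p) + l_R(q)`. -/
def divisors (R : Set G) (c : G) : Set G :=
  {p | ∃ q, c = p * q ∧ genLength R c = genLength R p + genLength R q}

/-- The defining relations of `M(P_c)` on the generators `w ∈ P_c`: the generator `1` is the unit,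
and `u · v = uv` whenever `u`, `v`, `uv ∈ P_c` and `l_R(uv) = l_R(u) + l_R(v)`. -/
inductive DualRel (R : Set G) (c : G) :
    FreeMonoid (divisors R c) → FreeMonoid (divisors R c) → Prop
  | one (e : divisors R c) (he : (e : G) = 1) : DualRel R c (FreeMonoid.of e) 1
  | mul (u v w : divisors R c) (hw : (w : G) = u * v)
      (hl : genLength R (w : G) = genLength R (u : G) + genLength R (v : G)) :
      DualRel R c (FreeMonoid.of u * FreeMonoid.of v) (FreeMonoid.of w)

/-- The dual monoid `M(P_c)`. -/
abbrev DualMonoid (R : Set G) (c : G) : Type _ := PresentedMonoid (DualRel R c)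

/-- The generator of `M(P_c)` attached to `w ∈ P_c`. -/
def DualMonoid.gen {R : Set G} {c : G} (w : divisors R c) : DualMonoid R c :=
  PresentedMonoid.of (DualRel R c) w

/-- `R` is stable under conjugation. -/
def ConjStable (R : Set G) : Prop := ∀ g : G, ∀ r ∈ R, g * r * g⁻¹ ∈ R

theorem genLength_conj_set {R : Set G} (hR : ConjStable R) (g w : G) (k : ℕ)
    (h : ∃ l : List G, (∀ r ∈ l, r ∈ R) ∧ l.prod = w ∧ l.length = k) :
    ∃ l : List G, (∀ r ∈ l, r ∈ R) ∧ l.prod = g * w * g⁻¹ ∧ l.length = k := by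
  obtain ⟨l, hl, hp, hk⟩ := h
  refine ⟨l.map (MulAut.conj g), ?_, ?_, by simpa using hk⟩
  · intro r hr
    obtain ⟨s, hs, rfl⟩ := List.mem_map.1 hr
    exact hR g s (hl s hs)
  · rw [← map_list_prod, hp, MulAut.conj_apply]

theorem genLength_conj {R : Set G} (hR : ConjStable R) (g w : G) :
    genLength R (g * w * g⁻¹) = genLength R w := by
  unfold genLength
  congr 1
  ext k
  constructor
  · intro h
    have h2 := genLength_conj_set hR g⁻¹ _ k h
    have h3 : g⁻¹ * (g * w * g⁻¹) * g⁻¹⁻¹ = w := by group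
    rwa [h3] at h2
  · exact genLength_conj_set hR g w k

theorem conj_mem_divisors {R : Set G} (hR : ConjStable R) {c g p : G} (hg : g * c * g⁻¹ = c)
    (hp : p ∈ divisors R c) : g * p * g⁻¹ ∈ divisors R c := by
  obtain ⟨q, hq, hl⟩ := hp
  refine ⟨g * q * g⁻¹, ?_, ?_⟩
  · rw [← hg, hq]
    group
  · rw [genLength_conj hR, genLength_conj hR, hl]

/-- The endomorphism of `M(P_c)` induced by conjugation by an element `g` commuting with `c`. -/
def conjHom {R : Set G} (hR : ConjStable R) {c : G} (g : G) (hg : g * c * g⁻¹ = c) :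
    DualMonoid R c →* DualMonoid R c :=
  PresentedMonoid.lift
    (fun w : divisors R c => (DualMonoid.gen ⟨g * (w : G) * g⁻¹, conj_mem_divisors hR hg w.2⟩ : DualMonoid R c)) (by
      intro a b h
      cases h with
      | one e he =>
        simp only [FreeMonoid.lift_eval_of, map_one]
        exact PresentedMonoid.mk_eq_mk_of_rel (DualRel.one _ (by simp [he]))
      | mul u v w hw hl =>
        simp only [FreeMonoid.lift_eval_of, map_mul]
        refine PresentedMonoid.mk_eq_mk_of_rel (DualRel.mul _ _ _ ?_ ?_)
        · simp [hw]
        · simpa only [genLength_conj hR] using hl)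

theorem conjHom_comp {R : Set G} (hR : ConjStable R) {c : G} (g h : G)
    (hg : g * c * g⁻¹ = c) (hh : h * c * h⁻¹ = c) (hgh : g * h = 1) :
    (conjHom hR g hg).comp (conjHom hR h hh) = MonoidHom.id (DualMonoid R c) := by
  apply PresentedMonoid.ext
  intro x
  obtain rfl : h = g⁻¹ := eq_inv_of_mul_eq_one_right hgh
  change conjHom hR g hg (conjHom hR g⁻¹ hh (PresentedMonoid.of _ x)) = _
  simp only [conjHom, DualMonoid.gen, PresentedMonoid.lift_of, MonoidHom.id_apply]
  congr 1
  apply Subtype.ext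
  simp [mul_assoc]

/-- Conjugation by `c`: the automorphism of `M(P_c)` sending the generator of `w ∈ P_c`
to the generator of `c w c⁻¹`. -/
def conjAut {R : Set G} (hR : ConjStable R) (c : G) : MulAut (DualMonoid R c) :=
  MonoidHom.toMulEquiv (conjHom hR c (by group)) (conjHom hR c⁻¹ (by group))
    (conjHom_comp hR _ _ _ _ (by group)) (conjHom_comp hR _ _ _ _ (by group))

end DualMonoid

/-! ## The Coxeter group of type `Ã_{n-1}` as a group of periodic permutations of `ℤ` -/

section AffineSymm

theorem periodic_mul {n : ℕ} {v : Equiv.Perm ℤ} (hv : ∀ x, v (x + n) = v x + n) (x k : ℤ) :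
    v (x + n * k) = v x + n * k := by
  induction k with
  | zero => simp
  | succ i ih => rw [mul_add, mul_one, ← add_assoc, hv, ih, add_assoc]
  | pred i ih =>
    have h := hv (x + n * (-(i : ℤ) - 1))
    have e : x + n * (-(i : ℤ) - 1) + n = x + n * (-(i : ℤ)) := by ring
    rw [e, ih] at h
    linarith

theorem inv_periodic {n : ℕ} {v : Equiv.Perm ℤ} (hv : ∀ x, v (x + n) = v x + n) (x : ℤ) :
    v⁻¹ (x + n) = v⁻¹ x + n := by
  apply v.injective
  rw [hv]
  simp

/-- The sum over one period of an `n`-periodic function does not change under composition with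
an `n`-periodic permutation. -/
theorem sum_comp_periodic {n : ℕ} (hn : 0 < n) {v : Equiv.Perm ℤ}
    (hv : ∀ x, v (x + n) = v x + n) {g : ℤ → ℤ} (hg : ∀ x k, g (x + n * k) = g x) :
    ∑ x ∈ Finset.Icc (1 : ℤ) n, g (v x) = ∑ x ∈ Finset.Icc (1 : ℤ) n, g x := by
  have hn' : (0 : ℤ) < n := by exact_mod_cast hn
  have mem : ∀ y : ℤ, (y - 1) % n + 1 ∈ Finset.Icc (1 : ℤ) n := by
    intro y
    have h1 := Int.emod_nonneg (y - 1) hn'.ne'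
    have h2 := Int.emod_lt_of_pos (y - 1) hn'
    rw [Finset.mem_Icc]
    constructor <;> linarith
  have red : ∀ y : ℤ, (y - 1) % n + 1 = y + n * (-((y - 1) / n)) := by
    intro y
    have := Int.emod_add_mul_ediv (y - 1) n
    linarith
  have key : ∀ x ∈ Finset.Icc (1 : ℤ) n, ∀ k : ℤ, ((x + n * k) - 1) % n + 1 = x := by
    intro x hx k
    rw [Finset.mem_Icc] at hx
    have e : x + n * k - 1 = (x - 1) + n * k := by ring
    rw [e, Int.add_mul_emod_self_left, Int.emod_eq_of_lt (by linarith) (by linarith)]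
    ring
  refine Finset.sum_nbij' (fun x => (v x - 1) % n + 1) (fun x => (v⁻¹ x - 1) % n + 1)
    (fun x _ => mem _) (fun x _ => mem _) ?_ ?_ ?_
  · intro x hx
    simp only [red (v x)]
    rw [periodic_mul (inv_periodic hv), show v⁻¹ (v x) = x from v.symm_apply_apply x]
    exact key x hx _
  · intro x hx
    simp only [red (v⁻¹ x)]
    rw [periodic_mul hv, show v (v⁻¹ x) = x from v.apply_symm_apply x]
    exact key x hx _
  · intro x _
    simp only [red (v x), hg]

theorem disp_periodic {n : ℕ} {v : Equiv.Perm ℤ} (hv : ∀ x, v (x + n) = v x + n) (x k : ℤ) :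
    v (x + n * k) - (x + n * k) = v x - x := by
  rw [periodic_mul hv]
  ring

/-- The Coxeter group `W` of type `Ã_{n-1}`: the `n`-periodic permutations `w` of `ℤ` whose shift
`(1/n) ∑_{x=1}^{n} (w(x) - x)` is zero. -/
def AffineSymm (n : ℕ) [n.AtLeastTwo] : Subgroup (Equiv.Perm ℤ) where
  carrier := {w | (∀ x, w (x + n) = w x + n) ∧ ∑ x ∈ Finset.Icc (1 : ℤ) n, (w x - x) = 0}
  one_mem' := by simp
  mul_mem' := by
    rintro u v ⟨hu, hu0⟩ ⟨hv, hv0⟩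
    refine ⟨fun x => by simp [hu, hv], ?_⟩
    have h := sum_comp_periodic (NeZero.pos n) hv (g := fun y => u y - y) (disp_periodic hu)
    calc ∑ x ∈ Finset.Icc (1 : ℤ) n, ((u * v) x - x)
        = ∑ x ∈ Finset.Icc (1 : ℤ) n, ((u (v x) - v x) + (v x - x)) :=
          Finset.sum_congr rfl fun x _ => by simp
      _ = 0 := by rw [Finset.sum_add_distrib, h, hu0, hv0, add_zero]
  inv_mem' := by
    rintro v ⟨hv, hv0⟩
    refine ⟨inv_periodic hv, ?_⟩
    have h := sum_comp_periodic (NeZero.pos n) (inv_periodic hv) (g := fun y => v y - y)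
      (disp_periodic hv)
    rw [hv0] at h
    rw [← neg_eq_zero, ← Finset.sum_neg_distrib, ← h]
    exact Finset.sum_congr rfl fun x _ => by simp

/-- The map exchanging `i + kn` and `i + 1 + kn` for all `k ∈ ℤ`. -/
def simpleFun (n : ℕ) (i x : ℤ) : ℤ :=
  if (n : ℤ) ∣ x - i then x + 1 else if (n : ℤ) ∣ x - (i + 1) then x - 1 else x

theorem not_dvd_consecutive (n : ℕ) [n.AtLeastTwo] (y : ℤ) (h : (n : ℤ) ∣ y) :
    ¬ (n : ℤ) ∣ y + 1 := by
  intro h2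
  have h3 : (n : ℤ) ∣ 1 := by simpa using dvd_sub h2 h
  have h4 : 2 ≤ n := Nat.AtLeastTwo.prop
  have h5 := Int.le_of_dvd one_pos h3
  omega

theorem simpleFun_involutive (n : ℕ) [n.AtLeastTwo] (i : ℤ) :
    Function.Involutive (simpleFun n i) := by
  intro x
  unfold simpleFun
  by_cases h1 : (n : ℤ) ∣ x - i
  · have h2 : ¬ (n : ℤ) ∣ x + 1 - i := by
      have := not_dvd_consecutive n _ h1
      rwa [show x + 1 - i = x - i + 1 by ring]
    have h3 : (n : ℤ) ∣ x + 1 - (i + 1) := by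
      rwa [show x + 1 - (i + 1) = x - i by ring]
    simp only [if_pos h1, if_neg h2, if_pos h3]
    ring
  · by_cases h2 : (n : ℤ) ∣ x - (i + 1)
    · have h3 : (n : ℤ) ∣ x - 1 - i := by rwa [show x - 1 - i = x - (i + 1) by ring]
      simp only [if_neg h1, if_pos h2, if_pos h3]
      ring
    · simp only [if_neg h1, if_neg h2]

theorem simple_mem (n : ℕ) [n.AtLeastTwo] (i : ℤ) :
    (simpleFun_involutive n i).toPerm ∈ AffineSymm n := by
  refine ⟨fun x => ?_, ?_⟩
  · simp only [Function.Involutive.coe_toPerm, simpleFun]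
    have e1 : (n : ℤ) ∣ x + n - i ↔ (n : ℤ) ∣ x - i := by
      rw [show x + n - i = x - i + n by ring]
      exact dvd_add_self_right
    have e2 : (n : ℤ) ∣ x + n - (i + 1) ↔ (n : ℤ) ∣ x - (i + 1) := by
      rw [show x + n - (i + 1) = x - (i + 1) + n by ring]
      exact dvd_add_self_right
    simp only [e1, e2]
    split_ifs <;> ring
  · have h := sum_comp_periodic (NeZero.pos n) (v := Equiv.addRight (-1 : ℤ))
      (g := fun x => if (n : ℤ) ∣ x - i then 1 else 0) (fun x => by simp; ring) (fun x k => by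
        have e : (n : ℤ) ∣ x + n * k - i ↔ (n : ℤ) ∣ x - i := by
          rw [show x + n * k - i = x - i + n * k by ring]
          exact (Int.dvd_add_left (dvd_mul_right _ _))
        simp only [e])
    rw [← sub_eq_zero, ← Finset.sum_sub_distrib] at h
    rw [← neg_eq_zero, ← Finset.sum_neg_distrib, ← h]
    refine Finset.sum_congr rfl fun x _ => ?_
    simp only [Function.Involutive.coe_toPerm, simpleFun, Equiv.coe_addRight]
    have e : x + -1 - i = x - (i + 1) := by ring
    simp only [e]
    by_cases h1 : (n : ℤ) ∣ x - i
    · have h2 : ¬ (n : ℤ) ∣ x - (i + 1) := by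
        intro h2
        apply not_dvd_consecutive n _ h2
        rwa [show x - (i + 1) + 1 = x - i by ring]
      simp [h1, h2]
    · by_cases h2 : (n : ℤ) ∣ x - (i + 1)
      · simp [h1, h2]
      · simp [h1, h2]

/-- The Coxeter generator `s_i = (i, i+1)` of `W`; it depends only on `i` modulo `n`. -/
def simpleRefl (n : ℕ) [n.AtLeastTwo] (i : ℤ) : AffineSymm n :=
  ⟨(simpleFun_involutive n i).toPerm, simple_mem n i⟩

/-- The set of reflections of `W`: the conjugates of `s_1, …, s_n`. -/
def reflections (n : ℕ) [n.AtLeastTwo] : Set (AffineSymm n) :=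
  {r | ∃ i ∈ Set.Icc (1 : ℤ) n, IsConj (simpleRefl n i) r}

theorem reflections_conjStable (n : ℕ) [n.AtLeastTwo] : ConjStable (reflections n) := by
  rintro g r ⟨i, hi, h⟩
  exact ⟨i, hi, h.trans (isConj_iff.2 ⟨g, rfl⟩)⟩

/-- The Coxeter elements of `W`: the products of `s_1, …, s_n`, each taken once, in any order. -/
def CoxeterElement (n : ℕ) [n.AtLeastTwo] : Type :=
  {c : AffineSymm n // ∃ l : List ℕ, l.Perm (List.range' 1 n) ∧
    c = (l.map fun i : ℕ => simpleRefl n i).prod}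

namespace CoxeterElement

variable {n : ℕ} [n.AtLeastTwo]

/-- The set `X`, union of the orbits of `c` of shift `1`: for such an orbit one has
`c^k(x) = x + n`, where `k` is the number of classes modulo `n` met by the orbit. -/
def X (c : CoxeterElement n) : Set ℤ :=
  {x | ∃ k : ℕ, 0 < k ∧ ((c.1 ^ k : AffineSymm n) : Equiv.Perm ℤ) x = x + n}

/-- The set `Ξ`, union of the orbits of `c` of shift `-1`. -/
def Xi (c : CoxeterElement n) : Set ℤ :=
  {x | ∃ k : ℕ, 0 < k ∧ ((c.1 ^ k : AffineSymm n) : Equiv.Perm ℤ) x = x - n}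

/-- `|X ∩ [1, n]|`. -/
noncomputable def cardX (c : CoxeterElement n) : ℕ := (c.X ∩ Set.Icc 1 (n : ℤ)).ncard

/-- `|Ξ ∩ [1, n]|`. -/
noncomputable def cardXi (c : CoxeterElement n) : ℕ := (c.Xi ∩ Set.Icc 1 (n : ℤ)).ncard

/-- The set `P_c` of divisors of `c` with respect to the reflection length. -/
abbrev P (c : CoxeterElement n) : Set (AffineSymm n) := divisors (reflections n) c.1

/-- The dual monoid `M(P_c)`. -/
abbrev M (c : CoxeterElement n) : Type := DualMonoid (reflections n) c.1

/-- The orbit of `m ∈ M(P_c)` under (powers of) conjugation by `c`. -/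
def conjOrbit (c : CoxeterElement n) (m : c.M) : Set c.M :=
  {m' | ∃ k : ℤ, ((conjAut (reflections_conjStable n) c.1) ^ k) m = m'}

end CoxeterElement

/-- Coxeter elements are identified when their dual monoids are isomorphic, so that the quotient is
the set of isomorphism classes of the monoids `M(P_c)`. -/
def dualIso (n : ℕ) [n.AtLeastTwo] : Setoid (CoxeterElement n) where
  r c c' := Nonempty (c.M ≃* c'.M)
  iseqv := ⟨fun _ => ⟨MulEquiv.refl _⟩, fun ⟨e⟩ => ⟨e.symm⟩, fun ⟨e⟩ ⟨f⟩ => ⟨e.trans f⟩⟩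

end AffineSymm

/-! ### Length and divisors for a generating set -/

section GenLength

variable {G : Type*} [Group G] {R : Set G}

theorem genLength_le_length {l : List G} (hl : ∀ r ∈ l, r ∈ R) :
    genLength R l.prod ≤ l.length :=
  Nat.sInf_le ⟨l, hl, rfl, rfl⟩

/-- Every element is a product of elements of `R`. -/
def Generates (R : Set G) : Prop := ∀ g : G, ∃ l : List G, (∀ r ∈ l, r ∈ R) ∧ l.prod = g

theorem Generates.exists_list (h : Generates R) (g : G) :
    ∃ l : List G, (∀ r ∈ l, r ∈ R) ∧ l.prod = g ∧ l.length = genLength R g := by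
  obtain ⟨l, hl, hp⟩ := h g
  exact Nat.sInf_mem (s := {k | ∃ l : List G, (∀ r ∈ l, r ∈ R) ∧ l.prod = g ∧ l.length = k})
    ⟨l.length, l, hl, hp, rfl⟩

theorem genLength_one : genLength R 1 = 0 :=
  Nat.le_zero.1 (genLength_le_length (R := R) (l := []) (by simp))

theorem Generates.genLength_eq_zero (h : Generates R) {g : G} : genLength R g = 0 ↔ g = 1 := by
  refine ⟨fun h0 => ?_, fun h1 => h1 ▸ genLength_one⟩
  obtain ⟨l, -, hp, hk⟩ := h.exists_list g
  rw [h0, List.length_eq_zero_iff] at hk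
  rw [← hp, hk, List.prod_nil]

theorem Generates.genLength_mul_le (h : Generates R) (u v : G) :
    genLength R (u * v) ≤ genLength R u + genLength R v := by
  obtain ⟨l, hl, hp, hk⟩ := h.exists_list u
  obtain ⟨m, hm, hq, hj⟩ := h.exists_list v
  rw [← hp, ← hq, ← List.prod_append, hp, hq, ← hk, ← hj, ← List.length_append]
  exact genLength_le_length fun r hr => (List.mem_append.1 hr).elim (hl r) (hm r)

theorem genLength_le_one {r : G} (hr : r ∈ R) : genLength R r ≤ 1 := by
  simpa using genLength_le_length (R := R) (l := [r]) (by simpa using hr)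

theorem Generates.genLength_of_mem (h : Generates R) (h1 : (1 : G) ∉ R) {r : G} (hr : r ∈ R) :
    genLength R r = 1 := by
  refine le_antisymm (genLength_le_one hr) (Nat.one_le_iff_ne_zero.2 fun h0 => ?_)
  rw [h.genLength_eq_zero] at h0
  exact h1 (h0 ▸ hr)

/-- A factor of a product of elements of a conjugation-stable set can be moved to the front. -/
theorem exists_list_cons_of_mem (hR : ConjStable R) {l : List G} (hl : ∀ r ∈ l, r ∈ R) {s : G}
    (hs : s ∈ l) :
    ∃ m : List G, (∀ r ∈ m, r ∈ R) ∧ s * m.prod = l.prod ∧ m.length + 1 = l.length := by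
  obtain ⟨l₁, l₂, rfl⟩ := List.append_of_mem hs
  refine ⟨l₁.map (MulAut.conj s⁻¹) ++ l₂, ?_, ?_, ?_⟩
  · intro r hr
    rcases List.mem_append.1 hr with hr | hr
    · obtain ⟨t, ht, rfl⟩ := List.mem_map.1 hr
      exact hR s⁻¹ t (hl t (by simp [ht]))
    · exact hl r (by simp [hr])
  · rw [List.prod_append, ← map_list_prod, MulAut.conj_apply, List.prod_append, List.prod_cons]
    group
  · simp
    omega

section Divisors

variable {c : G}

/-- If c = uvq is length-additive, the triangle inequality for vq and for u(vq) squeezes l(c)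
between l(u) + l(vq) and itself. -/
theorem Generates.left_mem_divisors (h : Generates R) {u v : G} (huv : u * v ∈ divisors R c)
    (hl : genLength R (u * v) = genLength R u + genLength R v) : u ∈ divisors R c := by
  obtain ⟨q, hq, hc⟩ := huv
  refine ⟨v * q, by rw [hq, mul_assoc], le_antisymm ?_ ?_⟩
  · rw [hq, mul_assoc]
    exact h.genLength_mul_le _ _
  · have := h.genLength_mul_le v q
    omega

/-- Writing uv = v(v⁻¹uv) turns the right factor into a left one, and conjugation does not change
the length. -/
theorem Generates.right_mem_divisors (h : Generates R) (hR : ConjStable R) {u v : G}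
    (huv : u * v ∈ divisors R c)
    (hl : genLength R (u * v) = genLength R u + genLength R v) : v ∈ divisors R c := by
  have e : u * v = v * (v⁻¹ * u * v⁻¹⁻¹) := by group
  have hc := genLength_conj hR v⁻¹ u
  rw [e] at huv
  refine h.left_mem_divisors huv ?_
  rw [← e, hl, hc, add_comm]

theorem mem_divisors_iff {p : G} :
    p ∈ divisors R c ↔ genLength R c = genLength R p + genLength R (p⁻¹ * c) := by
  constructor
  · rintro ⟨q, rfl, h⟩
    simpa using h
  · intro h
    exact ⟨p⁻¹ * c, by simp, h⟩

/-- If `c = r s q` with `l(q) + 2 ≤ l(c)`, then `rs` is a divisor of `c` of length `2`. -/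
theorem Generates.mul_mem_divisors (h : Generates R) {r s q : G}
    (hr : r ∈ R) (hs : s ∈ R) (hc : c = r * s * q) (hq : genLength R q + 2 ≤ genLength R c) :
    r * s ∈ divisors R c ∧ genLength R (r * s) = 2 := by
  have h1 := h.genLength_mul_le (r * s) q
  have h2 := h.genLength_mul_le r s
  have h3 := genLength_le_one hr
  have h4 := genLength_le_one hs
  rw [← hc] at h1
  exact ⟨⟨q, hc, by omega⟩, by omega⟩

end Divisors

end GenLength

/-! ### Atoms of the dual monoid and products of two atoms -/

namespace DualMonoid

variable {G : Type*} [Group G] {R : Set G} {c : G}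

/-- The canonical morphism from the dual monoid to the group. -/
def toGroup (R : Set G) (c : G) : DualMonoid R c →* G :=
  PresentedMonoid.lift (fun w : divisors R c => (w : G)) (by
    intro a b h
    cases h with
    | one e he => simpa using he
    | mul u v w hw hl => simp [hw])

@[simp]
theorem toGroup_gen (w : divisors R c) : toGroup R c (gen w) = w :=
  PresentedMonoid.lift_of _ _

theorem gen_injective : Function.Injective (gen : divisors R c → DualMonoid R c) := by
  intro u v h
  apply Subtype.ext
  rw [← toGroup_gen u, h, toGroup_gen]

theorem gen_one {w : divisors R c} (hw : (w : G) = 1) : gen w = 1 :=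
  PresentedMonoid.mk_eq_mk_of_rel (DualRel.one w hw)

theorem gen_mul_gen {u v w : divisors R c} (hw : (w : G) = u * v)
    (hl : genLength R (w : G) = genLength R (u : G) + genLength R (v : G)) :
    gen u * gen v = gen w :=
  PresentedMonoid.mk_eq_mk_of_rel (DualRel.mul u v w hw hl)

/-- The additive length on the dual monoid extending `l_R`. -/
noncomputable def length (R : Set G) (c : G) : DualMonoid R c →* Multiplicative ℕ :=
  PresentedMonoid.lift (fun w : divisors R c => Multiplicative.ofAdd (genLength R (w : G))) (by
    intro a b h
    cases h with
    | one e he => simp [he, genLength_one]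
    | mul u v w hw hl => simp [hl])

theorem length_gen (w : divisors R c) :
    length R c (gen w) = Multiplicative.ofAdd (genLength R (w : G)) :=
  PresentedMonoid.lift_of _ _

@[elab_as_elim]
theorem induction_gen {p : DualMonoid R c → Prop} (m : DualMonoid R c) (one : p 1)
    (gen_mul : ∀ (w : divisors R c) (m : DualMonoid R c), p m → p (gen w * m)) : p m := by
  obtain ⟨l, rfl⟩ := PresentedMonoid.surjective_mk (rels := DualRel R c) m
  induction l using FreeMonoid.inductionOn' with
  | one => exact one
  | of_mul w l ih => exact gen_mul w _ ih

theorem eq_one_of_length (h : Generates R) {m : DualMonoid R c} (hm : length R c m = 1) :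
    m = 1 := by
  induction m using induction_gen with
  | one => rfl
  | gen_mul w m ih =>
    rw [map_mul, length_gen] at hm
    have h1 : genLength R (w : G) + (length R c m).toAdd = 0 := hm
    have h2 : length R c m = 1 := Multiplicative.toAdd.injective (Nat.eq_zero_of_add_eq_zero_left h1)
    rw [ih h2, gen_one (h.genLength_eq_zero.1 (by omega)), one_mul]

/-- The atoms of the dual monoid are the generators attached to the elements of `R ∩ P_c`. -/
theorem irreducible_iff (h : Generates R) (hR : ConjStable R) (h1 : (1 : G) ∉ R) {m : DualMonoid R c} :
    Irreducible m ↔ ∃ r : divisors R c, (r : G) ∈ R ∧ gen r = m := by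
  -- A unit has invertible length in the additive monoid ℕ, hence length 0.
  have unit : ∀ x : DualMonoid R c, IsUnit x ↔ x = 1 := by
    intro x
    refine ⟨fun hx => eq_one_of_length h ?_, fun hx => hx ▸ isUnit_one⟩
    have := hx.map (length R c)
    obtain ⟨u, hu⟩ := this
    have e : (u : Multiplicative ℕ).toAdd + ((u⁻¹ : (Multiplicative ℕ)ˣ) : Multiplicative ℕ).toAdd
      = 0 := by rw [← toAdd_mul, Units.mul_inv, toAdd_one]
    rw [← hu]
    exact Multiplicative.toAdd.injective (by simp at e ⊢; omega)
  constructor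
  · intro hm
    -- The first letter of a shortest expression of a nontrivial generator splits off on the left as
    -- an atom.
    have key : ∀ x : DualMonoid R c, x ≠ 1 → ∃ (r : divisors R c) (y : DualMonoid R c),
        (r : G) ∈ R ∧ x = gen r * y := by
      intro x
      induction x using induction_gen with
      | one => intro hx; exact absurd rfl hx
      | gen_mul w x ih =>
        intro hx
        by_cases hw : (w : G) = 1
        · rw [gen_one hw, one_mul] at hx ⊢
          exact ih hx
        · obtain ⟨l, hl, hp, hk⟩ := h.exists_list (w : G)
          cases l with
          | nil => exact absurd (by simpa using hp.symm) hw
          | cons r l =>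
            rw [List.prod_cons] at hp
            have hr : r ∈ R := hl r (by simp)
            have hlen : genLength R (r * l.prod) = genLength R r + genLength R l.prod := by
              have e1 := h.genLength_mul_le r l.prod
              have e2 := genLength_le_length (R := R) (l := l) fun s hs => hl s (by simp [hs])
              have e3 := genLength_le_one hr
              rw [← hp, List.length_cons] at hk
              omega
            have hm : r * l.prod ∈ divisors R c := hp ▸ w.2
            have d1 := h.left_mem_divisors hm hlen
            have d2 : l.prod ∈ divisors R c := h.right_mem_divisors hR hm hlen
            have hlen' : genLength R (w : G) = genLength R r + genLength R l.prod := by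
              rw [← hp, hlen]
            refine ⟨⟨r, d1⟩, gen ⟨l.prod, d2⟩ * x, hr, ?_⟩
            rw [← mul_assoc, gen_mul_gen (w := w) hp.symm hlen']
    obtain ⟨r, y, hr, rfl⟩ := key m fun e => hm.not_isUnit ((unit m).2 e)
    refine ⟨r, hr, ?_⟩
    rcases hm.isUnit_or_isUnit rfl with hu | hu
    · rw [unit] at hu
      have := congrArg (toGroup R c) hu
      rw [toGroup_gen, map_one] at this
      exact absurd (this ▸ hr) h1
    · rw [unit] at hu
      rw [hu, mul_one]
  · rintro ⟨r, hr, rfl⟩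
    constructor
    · rw [unit]
      intro e
      have := congrArg (toGroup R c) e
      rw [toGroup_gen, map_one] at this
      exact h1 (this ▸ hr)
    · intro x y hxy
      have e := congrArg (fun z => (length R c z).toAdd) hxy
      simp only [length_gen, map_mul, toAdd_ofAdd, toAdd_mul, h.genLength_of_mem h1 hr] at e
      rcases Nat.eq_zero_or_pos (length R c x).toAdd with h0 | h0
      · exact Or.inl ((unit x).2 (eq_one_of_length h (Multiplicative.toAdd.injective h0)))
      · exact Or.inr ((unit y).2 (eq_one_of_length h
          (Multiplicative.toAdd.injective (Nat.eq_zero_of_not_pos fun h2 => by omega))))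

open Classical in
/-- The syntactic congruence of the words which become `[r, s]` once trivial letters are removed. -/
def wordCon (r s : divisors R c) : Con (FreeMonoid (divisors R c)) where
  r u v := ∀ x y : FreeMonoid (divisors R c),
    (x * u * y).toList.filter (fun w : divisors R c => (w : G) ≠ 1) = [r, s] ↔
      (x * v * y).toList.filter (fun w : divisors R c => (w : G) ≠ 1) = [r, s]
  iseqv := ⟨fun _ _ _ => Iff.rfl, fun h x y => (h x y).symm, fun h k x y => (h x y).trans (k x y)⟩
  mul' := by
    intro a b a' b' h k x y
    have h1 := h x (a' * y)
    have h2 := k (x * b) y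
    simp only [mul_assoc] at h1 h2 ⊢
    exact h1.trans h2

/-- If `rs` is not a divisor of length `2`, then `r s` is the only expression of its value as a
product of two atoms. -/
theorem gen_mul_gen_inj (h : Generates R) (h1 : (1 : G) ∉ R) {r s r' s' : divisors R c}
    (hr : (r : G) ∈ R) (hs : (s : G) ∈ R) (hr' : (r' : G) ∈ R) (hs' : (s' : G) ∈ R)
    (hrs : ¬ ((r : G) * s ∈ divisors R c ∧ genLength R ((r : G) * s) = 2))
    (he : gen r * gen s = gen r' * gen s') : r' = r ∧ s' = s := by
  classical
  have ne : ∀ {t : divisors R c}, (t : G) ∈ R → (t : G) ≠ 1 := fun ht e => h1 (e ▸ ht)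
  -- Enough to check the defining relations: if none of them can alter the word [r, s] except by
  -- trivial letters, then every word with the same value reduces to [r, s].
  have hle : conGen (DualRel R c) ≤ wordCon r s := by
    rw [Con.conGen_le]
    intro a b hab x y
    cases hab with
    | one e he => simp [he]
    | mul u v w hw hl =>
      by_cases hu : (u : G) = 1
      · have : w = v := Subtype.ext (by simp [hw, hu])
        simp [hu, this]
      by_cases hv : (v : G) = 1
      · have : w = u := Subtype.ext (by simp [hw, hv])
        simp [hv, this, List.filter_cons]
      have hu0 : genLength R (u : G) ≠ 0 := fun e => hu (h.genLength_eq_zero.1 e)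
      have hv0 : genLength R (v : G) ≠ 0 := fun e => hv (h.genLength_eq_zero.1 e)
      have hw0 : (w : G) ≠ 1 := by
        intro e
        rw [e, genLength_one] at hl
        omega
      have lr := h.genLength_of_mem h1 hr
      have ls := h.genLength_of_mem h1 hs
      simp only [FreeMonoid.toList_mul, FreeMonoid.toList_of, List.filter_append]
      constructor
      -- Two adjacent nontrivial letters u, v already fill the word, so u = r and v = s. Then w = rs
      -- is a divisor of length 2, which is excluded.
      · intro e
        exfalso
        have e2 : List.filter (fun w : divisors R c => (w : G) ≠ 1) [u] = [u] := by simp [hu]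
        have e3 : List.filter (fun w : divisors R c => (w : G) ≠ 1) [v] = [v] := by simp [hv]
        rw [e2, e3] at e
        have len := congrArg List.length e
        simp only [List.length_append, List.length_cons, List.length_nil] at len
        have l1 := List.length_eq_zero_iff.1 (show (List.filter (fun w : divisors R c =>
          (w : G) ≠ 1) x.toList).length = 0 by omega)
        have l2 := List.length_eq_zero_iff.1 (show (List.filter (fun w : divisors R c =>
          (w : G) ≠ 1) y.toList).length = 0 by omega)
        rw [l1, l2] at e
        obtain ⟨rfl, rfl⟩ : u = r ∧ v = s := by simpa using e
        exact hrs ⟨hw ▸ w.2, by rw [← hw, hl, lr, ls]⟩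
      -- In the other direction w would be one of the letters r, s of length 1, yet its length is at
      -- least 2.
      · intro e
        exfalso
        have e2 : List.filter (fun w : divisors R c => (w : G) ≠ 1) [w] = [w] := by simp [hw0]
        rw [e2] at e
        have hm : w ∈ [r, s] := by rw [← e]; simp
        have : w = r ∨ w = s := by simpa using hm
        rcases this with rfl | rfl <;> omega
  have key := hle (PresentedMonoid.mk_eq_mk_iff.1
    (show PresentedMonoid.mk (DualRel R c) (FreeMonoid.of r * FreeMonoid.of s) =
      PresentedMonoid.mk (DualRel R c) (FreeMonoid.of r' * FreeMonoid.of s') from he)) 1 1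
  simpa [ne hr, ne hs, ne hr', ne hs', Subtype.ext_iff] using key

end DualMonoid

/-! ### Isomorphism invariants built from atoms -/

section Partners

variable {M N : Type*} [Monoid M] [Monoid N]

/-- The atoms `s` such that `m s` has another expression as a product of two atoms. -/
def atomPartners (m : M) : Set M :=
  {s | Irreducible s ∧ ∃ r' s', Irreducible r' ∧ Irreducible s' ∧ ¬ (r' = m ∧ s' = s) ∧
    m * s = r' * s'}

/-- The atoms with finitely many partners. -/
def finiteAtoms (M : Type*) [Monoid M] : Set M := {m | Irreducible m ∧ (atomPartners m).Finite}

theorem mem_atomPartners_map (e : M ≃* N) {m s : M} (h : s ∈ atomPartners m) :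
    e s ∈ atomPartners (e m) := by
  obtain ⟨hs, r', s', hr', hs', hne, h⟩ := h
  refine ⟨(MulEquiv.irreducible_iff e).2 hs, e r', e s', (MulEquiv.irreducible_iff e).2 hr',
    (MulEquiv.irreducible_iff e).2 hs', ?_, by rw [← map_mul, h, map_mul]⟩
  simpa using hne

theorem atomPartners_map (e : M ≃* N) (m : M) : atomPartners (e m) = e '' atomPartners m := by
  ext s
  constructor
  · intro hs
    exact ⟨e.symm s, by simpa using mem_atomPartners_map e.symm hs, by simp⟩
  · rintro ⟨t, ht, rfl⟩
    exact mem_atomPartners_map e ht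

theorem mem_finiteAtoms_map (e : M ≃* N) (m : M) : e m ∈ finiteAtoms N ↔ m ∈ finiteAtoms M := by
  simp only [finiteAtoms, Set.mem_ofPred_eq, MulEquiv.irreducible_iff e, atomPartners_map,
    Set.finite_image_iff e.injective.injOn]

theorem ncard_atomPartners_map (e : M ≃* N) (m : M) :
    (atomPartners (e m) ∩ finiteAtoms N).ncard = (atomPartners m ∩ finiteAtoms M).ncard := by
  rw [← Set.ncard_image_of_injective (atomPartners m ∩ finiteAtoms M) e.injective]
  congr 1
  ext x
  rw [atomPartners_map]
  constructor
  · rintro ⟨⟨y, hy, rfl⟩, hx⟩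
    exact ⟨y, ⟨hy, (mem_finiteAtoms_map e y).1 hx⟩, rfl⟩
  · rintro ⟨y, ⟨hy, hf⟩, rfl⟩
    exact ⟨⟨y, hy, rfl⟩, (mem_finiteAtoms_map e y).2 hf⟩

end Partners

/-! ### Partners in the dual monoid; functoriality -/

namespace DualMonoid

variable {G : Type*} [Group G] {R : Set G} {c : G}

/-- When rs is a divisor of length 2, a second factorization is (rsr⁻¹)·r. It differs from r·s
because r = s would give rs = 1. In all other cases `gen_mul_gen_inj` rules out a second
factorization. -/
theorem atomPartners_gen (h : Generates R) (hR : ConjStable R) (h1 : (1 : G) ∉ R)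
    (hsq : ∀ r ∈ R, r * r = 1)
    {r : divisors R c} (hr : (r : G) ∈ R) :
    atomPartners (gen r) = gen '' {s : divisors R c | (s : G) ∈ R ∧ (r : G) * s ∈ divisors R c ∧
      genLength R ((r : G) * s) = 2} := by
  ext m
  constructor
  · rintro ⟨hm, r', s', hr', hs', hne, he⟩
    obtain ⟨s, hs, rfl⟩ := (irreducible_iff h hR h1).1 hm
    obtain ⟨r', hr₁, rfl⟩ := (irreducible_iff h hR h1).1 hr'
    obtain ⟨s', hs₁, rfl⟩ := (irreducible_iff h hR h1).1 hs'
    refine ⟨s, ⟨hs, ?_⟩, rfl⟩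
    by_contra hrs
    obtain ⟨rfl, rfl⟩ := gen_mul_gen_inj h h1 hr hs hr₁ hs₁ hrs he
    exact hne ⟨rfl, rfl⟩
  · rintro ⟨s, ⟨hs, hd, hl⟩, rfl⟩
    have lr := h.genLength_of_mem h1 hr
    have ls := h.genLength_of_mem h1 hs
    have e : (r : G) * s = (r : G) * s * (r : G)⁻¹ * r := by group
    have ht : (r : G) * s * (r : G)⁻¹ ∈ R := hR _ _ hs
    have lt := h.genLength_of_mem h1 ht
    have ht' : (r : G) * s * (r : G)⁻¹ ∈ divisors R c := by
      rw [e] at hd hl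
      exact h.left_mem_divisors hd (by omega)
    refine ⟨(irreducible_iff h hR h1).2 ⟨s, hs, rfl⟩, gen ⟨_, ht'⟩, gen r,
      (irreducible_iff h hR h1).2 ⟨_, ht, rfl⟩, (irreducible_iff h hR h1).2 ⟨r, hr, rfl⟩, ?_, ?_⟩
    · rintro ⟨h2, h3⟩
      have h4 := gen_injective h3
      subst h4
      rw [hsq _ hr, genLength_one] at hl
      omega
    · rw [gen_mul_gen (w := ⟨_, hd⟩) rfl (by dsimp; omega),
        gen_mul_gen (u := ⟨_, ht'⟩) (w := ⟨_, hd⟩) e (by dsimp; omega)]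

section Map

variable {H : Type*} [Group H] {S : Set H} {d : H}

theorem genLength_map (φ : G ≃* H) (hφ : ∀ r, φ r ∈ S ↔ r ∈ R) (g : G) :
    genLength S (φ g) = genLength R g := by
  unfold genLength
  congr 1
  ext k
  constructor
  · rintro ⟨l, hl, hp, hk⟩
    refine ⟨l.map φ.symm, ?_, ?_, by simpa using hk⟩
    · intro r hr
      obtain ⟨s, hs, rfl⟩ := List.mem_map.1 hr
      rw [← hφ]
      simpa using hl s hs
    · rw [← map_list_prod, hp]
      simp
  · rintro ⟨l, hl, hp, hk⟩
    refine ⟨l.map φ, ?_, by rw [← map_list_prod, hp], by simpa using hk⟩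
    intro r hr
    obtain ⟨s, hs, rfl⟩ := List.mem_map.1 hr
    exact (hφ s).2 (hl s hs)

theorem map_mem_divisors (φ : G ≃* H) (hφ : ∀ r, φ r ∈ S ↔ r ∈ R) (hc : φ c = d) {w : G}
    (hw : w ∈ divisors R c) : φ w ∈ divisors S d := by
  obtain ⟨q, hq, hl⟩ := hw
  refine ⟨φ q, by rw [← hc, hq, map_mul], ?_⟩
  rw [← hc, genLength_map φ hφ, genLength_map φ hφ, genLength_map φ hφ, hl]

/-- Functoriality of the dual monoid for isomorphisms of groups preserving the reflections. -/
def map (φ : G ≃* H) (hφ : ∀ r, φ r ∈ S ↔ r ∈ R) (hc : φ c = d) :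
    DualMonoid R c →* DualMonoid S d :=
  PresentedMonoid.lift (fun w : divisors R c =>
    (gen ⟨φ w, map_mem_divisors φ hφ hc w.2⟩ : DualMonoid S d)) (by
      intro a b h
      cases h with
      | one e he =>
        simp only [FreeMonoid.lift_eval_of, map_one]
        exact gen_one (by simp [he])
      | mul u v w hw hl =>
        simp only [FreeMonoid.lift_eval_of, map_mul]
        exact gen_mul_gen (by simp [hw]) (by simpa only [genLength_map φ hφ] using hl))

theorem map_gen (φ : G ≃* H) (hφ : ∀ r, φ r ∈ S ↔ r ∈ R) (hc : φ c = d) (w : divisors R c) :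
    map φ hφ hc (gen w) = gen ⟨φ w, map_mem_divisors φ hφ hc w.2⟩ :=
  PresentedMonoid.lift_of _ _

theorem map_comp_map (φ : G ≃* H) (ψ : H ≃* G) (hφ : ∀ r, φ r ∈ S ↔ r ∈ R) (hc : φ c = d)
    (hψ : ∀ r, ψ r ∈ R ↔ r ∈ S) (hd : ψ d = c) (h : ∀ g, ψ (φ g) = g) :
    (map ψ hψ hd).comp (map φ hφ hc) = MonoidHom.id (DualMonoid R c) := by
  apply PresentedMonoid.ext
  intro x
  change map ψ hψ hd (map φ hφ hc (gen x)) = gen x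
  rw [map_gen, map_gen]
  congr 1
  exact Subtype.ext (h _)

theorem nonempty_mulEquiv (φ : G ≃* H) (hφ : ∀ r, φ r ∈ S ↔ r ∈ R) (hc : φ c = d) :
    Nonempty (DualMonoid R c ≃* DualMonoid S d) := by
  have hψ : ∀ r, φ.symm r ∈ R ↔ r ∈ S := fun r => by rw [← hφ, φ.apply_symm_apply]
  have hd : φ.symm d = c := by rw [← hc, φ.symm_apply_apply]
  exact ⟨MonoidHom.toMulEquiv (map φ hφ hc) (map φ.symm hψ hd)
    (map_comp_map _ _ _ _ _ _ φ.symm_apply_apply) (map_comp_map _ _ _ _ _ _ φ.apply_symm_apply)⟩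

end Map

end DualMonoid

/-! ### Reflections as affine transpositions -/

section Reflections

variable {n : ℕ}

/-- The sign ε serves the later conjugations: 1 for permutations commuting with the translation by
n, -1 for those inverting it. -/
theorem apply_add_mul_of_sign {ε : ℤ} {g : Equiv.Perm ℤ}
    (hg : ∀ x, g (x + n) = g x + ε * n) (x k : ℤ) : g (x + n * k) = g x + n * (ε * k) := by
  induction k with
  | zero => simp
  | succ i ih => rw [mul_add, mul_one, ← add_assoc, hg, ih]; ring
  | pred i ih =>
    have h := hg (x + n * (-(i : ℤ) - 1))
    have e : x + n * (-(i : ℤ) - 1) + n = x + n * (-(i : ℤ)) := by ring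
    rw [e, ih] at h
    linarith

theorem dvd_apply_sub_of_sign {ε : ℤ} (hε : ε * ε = 1) {g : Equiv.Perm ℤ}
    (hg : ∀ x, g (x + n) = g x + ε * n) (x y : ℤ) : (n : ℤ) ∣ g x - g y ↔ (n : ℤ) ∣ x - y := by
  constructor
  · rintro ⟨k, hk⟩
    have h := apply_add_mul_of_sign hg y (ε * k)
    rw [← mul_assoc ε, hε, one_mul, ← hk, add_sub_cancel] at h
    exact ⟨ε * k, by rw [← g.injective h]; ring⟩
  · rintro ⟨k, hk⟩
    have h := apply_add_mul_of_sign hg y k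
    rw [← hk, add_sub_cancel] at h
    exact ⟨ε * k, by rw [h]; ring⟩

/-- The map exchanging `i + kn` and `j + kn` for all `k ∈ ℤ`. -/
def reflFun (n : ℕ) (i j x : ℤ) : ℤ :=
  if (n : ℤ) ∣ x - i then x + (j - i) else if (n : ℤ) ∣ x - j then x - (j - i) else x

theorem reflFun_left (i j : ℤ) : reflFun n i j i = j := by simp [reflFun]

theorem reflFun_right {i j : ℤ} (h : ¬ (n : ℤ) ∣ j - i) : reflFun n i j j = i := by
  simp [reflFun, h]

theorem reflFun_of_not_dvd {i j x : ℤ} (hi : ¬ (n : ℤ) ∣ x - i) (hj : ¬ (n : ℤ) ∣ x - j) :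
    reflFun n i j x = x := by
  simp [reflFun, hi, hj]

theorem reflFun_add_mul (i j x k : ℤ) :
    reflFun n i j (x + n * k) = reflFun n i j x + n * k := by
  have e : ∀ i, (n : ℤ) ∣ x + n * k - i ↔ (n : ℤ) ∣ x - i := by
    intro i
    rw [show x + n * k - i = x - i + n * k by ring]
    exact (Int.dvd_add_left (dvd_mul_right _ _))
  simp only [reflFun, e]
  split_ifs <;> ring

theorem reflFun_shift (i j k x : ℤ) : reflFun n (i + n * k) (j + n * k) x = reflFun n i j x := by
  have e : ∀ i, (n : ℤ) ∣ x - (i + n * k) ↔ (n : ℤ) ∣ x - i := by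
    intro i
    rw [show x - (i + n * k) = x - i - n * k by ring]
    exact (Int.dvd_iff_dvd_of_dvd_sub (by simp)).symm
  simp only [reflFun, e]
  split_ifs <;> ring

theorem reflFun_comm {i j : ℤ} (h : ¬ (n : ℤ) ∣ j - i) (x : ℤ) :
    reflFun n i j x = reflFun n j i x := by
  unfold reflFun
  by_cases h1 : (n : ℤ) ∣ x - i
  · have h2 : ¬ (n : ℤ) ∣ x - j := fun h2 => h (by simpa using dvd_sub h1 h2)
    simp only [h1, h2, if_true, if_false]; ring
  · by_cases h2 : (n : ℤ) ∣ x - j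
    · simp only [h1, h2, if_true, if_false]; ring
    · simp [h1, h2]

theorem reflFun_involutive {i j : ℤ} (h : ¬ (n : ℤ) ∣ j - i) :
    Function.Involutive (reflFun n i j) := by
  intro x
  by_cases h1 : (n : ℤ) ∣ x - i
  · obtain ⟨k, hk⟩ := h1
    obtain rfl : x = i + n * k := by linarith
    rw [reflFun_add_mul, reflFun_left, reflFun_add_mul, reflFun_right h]
  · by_cases h2 : (n : ℤ) ∣ x - j
    · obtain ⟨k, hk⟩ := h2
      obtain rfl : x = j + n * k := by linarith
      rw [reflFun_add_mul, reflFun_right h, reflFun_add_mul, reflFun_left]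
    · rw [reflFun_of_not_dvd h1 h2, reflFun_of_not_dvd h1 h2]

theorem apply_reflFun_of_sign {ε : ℤ} (hε : ε * ε = 1) {g : Equiv.Perm ℤ}
    (hg : ∀ x, g (x + n) = g x + ε * n) (i j x : ℤ) (h : ¬ (n : ℤ) ∣ j - i) :
    g (reflFun n i j x) = reflFun n (g i) (g j) (g x) := by
  have d := dvd_apply_sub_of_sign hε hg
  by_cases h1 : (n : ℤ) ∣ x - i
  · obtain ⟨k, hk⟩ := h1
    obtain rfl : x = i + n * k := by linarith
    rw [reflFun_add_mul, reflFun_left, apply_add_mul_of_sign hg, apply_add_mul_of_sign hg,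
      reflFun_add_mul, reflFun_left]
  · by_cases h2 : (n : ℤ) ∣ x - j
    · obtain ⟨k, hk⟩ := h2
      obtain rfl : x = j + n * k := by linarith
      rw [reflFun_add_mul, reflFun_right h, apply_add_mul_of_sign hg, apply_add_mul_of_sign hg,
        reflFun_add_mul, reflFun_right (by rwa [d])]
    · rw [reflFun_of_not_dvd h1 h2, reflFun_of_not_dvd (by rwa [d]) (by rwa [d])]

variable [n.AtLeastTwo]

namespace AffineSymm

theorem apply_add (w : AffineSymm n) (x : ℤ) : (w : Equiv.Perm ℤ) (x + n) = (w : Equiv.Perm ℤ) x + n :=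
  w.2.1 x

theorem apply_add_mul (w : AffineSymm n) (x k : ℤ) :
    (w : Equiv.Perm ℤ) (x + n * k) = (w : Equiv.Perm ℤ) x + n * k :=
  periodic_mul w.2.1 x k

theorem ext_apply {v w : AffineSymm n}
    (h : ∀ x, (v : Equiv.Perm ℤ) x = (w : Equiv.Perm ℤ) x) : v = w :=
  Subtype.ext (Equiv.ext h)

theorem mul_apply (v w : AffineSymm n) (x : ℤ) :
    ((v * w : AffineSymm n) : Equiv.Perm ℤ) x = (v : Equiv.Perm ℤ) ((w : Equiv.Perm ℤ) x) := rfl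

end AffineSymm

theorem AffineSymm.dvd_apply_sub (w : AffineSymm n) (x y : ℤ) :
    (n : ℤ) ∣ (w : Equiv.Perm ℤ) x - (w : Equiv.Perm ℤ) y ↔ (n : ℤ) ∣ x - y :=
  dvd_apply_sub_of_sign (ε := 1) (by ring) (fun x => by rw [AffineSymm.apply_add, one_mul]) x y

theorem sum_dvd_sub (i : ℤ) :
    ∑ x ∈ Finset.Icc (1 : ℤ) n, (if (n : ℤ) ∣ x - i then (1 : ℤ) else 0) =
      ∑ x ∈ Finset.Icc (1 : ℤ) n, (if (n : ℤ) ∣ x then (1 : ℤ) else 0) := by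
  have h := sum_comp_periodic (NeZero.pos n) (v := Equiv.addRight (-i))
    (g := fun x => if (n : ℤ) ∣ x then (1 : ℤ) else 0) (fun x => by simp; ring) (fun x k => by
      have e : (n : ℤ) ∣ x + n * k ↔ (n : ℤ) ∣ x := Int.dvd_add_left (dvd_mul_right _ _)
      simp only [e])
  simpa [← sub_eq_add_neg] using h

theorem reflFun_mem {i j : ℤ} (h : ¬ (n : ℤ) ∣ j - i) :
    (reflFun_involutive h).toPerm ∈ AffineSymm n := by
  refine ⟨fun x => by simpa using reflFun_add_mul (n := n) i j x 1, ?_⟩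
  have e : ∀ x : ℤ, reflFun n i j x - x =
      (j - i) * (if (n : ℤ) ∣ x - i then 1 else 0) - (j - i) * (if (n : ℤ) ∣ x - j then 1 else 0) := by
    intro x
    unfold reflFun
    by_cases h1 : (n : ℤ) ∣ x - i
    · have h2 : ¬ (n : ℤ) ∣ x - j := fun h2 => h (by simpa using dvd_sub h1 h2)
      simp [h1, h2]
    · by_cases h2 : (n : ℤ) ∣ x - j <;> simp [h1, h2]
  simp only [Function.Involutive.coe_toPerm, e, Finset.sum_sub_distrib, ← Finset.mul_sum,
    sum_dvd_sub, sub_self]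

open Classical in
/-- The reflection exchanging `i` and `j`, for `i ≢ j` modulo `n`. -/
noncomputable def affRefl (n : ℕ) [n.AtLeastTwo] (i j : ℤ) : AffineSymm n :=
  if h : ¬ (n : ℤ) ∣ j - i then ⟨(reflFun_involutive h).toPerm, reflFun_mem h⟩ else 1

theorem affRefl_apply {i j : ℤ} (h : ¬ (n : ℤ) ∣ j - i) (x : ℤ) :
    (affRefl n i j : Equiv.Perm ℤ) x = reflFun n i j x := by
  simp [affRefl, h]

/-- No hypothesis on i and j is needed, since `affRefl` takes the symmetric value 1 when they are
congruent modulo n. -/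
theorem affRefl_comm (i j : ℤ) : affRefl n i j = affRefl n j i := by
  by_cases h : (n : ℤ) ∣ j - i
  · have h' : (n : ℤ) ∣ i - j := by rwa [dvd_sub_comm]
    simp [affRefl, h, h']
  · have h' : ¬ (n : ℤ) ∣ i - j := by rwa [dvd_sub_comm]
    exact AffineSymm.ext_apply fun x => by rw [affRefl_apply h, affRefl_apply h', reflFun_comm h]

theorem affRefl_shift (i j k : ℤ) : affRefl n (i + n * k) (j + n * k) = affRefl n i j := by
  by_cases h : (n : ℤ) ∣ j - i
  · simp [affRefl, h]
  · have h' : ¬ (n : ℤ) ∣ (j + n * k) - (i + n * k) := by simpa using h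
    exact AffineSymm.ext_apply fun x => by rw [affRefl_apply h, affRefl_apply h', reflFun_shift]

theorem affRefl_mul_self (i j : ℤ) : affRefl n i j * affRefl n i j = 1 := by
  by_cases h : (n : ℤ) ∣ j - i
  · simp [affRefl, h]
  · refine AffineSymm.ext_apply fun x => ?_
    rw [AffineSymm.mul_apply, affRefl_apply h, affRefl_apply h, reflFun_involutive h]
    rfl

theorem simpleRefl_apply (i x : ℤ) :
    (simpleRefl n i : Equiv.Perm ℤ) x = simpleFun n i x := rfl

theorem not_dvd_one : ¬ (n : ℤ) ∣ 1 := by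
  simpa using not_dvd_consecutive n 0 (dvd_zero _)

theorem simpleRefl_eq (i : ℤ) : simpleRefl n i = affRefl n i (i + 1) := by
  refine AffineSymm.ext_apply fun x => ?_
  rw [affRefl_apply (by simpa using not_dvd_one), simpleRefl_apply, simpleFun, reflFun]
  simp

theorem conj_affRefl (w : AffineSymm n) {i j : ℤ} (h : ¬ (n : ℤ) ∣ j - i) :
    w * affRefl n i j * w⁻¹ = affRefl n ((w : Equiv.Perm ℤ) i) ((w : Equiv.Perm ℤ) j) := by
  rw [mul_inv_eq_iff_eq_mul]
  refine AffineSymm.ext_apply fun x => ?_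
  rw [AffineSymm.mul_apply, AffineSymm.mul_apply, affRefl_apply h,
    affRefl_apply (by rwa [AffineSymm.dvd_apply_sub])]
  exact apply_reflFun_of_sign (ε := 1) (by ring) (fun x => by rw [AffineSymm.apply_add, one_mul]) i j x h

theorem simpleRefl_mem_reflections (i : ℤ) : simpleRefl n i ∈ reflections n := by
  have hn : (0 : ℤ) < n := by exact_mod_cast NeZero.pos n
  have h1 := Int.emod_nonneg (i - 1) hn.ne'
  have h2 := Int.emod_lt_of_pos (i - 1) hn
  refine ⟨(i - 1) % n + 1, ⟨by omega, by omega⟩, ?_⟩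
  have e : i = (i - 1) % n + 1 + n * ((i - 1) / n) := by
    have := Int.emod_add_mul_ediv (i - 1) n
    linarith
  have e2 : simpleRefl n ((i - 1) % n + 1) = simpleRefl n i := by
    rw [simpleRefl_eq, simpleRefl_eq]
    conv_rhs => rw [e]
    rw [add_right_comm _ (_ * _) 1, affRefl_shift]
  rw [e2]

/-- Strong induction on the distance between the two points. Normally (i, i + m + 2) is the
conjugate of (i, i + m + 1) by the simple reflection at the right end. That shorter pair is
degenerate when n divides m + 1. Then conjugating (i + 1, i + m + 1) by s_i moves both ends outwards
at once. -/
theorem affRefl_add_mem_reflections (m : ℕ) (i : ℤ) (h : ¬ (n : ℤ) ∣ m) :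
    affRefl n i (i + m) ∈ reflections n := by
  induction m using Nat.strong_induction_on generalizing i with
  | _ m ih =>
    rcases m with _ | _ | m
    · simp at h
    · rw [Nat.zero_add, Nat.cast_one, ← simpleRefl_eq]
      exact simpleRefl_mem_reflections i
    · have n1 := not_dvd_one (n := n)
      by_cases h1 : (n : ℤ) ∣ (m + 1 : ℕ)
      · have h2 : ¬ (n : ℤ) ∣ (m : ℕ) := fun h2 => not_dvd_consecutive n _ h2 (by exact_mod_cast h1)
        have h3 := reflections_conjStable n (simpleRefl n i) _ (ih m (by omega) (i + 1) h2)
        rw [conj_affRefl _ (by rwa [add_sub_cancel_left]), simpleRefl_eq, affRefl_apply (by simpa),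
          affRefl_apply (by simpa), reflFun_right (by simpa)] at h3
        have e : i + 1 + (m : ℤ) = i + ((m + 1 : ℕ) : ℤ) := by push_cast; ring
        have h4 : reflFun n i (i + 1) (i + ((m + 1 : ℕ) : ℤ)) = i + ((m + 2 : ℕ) : ℤ) := by
          rw [reflFun, if_pos (by simpa using h1)]
          push_cast
          ring
        rwa [e, h4] at h3
      · have h3 := reflections_conjStable n (simpleRefl n (i + (m + 1 : ℕ))) _
          (ih (m + 1) (by omega) i h1)
        rw [conj_affRefl _ (by rwa [add_sub_cancel_left]), simpleRefl_eq, affRefl_apply (by simpa),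
          affRefl_apply (by simpa), reflFun_left, reflFun_of_not_dvd] at h3
        · convert h3 using 2
          push_cast
          ring
        · rw [sub_add_cancel_left, dvd_neg]
          exact h1
        · rw [show i - (i + ((m + 1 : ℕ) : ℤ) + 1) = -((m + 1 + 1 : ℕ) : ℤ) by push_cast; ring, dvd_neg]
          exact h

theorem affRefl_mem_reflections {i j : ℤ} (h : ¬ (n : ℤ) ∣ j - i) : affRefl n i j ∈ reflections n := by
  rcases le_total i j with hij | hij
  · obtain ⟨m, hm⟩ := Int.le.dest hij
    rw [← hm] at h ⊢
    exact affRefl_add_mem_reflections m i (by simpa using h)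
  · obtain ⟨m, hm⟩ := Int.le.dest hij
    rw [dvd_sub_comm] at h
    rw [affRefl_comm]
    rw [← hm] at h ⊢
    exact affRefl_add_mem_reflections m j (by simpa using h)

theorem mem_reflections_iff {r : AffineSymm n} :
    r ∈ reflections n ↔ ∃ i j : ℤ, ¬ (n : ℤ) ∣ j - i ∧ r = affRefl n i j := by
  constructor
  · rintro ⟨i, -, h⟩
    obtain ⟨g, rfl⟩ := isConj_iff.1 h
    have h1 : ¬ (n : ℤ) ∣ (i + 1) - i := by simpa using not_dvd_one
    exact ⟨_, _, by rwa [AffineSymm.dvd_apply_sub g], by rw [simpleRefl_eq, conj_affRefl _ h1]⟩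
  · rintro ⟨i, j, h, rfl⟩
    exact affRefl_mem_reflections h

theorem affRefl_apply_left {i j : ℤ} (h : ¬ (n : ℤ) ∣ j - i) :
    (affRefl n i j : Equiv.Perm ℤ) i = j := by rw [affRefl_apply h, reflFun_left]

theorem affRefl_apply_right {i j : ℤ} (h : ¬ (n : ℤ) ∣ j - i) :
    (affRefl n i j : Equiv.Perm ℤ) j = i := by rw [affRefl_apply h, reflFun_right h]

theorem affRefl_apply_of_not_dvd {i j x : ℤ} (hi : ¬ (n : ℤ) ∣ x - i) (hj : ¬ (n : ℤ) ∣ x - j) :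
    (affRefl n i j : Equiv.Perm ℤ) x = x := by
  by_cases h : (n : ℤ) ∣ j - i
  · simp [affRefl, h]
  · rw [affRefl_apply h, reflFun_of_not_dvd hi hj]

theorem one_notMem_reflections : (1 : AffineSymm n) ∉ reflections n := by
  rw [mem_reflections_iff]
  rintro ⟨i, j, h, e⟩
  have := affRefl_apply_left h
  rw [← e] at this
  have : i = j := this
  simp [this] at h

theorem reflections_mul_self {r : AffineSymm n} (hr : r ∈ reflections n) : r * r = 1 := by
  obtain ⟨i, j, h, rfl⟩ := mem_reflections_iff.1 hr
  exact affRefl_mul_self i j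

/-- A reflection is determined by any point which it moves. -/
theorem eq_affRefl_of_apply {r : AffineSymm n} (hr : r ∈ reflections n) {i j : ℤ} (hij : i ≠ j)
    (h : (r : Equiv.Perm ℤ) i = j) : ¬ (n : ℤ) ∣ j - i ∧ r = affRefl n i j := by
  obtain ⟨p, q, hpq, rfl⟩ := mem_reflections_iff.1 hr
  by_cases h1 : (n : ℤ) ∣ i - p
  · obtain ⟨k, hk⟩ := h1
    obtain rfl : i = p + n * k := by linarith
    rw [AffineSymm.apply_add_mul, affRefl_apply_left hpq] at h
    subst h
    exact ⟨by simpa using hpq, (affRefl_shift _ _ _).symm⟩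
  · by_cases h2 : (n : ℤ) ∣ i - q
    · obtain ⟨k, hk⟩ := h2
      obtain rfl : i = q + n * k := by linarith
      rw [AffineSymm.apply_add_mul, affRefl_apply_right hpq] at h
      subst h
      refine ⟨?_, by rw [affRefl_shift, affRefl_comm]⟩
      rw [dvd_sub_comm]
      simpa using hpq
    · rw [affRefl_apply_of_not_dvd h1 h2] at h
      exact absurd h hij

end Reflections

/-! ### Balanced functions, signature and generation by reflections -/

section Lengths

variable {n : ℕ}

theorem add_mul_of_add {A : Type*} {f : ℤ → A} (hf : ∀ x, f (x + n) = f x) (x k : ℤ) :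
    f (x + n * k) = f x := by
  have : Function.Periodic f (n : ℤ) := hf
  rw [mul_comm]
  exact this.int_mul k x

variable [n.AtLeastTwo]

theorem sum_zmod_of_transversal {ι A : Type*} [Fintype ι] [AddCommMonoid A] {o : ι → ℤ}
    (hcard : Fintype.card ι = n) (ho : ∀ s t, (n : ℤ) ∣ o s - o t → s = t) {h : ℤ → A}
    (hh : ∀ x k, h (x + n * k) = h x) : ∑ s, h (o s) = ∑ z : ZMod n, h z.val := by
  have hb : Function.Bijective (fun s => (o s : ZMod n)) := by
    rw [Fintype.bijective_iff_injective_and_card, ZMod.card]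
    refine ⟨fun s t hst => ho s t ?_, hcard⟩
    rw [dvd_sub_comm]
    exact (ZMod.intCast_eq_intCast_iff_dvd_sub _ _ _).1 hst
  rw [← Function.Bijective.sum_comp hb]
  refine Finset.sum_congr rfl fun s _ => ?_
  rw [ZMod.val_intCast]
  conv_lhs => rw [← Int.emod_add_mul_ediv (o s) n, hh]

/-- The sum of a periodic function over a set of representatives of the classes modulo `n`. -/
theorem sum_transversal {ι A : Type*} [Fintype ι] [AddCommMonoid A] {o : ι → ℤ}
    (hcard : Fintype.card ι = n) (ho : ∀ s t, (n : ℤ) ∣ o s - o t → s = t) {h : ℤ → A}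
    (hh : ∀ x k, h (x + n * k) = h x) : ∑ s, h (o s) = ∑ x ∈ Finset.Icc (1 : ℤ) n, h x := by
  rw [sum_zmod_of_transversal hcard ho hh, ← Finset.sum_coe_sort (Finset.Icc (1 : ℤ) n) h]
  refine (sum_zmod_of_transversal (o := fun x : Finset.Icc (1 : ℤ) n => (x : ℤ)) (by simp) ?_
    hh).symm
  rintro ⟨s, hs⟩ ⟨t, ht⟩ hst
  rw [Finset.mem_Icc] at hs ht
  have := Int.eq_zero_of_abs_lt_dvd hst (abs_lt.2 ⟨by dsimp; omega, by dsimp; omega⟩)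
  exact Subtype.ext (by dsimp at this ⊢; omega)

/-- `f` is constant on the orbits of `w`, and the displacement of `w` weighted by `f` vanishes. -/
def IsBalanced (w : AffineSymm n) (f : ℤ → ℚ) : Prop :=
  (∀ x, f ((w : Equiv.Perm ℤ) x) = f x) ∧
    ∑ x ∈ Finset.Icc (1 : ℤ) n, f x * ((w : Equiv.Perm ℤ) x - x : ℤ) = 0

theorem isBalanced_one (f : ℤ → ℚ) : IsBalanced (1 : AffineSymm n) f := by
  simp [IsBalanced]

/-- The displacement of uv at x is that of u at v(x) plus that of v at x. As f is v-invariant and v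
permutes the classes modulo n, the first sum can be reindexed over v(1), …, v(n). -/
theorem sum_displacement_comp {f : ℤ → ℚ} (hf : ∀ x, f (x + n) = f x) (u v : AffineSymm n)
    (hv : ∀ x, f ((v : Equiv.Perm ℤ) x) = f x) :
    ∑ x ∈ Finset.Icc (1 : ℤ) n, f x * (((u * v : AffineSymm n) : Equiv.Perm ℤ) x - x : ℤ) =
      ∑ x ∈ Finset.Icc (1 : ℤ) n, f x * ((u : Equiv.Perm ℤ) x - x : ℤ) +
      ∑ x ∈ Finset.Icc (1 : ℤ) n, f x * ((v : Equiv.Perm ℤ) x - x : ℤ) := by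
  have h := sum_transversal (n := n) (A := ℚ)
    (o := fun x : Finset.Icc (1 : ℤ) n => (v : Equiv.Perm ℤ) x) (by simp)
    (by
      rintro ⟨s, hs⟩ ⟨t, ht⟩ hst
      rw [AffineSymm.dvd_apply_sub] at hst
      rw [Finset.mem_Icc] at hs ht
      have := Int.eq_zero_of_abs_lt_dvd hst (abs_lt.2 ⟨by dsimp; omega, by dsimp; omega⟩)
      exact Subtype.ext (by dsimp at this ⊢; omega))
    (h := fun x => f x * ((u : Equiv.Perm ℤ) x - x : ℤ)) (fun x k => by
      rw [add_mul_of_add hf, disp_periodic u.2.1])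
  rw [← h, Finset.sum_coe_sort (Finset.Icc (1 : ℤ) n) (fun x : ℤ =>
    f ((v : Equiv.Perm ℤ) x) * ((u : Equiv.Perm ℤ) ((v : Equiv.Perm ℤ) x) -
      ((v : Equiv.Perm ℤ) x) : ℤ)), ← Finset.sum_add_distrib]
  refine Finset.sum_congr rfl fun x _ => ?_
  rw [hv, AffineSymm.mul_apply, ← mul_add, ← Int.cast_add]
  congr 2
  ring

theorem IsBalanced.mul {f : ℤ → ℚ} (hf : ∀ x, f (x + n) = f x) {u v : AffineSymm n}
    (hu : IsBalanced u f) (hv : IsBalanced v f) : IsBalanced (u * v) f :=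
  ⟨fun x => by rw [AffineSymm.mul_apply, hu.1, hv.1],
    by rw [sum_displacement_comp hf _ _ hv.1, hu.2, hv.2, add_zero]⟩

theorem isBalanced_list_prod {f : ℤ → ℚ} (hf : ∀ x, f (x + n) = f x) {l : List (AffineSymm n)}
    (hl : ∀ r ∈ l, IsBalanced r f) : IsBalanced l.prod f := by
  induction l with
  | nil => exact isBalanced_one f
  | cons r l ih =>
    rw [List.prod_cons]
    exact (hl r (by simp)).mul hf (ih fun s hs => hl s (by simp [hs]))

theorem isBalanced_affRefl {f : ℤ → ℚ} (hf : ∀ x, f (x + n) = f x) {i j : ℤ} (hij : f i = f j) :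
    IsBalanced (affRefl n i j) f := by
  by_cases h : (n : ℤ) ∣ j - i
  · simpa [affRefl, h] using isBalanced_one f
  have inv : ∀ x, f ((affRefl n i j : Equiv.Perm ℤ) x) = f x := by
    intro x
    rw [affRefl_apply h]
    by_cases h1 : (n : ℤ) ∣ x - i
    · obtain ⟨k, hk⟩ := h1
      obtain rfl : x = i + n * k := by linarith
      rw [reflFun_add_mul, reflFun_left, add_mul_of_add hf, add_mul_of_add hf, hij]
    · by_cases h2 : (n : ℤ) ∣ x - j
      · obtain ⟨k, hk⟩ := h2
        obtain rfl : x = j + n * k := by linarith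
        rw [reflFun_add_mul, reflFun_right h, add_mul_of_add hf, add_mul_of_add hf, hij]
      · rw [reflFun_of_not_dvd h1 h2]
  refine ⟨inv, ?_⟩
  -- By additivity, twice the displacement sum of an involution is that of the identity, namely
  -- zero.
  have h2 := sum_displacement_comp hf (affRefl n i j) (affRefl n i j) inv
  rw [affRefl_mul_self] at h2
  simp only [OneMemClass.coe_one, Equiv.Perm.coe_one, id_eq, sub_self, Int.cast_zero, mul_zero,
    Finset.sum_const_zero] at h2
  linarith

/-- A product of at most `n - 2` reflections admits a nonconstant balanced function. -/
theorem exists_isBalanced {l : List (AffineSymm n)} (hl : ∀ r ∈ l, r ∈ reflections n)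
    (hlen : l.length + 2 ≤ n) :
    ∃ f : ℤ → ℚ, (∀ x, f (x + n) = f x) ∧ IsBalanced l.prod f ∧ ∃ x y, f x ≠ f y := by
  have h : ∀ t : Fin l.length, ∃ p : ℤ × ℤ, l.get t = affRefl n p.1 p.2 := by
    intro t
    obtain ⟨i, j, -, h⟩ := mem_reflections_iff.1 (hl _ (l.get_mem t))
    exact ⟨(i, j), h⟩
  choose p hp using h
  -- A function on ℤ/n has n free values. Each reflection imposes one equality, and f(0) = 0 is
  -- added so that a nonzero solution is nonconstant. There are at most n - 1 conditions in all.
  let Φ : (ZMod n → ℚ) →ₗ[ℚ] (Fin l.length → ℚ) × ℚ :=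
    LinearMap.prod (LinearMap.pi fun t =>
      (LinearMap.proj (R := ℚ) (φ := fun _ : ZMod n => ℚ) ((p t).1 : ZMod n) -
        LinearMap.proj (R := ℚ) (φ := fun _ : ZMod n => ℚ) ((p t).2 : ZMod n) :
        (ZMod n → ℚ) →ₗ[ℚ] ℚ)) (LinearMap.proj 0)
  have hker : LinearMap.ker Φ ≠ ⊥ := by
    apply LinearMap.ker_ne_bot_of_finrank_lt
    simp
    omega
  obtain ⟨F, hF, hF0⟩ := (Submodule.ne_bot_iff _).1 hker
  rw [LinearMap.mem_ker] at hF
  have h0 : F 0 = 0 := congrArg Prod.snd hF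
  have h1 : ∀ t, F (p t).1 = F (p t).2 := fun t =>
    sub_eq_zero.1 (congrFun (congrArg Prod.fst hF) t)
  have hper : ∀ x : ℤ, F ((x + n : ℤ) : ZMod n) = F (x : ZMod n) := fun x => by simp
  refine ⟨fun x => F x, hper, isBalanced_list_prod hper ?_, ?_⟩
  · intro r hr
    obtain ⟨t, rfl⟩ := List.get_of_mem hr
    rw [hp]
    exact isBalanced_affRefl hper (h1 t)
  · obtain ⟨z, hz⟩ := Function.ne_iff.1 hF0
    obtain ⟨x, rfl⟩ := ZMod.intCast_surjective z
    exact ⟨x, 0, by simpa [h0] using hz⟩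

theorem AffineSymm.intCast_apply_congr (w : AffineSymm n) {x y : ℤ}
    (h : (x : ZMod n) = y) :
    (((w : Equiv.Perm ℤ) x : ℤ) : ZMod n) = ((w : Equiv.Perm ℤ) y : ℤ) := by
  rw [ZMod.intCast_eq_intCast_iff_dvd_sub] at h ⊢
  rwa [AffineSymm.dvd_apply_sub]

/-- The permutation of `ℤ/n` induced by an element of `W`. -/
def modPerm (n : ℕ) [n.AtLeastTwo] : AffineSymm n →* Equiv.Perm (ZMod n) :=
  MonoidHom.toHomPerm
    { toFun := fun w z => ((w : Equiv.Perm ℤ) z.val : ℤ)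
      map_one' := by
        funext z
        simp [Function.End.one_def]
      map_mul' := by
        intro u v
        funext z
        change _ = (((u : Equiv.Perm ℤ) _ : ℤ) : ZMod n)
        rw [AffineSymm.mul_apply]
        exact AffineSymm.intCast_apply_congr u (by simp) }

theorem modPerm_apply (w : AffineSymm n) (x : ℤ) :
    modPerm n w (x : ZMod n) = ((w : Equiv.Perm ℤ) x : ℤ) :=
  AffineSymm.intCast_apply_congr w (by simp)

/-- The signature of the induced permutation of `ℤ/n`. -/
def affSign (n : ℕ) [n.AtLeastTwo] : AffineSymm n →* ℤˣ := Equiv.Perm.sign.comp (modPerm n)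

theorem affSign_of_mem {r : AffineSymm n} (hr : r ∈ reflections n) : affSign n r = -1 := by
  obtain ⟨i, j, h, rfl⟩ := mem_reflections_iff.1 hr
  have ne : (i : ZMod n) ≠ j := by rwa [Ne, ZMod.intCast_eq_intCast_iff_dvd_sub]
  have e : modPerm n (affRefl n i j) = Equiv.swap (i : ZMod n) j := by
    refine Equiv.ext fun z => ?_
    obtain ⟨x, rfl⟩ := ZMod.intCast_surjective z
    by_cases h1 : (x : ZMod n) = i
    · rw [h1, Equiv.swap_apply_left, modPerm_apply, affRefl_apply_left h]
    by_cases h2 : (x : ZMod n) = j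
    · rw [h2, Equiv.swap_apply_right, modPerm_apply, affRefl_apply_right h]
    rw [Equiv.swap_apply_of_ne_of_ne h1 h2, modPerm_apply, affRefl_apply_of_not_dvd]
    · rwa [dvd_sub_comm, ← ZMod.intCast_eq_intCast_iff_dvd_sub]
    · rwa [dvd_sub_comm, ← ZMod.intCast_eq_intCast_iff_dvd_sub]
  rw [affSign, MonoidHom.comp_apply, e, Equiv.Perm.sign_swap ne]

theorem affSign_list_prod {l : List (AffineSymm n)} (hl : ∀ r ∈ l, r ∈ reflections n) :
    affSign n l.prod = (-1) ^ l.length := by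
  induction l with
  | nil => simp
  | cons r l ih =>
    rw [List.prod_cons, map_mul, affSign_of_mem (hl r (by simp)), ih fun s hs => hl s (by simp [hs]),
      List.length_cons, pow_succ']

theorem AffineSymm.eq_one_of_Icc {w : AffineSymm n}
    (h : ∀ x ∈ Finset.Icc (1 : ℤ) n, (w : Equiv.Perm ℤ) x = x) : w = 1 := by
  refine AffineSymm.ext_apply fun x => ?_
  have hn : (0 : ℤ) < n := by exact_mod_cast NeZero.pos n
  have h1 := Int.emod_nonneg (x - 1) hn.ne'
  have h2 := Int.emod_lt_of_pos (x - 1) hn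
  have e := Int.emod_add_mul_ediv (x - 1) n
  have e2 : x = (x - 1) % n + 1 + n * ((x - 1) / n) := by linarith
  rw [e2, AffineSymm.apply_add_mul, h _ (Finset.mem_Icc.2 ⟨by omega, by omega⟩)]
  rfl

/-- Induction on the number of points of [1, n] that are moved: multiplying w on the left by one or
two reflections fixes a new point i and keeps the fixed points of w. If w(i) is not congruent to i,
the reflection (i, w(i)) suffices. -/
theorem generates_of_fixed (k : ℕ) (w : AffineSymm n)
    (hk : ((Finset.Icc (1 : ℤ) n).filter fun x => (w : Equiv.Perm ℤ) x ≠ x).card = k) :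
    ∃ l : List (AffineSymm n), (∀ r ∈ l, r ∈ reflections n) ∧ l.prod = w := by
  induction k using Nat.strong_induction_on generalizing w with
  | _ k ih =>
  have step : ∀ v : AffineSymm n, (∀ x ∈ Finset.Icc (1 : ℤ) n, (w : Equiv.Perm ℤ) x = x →
      (v : Equiv.Perm ℤ) x = x) → (∃ x ∈ Finset.Icc (1 : ℤ) n, (w : Equiv.Perm ℤ) x ≠ x ∧
      (v : Equiv.Perm ℤ) x = x) →
      ∃ l : List (AffineSymm n), (∀ r ∈ l, r ∈ reflections n) ∧ l.prod = v := by
    rintro v hv ⟨x, hx, hwx, hvx⟩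
    refine ih _ ?_ v rfl
    rw [← hk]
    apply Finset.card_lt_card
    rw [Finset.ssubset_iff_of_subset]
    · exact ⟨x, by simp [hwx]; simpa using hx, by simp [hvx]⟩
    · intro y hy
      rw [Finset.mem_filter] at hy ⊢
      exact ⟨hy.1, fun e => hy.2 (hv y hy.1 e)⟩
  by_cases hw : ∀ x ∈ Finset.Icc (1 : ℤ) n, (w : Equiv.Perm ℤ) x = x
  · exact ⟨[], by simp, by rw [AffineSymm.eq_one_of_Icc hw]; rfl⟩
  push Not at hw
  obtain ⟨i, hi, hwi⟩ := hw
  have fixed : ∀ x, (w : Equiv.Perm ℤ) x = x → ¬ (n : ℤ) ∣ x - i ∧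
      ¬ (n : ℤ) ∣ x - (w : Equiv.Perm ℤ) i := by
    intro x hx
    have h1 : ¬ (n : ℤ) ∣ x - i := by
      rintro ⟨m, hm⟩
      obtain rfl : x = i + n * m := by linarith
      rw [AffineSymm.apply_add_mul] at hx
      exact hwi (by linarith)
    refine ⟨h1, fun h2 => h1 ?_⟩
    rwa [← AffineSymm.dvd_apply_sub, hx]
  by_cases h : (n : ℤ) ∣ (w : Equiv.Perm ℤ) i - i
  -- Here w translates the class of i. The total displacement being zero, another class must move
  -- too, and its point j serves as a relay: w(i) ↦ j ↦ i.
  · have : ∃ j ∈ Finset.Icc (1 : ℤ) n, j ≠ i ∧ (w : Equiv.Perm ℤ) j ≠ j := by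
      by_contra hcon
      push Not at hcon
      have h2 := w.2.2
      rw [Finset.sum_eq_single_of_mem i hi fun j hj hji => by rw [hcon j hj hji, sub_self]] at h2
      exact hwi (by linarith)
    obtain ⟨j, hj, hji, hwj⟩ := this
    have hji' : ¬ (n : ℤ) ∣ j - i := by
      intro hd
      rw [Finset.mem_Icc] at hi hj
      have := Int.eq_zero_of_abs_lt_dvd hd (abs_lt.2 ⟨by omega, by omega⟩)
      omega
    have hwij : ¬ (n : ℤ) ∣ j - (w : Equiv.Perm ℤ) i := fun hd => hji' (by
      simpa using dvd_add hd h)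
    have hji'' : ¬ (n : ℤ) ∣ i - j := by rwa [dvd_sub_comm]
    obtain ⟨l, hl, hp⟩ := step (affRefl n j i * (affRefl n ((w : Equiv.Perm ℤ) i) j * w)) (by
        intro x hx hwx
        have hxj : ¬ (n : ℤ) ∣ x - j := by
          rintro ⟨m, hm⟩
          obtain rfl : x = j + n * m := by linarith
          rw [AffineSymm.apply_add_mul] at hwx
          exact hwj (by linarith)
        rw [AffineSymm.mul_apply, AffineSymm.mul_apply, hwx,
          affRefl_apply_of_not_dvd (fixed x hwx).2 hxj, affRefl_apply_of_not_dvd hxj (fixed x hwx).1])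
      ⟨i, hi, hwi, by rw [AffineSymm.mul_apply, AffineSymm.mul_apply, affRefl_apply_left hwij,
        affRefl_apply_left hji'']⟩
    refine ⟨affRefl n ((w : Equiv.Perm ℤ) i) j :: affRefl n j i :: l, ?_, ?_⟩
    · simp only [List.mem_cons, forall_eq_or_imp]
      exact ⟨affRefl_mem_reflections hwij, affRefl_mem_reflections hji'', hl⟩
    · rw [List.prod_cons, List.prod_cons, hp, ← mul_assoc (affRefl n j i), affRefl_mul_self, one_mul,
        ← mul_assoc, affRefl_mul_self, one_mul]
  · obtain ⟨l, hl, hp⟩ := step (affRefl n i ((w : Equiv.Perm ℤ) i) * w) (by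
        intro x hx hwx
        rw [AffineSymm.mul_apply, hwx, affRefl_apply_of_not_dvd (fixed x hwx).1 (fixed x hwx).2])
      ⟨i, hi, hwi, by rw [AffineSymm.mul_apply, affRefl_apply_right h]⟩
    refine ⟨affRefl n i ((w : Equiv.Perm ℤ) i) :: l, ?_, ?_⟩
    · simp only [List.mem_cons, forall_eq_or_imp]
      exact ⟨affRefl_mem_reflections h, hl⟩
    · rw [List.prod_cons, hp, ← mul_assoc, affRefl_mul_self, one_mul]

theorem generates_reflections : Generates (reflections n) := fun w => generates_of_fixed _ w rfl

end Lengths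

/-! ### Orbits of a map sending each point of a periodic set to the next -/

section Counting

variable {n : ℕ}

/-- A counting function of a predicate on the integers. -/
theorem exists_counting (u : ℤ → ℤ) : ∃ N : ℤ → ℤ, ∀ x, N (x + 1) = N x + u x := by
  refine ⟨fun x => (∑ i ∈ Finset.range x.toNat, u i) -
    ∑ i ∈ Finset.range (-x).toNat, u (-(i + 1 : ℤ)), fun x => ?_⟩
  rcases lt_or_ge x 0 with hx | hx
  · obtain ⟨k, rfl⟩ : ∃ k : ℕ, x = -(k + 1 : ℤ) := ⟨(-x - 1).toNat, by omega⟩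
    have e1 : (-(-(k + 1 : ℤ) + 1)).toNat = k := by omega
    have e2 : (-(-(k + 1 : ℤ))).toNat = k + 1 := by omega
    have e3 : (-(k + 1 : ℤ) + 1).toNat = 0 := by omega
    have e4 : (-(k + 1 : ℤ)).toNat = 0 := by omega
    simp only [e1, e2, e3, e4, Finset.sum_range_succ, Finset.sum_range_zero]
    ring
  · obtain ⟨k, rfl⟩ := Int.eq_ofNat_of_zero_le hx
    have e1 : (-((k : ℤ) + 1)).toNat = 0 := by omega
    have e2 : (-(k : ℤ)).toNat = 0 := by omega
    have e3 : ((k : ℤ) + 1).toNat = k + 1 := by omega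
    simp only [e1, e2, e3, Int.toNat_natCast, Finset.sum_range_succ, Finset.sum_range_zero]
    ring

theorem dvd_sub_imp_eq {s t : ℤ} (hs : 0 ≤ s) (hsn : s < n) (ht : 0 ≤ t) (htn : t < n)
    (h : (n : ℤ) ∣ s - t) : s = t := by
  have := Int.eq_zero_of_abs_lt_dvd h (abs_lt.2 ⟨by omega, by omega⟩)
  omega

variable [n.AtLeastTwo]

theorem counting_add {u N : ℤ → ℤ} (hu : ∀ x k, u (x + n * k) = u x)
    (hN : ∀ x, N (x + 1) = N x + u x) (x : ℤ) :
    N (x + n) = N x + ∑ y ∈ Finset.Icc (1 : ℤ) n, u y := by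
  have h : ∀ k : ℕ, N (x + k) = N x + ∑ i ∈ Finset.range k, u (x + i) := by
    intro k
    induction k with
    | zero => simp
    | succ k ih =>
      rw [Finset.sum_range_succ, Nat.cast_add, Nat.cast_one, ← add_assoc, hN, ih]
      ring
  rw [h, Finset.sum_range, sum_transversal (o := fun i : Fin n => x + i) (by simp) _ hu]
  intro s t hst
  have := dvd_sub_imp_eq (n := n) (s := s) (t := t) (by omega) (by omega) (by omega) (by omega)
    (by simpa using hst)
  exact Fin.ext (by exact_mod_cast this)

/-- If `c` maps each element of a periodic set `U` to the next one, then `U` is one orbit. -/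
theorem orbit_of_next (c : AffineSymm n) {U : ℤ → Prop} [DecidablePred U]
    (hU : ∀ x, U (x + n) ↔ U x)
    (hc : ∀ x, U x → x < (c : Equiv.Perm ℤ) x ∧ U ((c : Equiv.Perm ℤ) x) ∧
      ∀ y, x < y → y < (c : Equiv.Perm ℤ) x → ¬ U y) {x : ℤ} (hx : U x) :
    ((c ^ ((Finset.Icc (1 : ℤ) n).filter U).card : AffineSymm n) : Equiv.Perm ℤ) x = x + n ∧
      ∀ y, U y → ∃ m : ℤ, y = ((c ^ m : AffineSymm n) : Equiv.Perm ℤ) x := by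
  -- A primitive N of the indicator of U numbers the points of U consecutively. Then c raises N by 1
  -- on U, while translation by n raises it by the number of points of U in a period.
  set u : ℤ → ℤ := fun x => if U x then 1 else 0 with hu
  obtain ⟨N, hN⟩ := exists_counting u
  have hup : ∀ x k, u (x + n * k) = u x := add_mul_of_add fun x => by simp only [hu, hU]
  have hNn := counting_add hup hN
  have hsum : ∑ y ∈ Finset.Icc (1 : ℤ) n, u y = ((Finset.Icc (1 : ℤ) n).filter U).card := by
    simp [hu]
  have hmono : Monotone N := monotone_int_of_le_succ fun y => by
    rw [hN, hu]
    dsimp only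
    split_ifs <;> omega
  have hlt : ∀ y z, U y → y < z → N y < N z := by
    intro y z hy hyz
    have h1 := hmono (show y + 1 ≤ z by omega)
    rw [hN, hu] at h1
    simp only [hy, if_true] at h1
    omega
  have hinj : ∀ y z, U y → U z → N y = N z → y = z := by
    intro y z hy hz h
    rcases lt_trichotomy y z with h1 | h1 | h1
    · have := hlt y z hy h1; omega
    · exact h1
    · have := hlt z y hz h1; omega
  have hstep : ∀ y, U y → N ((c : Equiv.Perm ℤ) y) = N y + 1 := by
    intro y hy
    obtain ⟨h1, -, h2⟩ := hc y hy
    have h3 : ∀ k : ℕ, y + 1 + k ≤ (c : Equiv.Perm ℤ) y → N (y + 1 + k) = N y + 1 := by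
      intro k
      induction k with
      | zero =>
        intro _
        simp [hN, hu, hy]
      | succ k ih =>
        intro hk
        push_cast at hk ⊢
        rw [← add_assoc, hN, ih (by omega), hu]
        simp [h2 (y + 1 + k) (by omega) (by omega)]
    have h4 := h3 ((c : Equiv.Perm ℤ) y - (y + 1)).toNat (by omega)
    rwa [Int.toNat_of_nonneg (by omega), add_sub_cancel] at h4
  have hpow : ∀ y, U y → ∀ m : ℕ, U (((c ^ m : AffineSymm n) : Equiv.Perm ℤ) y) ∧
      N (((c ^ m : AffineSymm n) : Equiv.Perm ℤ) y) = N y + m := by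
    intro y hy m
    induction m with
    | zero => simpa using hy
    | succ m ih =>
      rw [pow_succ', AffineSymm.mul_apply]
      refine ⟨(hc _ ih.1).2.1, ?_⟩
      rw [hstep _ ih.1, ih.2]
      push_cast
      ring
  have hreach : ∀ y z, U y → U z → N y ≤ N z →
      z = ((c ^ (N z - N y).toNat : AffineSymm n) : Equiv.Perm ℤ) y := by
    intro y z hy hz hyz
    obtain ⟨h1, h2⟩ := hpow y hy (N z - N y).toNat
    refine hinj _ _ hz h1 ?_
    rw [h2]
    omega
  constructor
  · have h1 := hpow x hx ((Finset.Icc (1 : ℤ) n).filter U).card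
    refine hinj _ _ h1.1 ((hU x).2 hx) ?_
    rw [h1.2, hNn, hsum]
  · intro y hy
    rcases le_total (N x) (N y) with h | h
    · exact ⟨(N y - N x).toNat, by rw [zpow_natCast]; exact hreach x y hx hy h⟩
    · refine ⟨-(N x - N y).toNat, ?_⟩
      have h1 := hreach y x hy hx h
      rw [zpow_neg, zpow_natCast, InvMemClass.coe_inv, Equiv.Perm.eq_inv_iff_eq]
      exact h1.symm

end Counting

/-! ### The two orbits of a Coxeter element -/

section CoxeterDynamics

variable {n : ℕ}

/-- `ρ x` is the position in the list `L` of the simple reflection `s_x`. -/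
def IsRank (L : List ℕ) (ρ : ℤ → ℕ) (n : ℕ) : Prop :=
  L.length = n ∧ (∀ x, ρ x < n) ∧ ∀ (t : ℕ) (ht : t < L.length) (x : ℤ), ρ x = t ↔ (n : ℤ) ∣ x - L[t]

theorem IsRank.add {L : List ℕ} {ρ : ℤ → ℕ} (h : IsRank L ρ n) (x : ℤ) : ρ (x + n) = ρ x := by
  obtain ⟨h1, h2, h3⟩ := h
  rw [h3 (ρ x) (by rw [h1]; exact h2 x), add_sub_right_comm, dvd_add_self_right]
  exact (h3 _ _ _).1 rfl

/-- Reversing the list replaces the product by its inverse and exchanges the two kinds of points, so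
results for X carry over to Ξ. -/
theorem IsRank.reverse {L : List ℕ} {ρ : ℤ → ℕ} (h : IsRank L ρ n) :
    IsRank L.reverse (fun x => n - 1 - ρ x) n := by
  obtain ⟨h1, h2, h3⟩ := h
  refine ⟨by simpa using h1, fun x => by have := h2 x; dsimp only; omega, fun t ht x => ?_⟩
  rw [List.length_reverse] at ht
  rw [List.getElem_reverse, ← h3 _ (by omega)]
  have := h2 x
  dsimp only
  omega

variable [n.AtLeastTwo]

theorem IsRank.ne_pred {L : List ℕ} {ρ : ℤ → ℕ} (h : IsRank L ρ n) (x : ℤ) : ρ (x - 1) ≠ ρ x := by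
  obtain ⟨h1, h2, h3⟩ := h
  intro e
  have e1 := (h3 (ρ x) (by rw [h1]; exact h2 x) x).1 rfl
  have e2 := (h3 (ρ x) (by rw [h1]; exact h2 x) (x - 1)).1 e
  apply not_dvd_one (n := n)
  have := dvd_sub e1 e2
  simpa using this

theorem IsRank.simpleRefl_apply {L : List ℕ} {ρ : ℤ → ℕ} (h : IsRank L ρ n) {t : ℕ}
    (ht : t < L.length) (p : ℤ) : (simpleRefl n L[t] : Equiv.Perm ℤ) p =
      if ρ p = t then p + 1 else if ρ (p - 1) = t then p - 1 else p := by
  rw [_root_.simpleRefl_apply, simpleFun]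
  simp only [h.2.2 t ht]
  rw [show p - 1 - (L[t] : ℤ) = p - (L[t] + 1) by ring]

/-- The product of the simple reflections of a list, the first one being applied first. -/
def simpleProd (n : ℕ) [n.AtLeastTwo] (L : List ℕ) : AffineSymm n :=
  (L.reverse.map fun i : ℕ => simpleRefl n i).prod

theorem simpleProd_take_succ (L : List ℕ) {t : ℕ} (ht : t < L.length) :
    simpleProd n (L.take (t + 1)) = simpleRefl n L[t] * simpleProd n (L.take t) := by
  rw [simpleProd, ← List.take_append_getElem ht, List.reverse_append, List.map_append,
    List.prod_append, simpleProd]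
  simp only [List.reverse_singleton, List.map_singleton, List.prod_singleton]

/-- A Coxeter element moves each `x` such that `s_x` comes before `s_{x-1}` to the next one. -/
theorem IsRank.next {L : List ℕ} {ρ : ℤ → ℕ} (h : IsRank L ρ n) {x : ℤ} (hx : ρ x < ρ (x - 1)) :
    x < (simpleProd n L : Equiv.Perm ℤ) x ∧
      ρ ((simpleProd n L : Equiv.Perm ℤ) x) < ρ ((simpleProd n L : Equiv.Perm ℤ) x - 1) ∧
      ∀ y, x < y → y < (simpleProd n L : Equiv.Perm ℤ) x → ¬ ρ y < ρ (y - 1) := by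
  -- Position p of x after t reflections. Either s_x has not yet been used and x has not moved, or x
  -- was pushed right by s_(p-1) past no other point y with s_y before s_(y-1). In the second case,
  -- s_p is still to come and may push further, or it came before s_(p-1) and p is final.
  have key : ∀ t ≤ L.length, ∀ p, (simpleProd n (L.take t) : Equiv.Perm ℤ) x = p →
      (t ≤ ρ x ∧ p = x) ∨ (x < p ∧ ρ (p - 1) < t ∧ (∀ y, x < y → y < p → ¬ ρ y < ρ (y - 1)) ∧
        (t ≤ ρ p ∨ ρ p < ρ (p - 1))) := by
    intro t
    induction t with
    | zero =>
      rintro _ p rfl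
      left
      simp [simpleProd]
    | succ t ih =>
      rintro ht p hp
      rw [simpleProd_take_succ L ht, AffineSymm.mul_apply, h.simpleRefl_apply ht] at hp
      have ih := ih (by omega) _ rfl
      generalize (simpleProd n (L.take t) : Equiv.Perm ℤ) x = q at hp ih
      rcases ih with ⟨h1, rfl⟩ | ⟨h1, h2, h3, h4⟩
      · split_ifs at hp with h5 h6
        · right
          subst hp
          have ne := h.ne_pred (q + 1)
          rw [add_sub_cancel_right] at ne ⊢
          refine ⟨by omega, by omega, fun y hy1 hy2 => by omega, by omega⟩
        · omega
        · exact Or.inl ⟨by omega, hp.symm⟩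
      · right
        split_ifs at hp with h5 h6
        · subst hp
          have ne := h.ne_pred (q + 1)
          rw [add_sub_cancel_right] at ne ⊢
          refine ⟨by omega, by omega, fun y hy1 hy2 => ?_, by omega⟩
          rcases (show y < q ∨ y = q by omega) with h7 | rfl
          · exact h3 y hy1 h7
          · omega
        · omega
        · subst hp
          exact ⟨h1, by omega, h3, by omega⟩
  have hlen := h.1
  rcases key L.length le_rfl _ rfl with ⟨h1, -⟩ | ⟨h1, h2, h3, h4⟩
  · have := h.2.1 x
    omega
  · rw [List.take_length] at h1 h2 h3 h4
    have := h.2.1 ((simpleProd n L : Equiv.Perm ℤ) x)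
    exact ⟨h1, by omega, h3⟩

theorem simpleProd_reverse (L : List ℕ) : simpleProd n L.reverse = (simpleProd n L)⁻¹ := by
  have hs : ∀ i : ℤ, (simpleRefl n i)⁻¹ = simpleRefl n i := fun i => by
    rw [inv_eq_iff_mul_eq_one, simpleRefl_eq, affRefl_mul_self]
  rw [simpleProd, simpleProd, List.prod_inv_reverse, List.map_map, ← List.map_reverse]
  refine congrArg List.prod (List.map_congr_left fun i _ => (hs i).symm)

/-- The element `c` has two orbits of classes modulo `n`: that of `x`, which has `a` classes and
shift `1`, and that of `ξ`, which has `b` classes and shift `-1`. -/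
structure HasOrbits (c : AffineSymm n) (a b : ℕ) (x ξ : ℤ) : Prop where
  pos_left : 0 < a
  pos_right : 0 < b
  add_eq : a + b = n
  pow_left : ((c ^ a : AffineSymm n) : Equiv.Perm ℤ) x = x + n
  pow_right : ((c ^ b : AffineSymm n) : Equiv.Perm ℤ) ξ = ξ - n
  cover : ∀ y, ∃ m : ℤ, y = ((c ^ m : AffineSymm n) : Equiv.Perm ℤ) x ∨
    y = ((c ^ m : AffineSymm n) : Equiv.Perm ℤ) ξ

/-- The points x with s_x before s_(x-1) form one orbit, by `IsRank.next`. The remaining points form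
the other, by the same result for the reversed list, that is, for the inverse. -/
theorem IsRank.hasOrbits {L : List ℕ} {ρ : ℤ → ℕ} (h : IsRank L ρ n) : ∃ x ξ,
    HasOrbits (simpleProd n L) ((Finset.Icc (1 : ℤ) n).filter fun x => ρ x < ρ (x - 1)).card
      ((Finset.Icc (1 : ℤ) n).filter fun x => ¬ ρ x < ρ (x - 1)).card x ξ := by
  have hn : 0 < n := NeZero.pos n
  have hU : ∀ x, ρ (x + n) < ρ (x + n - 1) ↔ ρ x < ρ (x - 1) := fun x => by
    rw [add_sub_right_comm, h.add, h.add]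
  have e0 : ∀ x, (n - 1 - ρ x < n - 1 - ρ (x - 1)) ↔ ¬ ρ x < ρ (x - 1) := fun x => by
    have := h.2.1 x
    have := h.2.1 (x - 1)
    have := h.ne_pred x
    omega
  have h0 : 0 < L.length := by rw [h.1]; exact hn
  -- The index used first precedes both of its neighbours: it lies in the first set and its
  -- successor in the second, so neither set is empty.
  have hx0 : ρ (L[0] : ℕ) = 0 := (h.2.2 0 h0 _).2 (by simp)
  have hx : ρ (L[0] : ℕ) < ρ ((L[0] : ℕ) - 1) := by
    have := h.ne_pred (L[0] : ℕ)
    omega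
  have hξ : ¬ ρ ((L[0] : ℕ) + 1) < ρ ((L[0] : ℕ) + 1 - 1) := by
    rw [add_sub_cancel_right]
    omega
  obtain ⟨p1, p2⟩ := orbit_of_next (simpleProd n L) (U := fun x => ρ x < ρ (x - 1)) hU
    (fun x hx => h.next hx) hx
  obtain ⟨q1, q2⟩ := orbit_of_next (simpleProd n L.reverse) (U := fun x => ¬ ρ x < ρ (x - 1))
    (fun x => not_congr (hU x)) (fun x hx => by
      have := h.reverse.next ((e0 x).2 hx)
      simpa only [e0] using this) hξ
  rw [simpleProd_reverse] at q1 q2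
  have hsum : ((Finset.Icc (1 : ℤ) n).filter fun x => ρ x < ρ (x - 1)).card +
      ((Finset.Icc (1 : ℤ) n).filter fun x => ¬ ρ x < ρ (x - 1)).card = n := by
    rw [Finset.card_filter_add_card_filter_not]
    simp
  refine ⟨(L[0] : ℕ), (L[0] : ℕ) + 1, Nat.pos_of_ne_zero fun e => ?_,
    Nat.pos_of_ne_zero fun e => ?_, hsum, ?_, ?_, ?_⟩
  · rw [e, pow_zero] at p1
    have : ((L[0] : ℕ) : ℤ) = (L[0] : ℕ) + n := p1
    omega
  · rw [e, pow_zero] at q1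
    have : ((L[0] : ℕ) : ℤ) + 1 = (L[0] : ℕ) + 1 + n := q1
    omega
  · exact p1
  · have q3 : ((simpleProd n L ^ ((Finset.Icc (1 : ℤ) n).filter
        fun x => ¬ ρ x < ρ (x - 1)).card : AffineSymm n) : Equiv.Perm ℤ)
        (((L[0] : ℕ) : ℤ) + 1 + n) = ((L[0] : ℕ) : ℤ) + 1 := by
      rw [inv_pow] at q1
      rw [InvMemClass.coe_inv, Equiv.Perm.inv_eq_iff_eq] at q1
      exact q1.symm
    rw [AffineSymm.apply_add] at q3
    linarith
  · intro y
    by_cases hy : ρ y < ρ (y - 1)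
    · obtain ⟨m, hm⟩ := p2 y hy
      exact ⟨m, Or.inl hm⟩
    · obtain ⟨m, hm⟩ := q2 y hy
      exact ⟨-m, Or.inr (by rw [hm, inv_zpow, zpow_neg])⟩

end CoxeterDynamics

/-! ### Coordinates on X and Ξ; existence for every pair (a, b) -/

section Orbits

variable {n : ℕ} [n.AtLeastTwo]

/-- The point `c^m(x)`. -/
def orbitMap (c : AffineSymm n) (x m : ℤ) : ℤ := ((c ^ m : AffineSymm n) : Equiv.Perm ℤ) x

theorem orbitMap_zero (c : AffineSymm n) (x : ℤ) : orbitMap c x 0 = x := rfl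

theorem orbitMap_orbitMap (c : AffineSymm n) (x m k : ℤ) :
    orbitMap c (orbitMap c x m) k = orbitMap c x (m + k) := by
  rw [orbitMap, orbitMap, ← AffineSymm.mul_apply, ← zpow_add, add_comm k m]
  rfl

theorem apply_orbitMap (c : AffineSymm n) (x m : ℤ) :
    (c : Equiv.Perm ℤ) (orbitMap c x m) = orbitMap c x (m + 1) := by
  rw [← orbitMap_orbitMap c x m 1]
  rfl

theorem orbitMap_add_mul (c : AffineSymm n) (x k m : ℤ) :
    orbitMap c (x + n * k) m = orbitMap c x m + n * k :=
  AffineSymm.apply_add_mul _ _ _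

theorem orbitMap_inv (c : AffineSymm n) (x m : ℤ) : orbitMap c⁻¹ x m = orbitMap c x (-m) := by
  rw [orbitMap, inv_zpow, ← zpow_neg, orbitMap]

theorem orbitMap_period {c : AffineSymm n} {x p e : ℤ} (h : orbitMap c x p = x + n * e) (m k : ℤ) :
    orbitMap c x (m + p * k) = orbitMap c x m + n * (e * k) := by
  have hs : ∀ m, orbitMap c x (m + p) = orbitMap c x m + n * e := fun m => by
    rw [add_comm, ← orbitMap_orbitMap, h, orbitMap_add_mul]
  induction k with
  | zero => simp
  | succ i ih => rw [mul_add, mul_one, ← add_assoc, hs, ih]; ring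
  | pred i ih =>
    have h2 := hs (m + p * (-(i : ℤ) - 1))
    have e2 : m + p * (-(i : ℤ) - 1) + p = m + p * (-(i : ℤ)) := by ring
    rw [e2, ih] at h2
    linarith

namespace HasOrbits

variable {c : AffineSymm n} {a b : ℕ} {x ξ : ℤ}

theorem orbitMap_left (h : HasOrbits c a b x ξ) (m k : ℤ) :
    orbitMap c x (m + a * k) = orbitMap c x m + n * k := by
  rw [orbitMap_period (e := 1) (by rw [mul_one, ← h.pow_left, orbitMap, zpow_natCast]), one_mul]

theorem orbitMap_right (h : HasOrbits c a b x ξ) (m k : ℤ) :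
    orbitMap c ξ (m + b * k) = orbitMap c ξ m - n * k := by
  rw [orbitMap_period (e := -1) (by rw [orbitMap, zpow_natCast, h.pow_right]; ring)]
  ring

theorem exists_orbitMap (h : HasOrbits c a b x ξ) (y : ℤ) :
    (∃ m, y = orbitMap c x m) ∨ ∃ m, y = orbitMap c ξ m := by
  obtain ⟨m, hm | hm⟩ := h.cover y
  · exact Or.inl ⟨m, hm⟩
  · exact Or.inr ⟨m, hm⟩

/-- Passing to c⁻¹ exchanges the roles of X and Ξ; facts about Ξ are deduced this way from those
about X. -/
theorem inv (h : HasOrbits c a b x ξ) : HasOrbits c⁻¹ b a ξ x where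
  pos_left := h.pos_right
  pos_right := h.pos_left
  add_eq := by rw [add_comm, h.add_eq]
  pow_left := by
    have := h.orbitMap_right 0 (-1)
    rw [orbitMap_zero] at this
    rw [← zpow_natCast, ← orbitMap, orbitMap_inv, show -(b : ℤ) = 0 + b * -1 by ring, this]
    ring
  pow_right := by
    have := h.orbitMap_left 0 (-1)
    rw [orbitMap_zero] at this
    rw [← zpow_natCast, ← orbitMap, orbitMap_inv, show -(a : ℤ) = 0 + a * -1 by ring, this]
    ring
  cover y := by
    rcases h.exists_orbitMap y with ⟨m, hm⟩ | ⟨m, hm⟩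
    · exact ⟨-m, Or.inr (by rw [← orbitMap, orbitMap_inv, neg_neg, hm])⟩
    · exact ⟨-m, Or.inl (by rw [← orbitMap, orbitMap_inv, neg_neg, hm])⟩

/-- Base points may be moved independently along the two orbits, so a result proved for the pair (x,
ξ) holds for every pair in X × Ξ. -/
theorem rebase (h : HasOrbits c a b x ξ) (p q : ℤ) :
    HasOrbits c a b (orbitMap c x p) (orbitMap c ξ q) where
  pos_left := h.pos_left
  pos_right := h.pos_right
  add_eq := h.add_eq
  pow_left := by
    rw [← zpow_natCast, ← orbitMap, orbitMap_orbitMap, ← mul_one (a : ℤ), h.orbitMap_left, mul_one]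
  pow_right := by
    rw [← zpow_natCast, ← orbitMap, orbitMap_orbitMap, ← mul_one (b : ℤ), h.orbitMap_right, mul_one]
  cover y := by
    rcases h.exists_orbitMap y with ⟨m, hm⟩ | ⟨m, hm⟩
    · exact ⟨m - p, Or.inl (by rw [← orbitMap, orbitMap_orbitMap, add_sub_cancel, hm])⟩
    · exact ⟨m - q, Or.inr (by rw [← orbitMap, orbitMap_orbitMap, add_sub_cancel, hm])⟩

/-- The two orbits cover ℤ, so these a + b = n points meet all n classes, hence each of them once.
-/
theorem transversal (h : HasOrbits c a b x ξ) (s t : Fin a ⊕ Fin b)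
    (hst : (n : ℤ) ∣ Sum.elim (fun i : Fin a => orbitMap c x i) (fun j : Fin b => orbitMap c ξ j) s -
      Sum.elim (fun i : Fin a => orbitMap c x i) (fun j : Fin b => orbitMap c ξ j) t) : s = t := by
  set o : Fin a ⊕ Fin b → ℤ :=
    Sum.elim (fun i : Fin a => orbitMap c x i) (fun j : Fin b => orbitMap c ξ j) with ho
  have hb : Function.Bijective (fun s => (o s : ZMod n)) := by
    rw [Fintype.bijective_iff_surjective_and_card, ZMod.card]
    refine ⟨fun z => ?_, by simp [h.add_eq]⟩
    obtain ⟨y, rfl⟩ := ZMod.intCast_surjective z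
    have ha : (0 : ℤ) < a := by exact_mod_cast h.pos_left
    have hb : (0 : ℤ) < b := by exact_mod_cast h.pos_right
    rcases h.exists_orbitMap y with ⟨m, rfl⟩ | ⟨m, rfl⟩
    · have h1 := Int.emod_nonneg m ha.ne'
      have h2 := Int.emod_lt_of_pos m ha
      refine ⟨Sum.inl ⟨(m % a).toNat, by omega⟩, ?_⟩
      conv_rhs => rw [← Int.emod_add_mul_ediv m a, h.orbitMap_left]
      simp only [ho, Sum.elim_inl, Int.toNat_of_nonneg h1]
      simp
    · have h1 := Int.emod_nonneg m hb.ne'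
      have h2 := Int.emod_lt_of_pos m hb
      refine ⟨Sum.inr ⟨(m % b).toNat, by omega⟩, ?_⟩
      conv_rhs => rw [← Int.emod_add_mul_ediv m b, h.orbitMap_right]
      simp only [ho, Sum.elim_inr, Int.toNat_of_nonneg h1]
      simp
  apply hb.injective
  rw [dvd_sub_comm] at hst
  exact (ZMod.intCast_eq_intCast_iff_dvd_sub _ _ _).2 hst

theorem left_dvd_iff (h : HasOrbits c a b x ξ) (m k : ℤ) :
    (n : ℤ) ∣ orbitMap c x m - orbitMap c x k ↔ (a : ℤ) ∣ m - k := by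
  constructor
  · intro hd
    have h' := h.rebase k 0
    have ha : (0 : ℤ) < a := by exact_mod_cast h.pos_left
    have h1 := Int.emod_nonneg (m - k) ha.ne'
    have h2 := Int.emod_lt_of_pos (m - k) ha
    have e : orbitMap c x m = orbitMap c (orbitMap c x k) ((m - k) % a) + n * ((m - k) / a) := by
      rw [← h'.orbitMap_left, Int.emod_add_mul_ediv, orbitMap_orbitMap, add_sub_cancel]
    rw [e] at hd
    have h3 := h'.transversal (Sum.inl ⟨((m - k) % a).toNat, by omega⟩) (Sum.inl ⟨0, h.pos_left⟩) (by
      simp only [Sum.elim_inl, Int.toNat_of_nonneg h1, Nat.cast_zero, orbitMap_zero]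
      rw [add_sub_right_comm] at hd
      exact (Int.dvd_add_left (dvd_mul_right _ _)).1 hd)
    have h4 := congrArg Fin.val (Sum.inl_injective h3)
    dsimp only at h4
    exact Int.dvd_of_emod_eq_zero (by omega)
  · rintro ⟨q, hq⟩
    obtain rfl : m = k + a * q := by linarith
    rw [h.orbitMap_left, add_sub_cancel_left]
    exact dvd_mul_right _ _

theorem right_dvd_iff (h : HasOrbits c a b x ξ) (m k : ℤ) :
    (n : ℤ) ∣ orbitMap c ξ m - orbitMap c ξ k ↔ (b : ℤ) ∣ m - k := by
  have := h.inv.left_dvd_iff (-m) (-k)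
  rw [orbitMap_inv, orbitMap_inv, neg_neg, neg_neg, neg_sub_neg] at this
  rw [this, dvd_sub_comm]

theorem not_dvd_left_right (h : HasOrbits c a b x ξ) (m k : ℤ) :
    ¬ (n : ℤ) ∣ orbitMap c x m - orbitMap c ξ k := by
  intro hd
  have h3 := (h.rebase m k).transversal (Sum.inl ⟨0, h.pos_left⟩) (Sum.inr ⟨0, h.pos_right⟩) (by
    simpa [orbitMap_zero] using hd)
  cases h3

theorem left_injective (h : HasOrbits c a b x ξ) : Function.Injective (orbitMap c x) := by
  intro m k hmk
  have h1 := (h.left_dvd_iff m k).1 (by rw [hmk, sub_self]; exact dvd_zero _)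
  obtain ⟨q, hq⟩ := h1
  obtain rfl : m = k + a * q := by linarith
  rw [h.orbitMap_left, add_eq_left, mul_eq_zero] at hmk
  rcases hmk with h2 | rfl
  · exact absurd (by exact_mod_cast h2) (NeZero.ne n)
  · simp

theorem right_injective (h : HasOrbits c a b x ξ) : Function.Injective (orbitMap c ξ) := by
  intro m k hmk
  apply neg_injective
  apply h.inv.left_injective
  rw [orbitMap_inv, orbitMap_inv, neg_neg, neg_neg, hmk]

end HasOrbits

namespace CoxeterElement

variable {c : CoxeterElement n} {a b : ℕ} {x ξ : ℤ}

theorem X_eq (h : HasOrbits c.1 a b x ξ) : c.X = Set.range (orbitMap c.1 x) := by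
  have hn : (0 : ℤ) < n := by exact_mod_cast NeZero.pos n
  ext y
  constructor
  · rintro ⟨k, hk, hy⟩
    rcases h.exists_orbitMap y with ⟨m, rfl⟩ | ⟨m, rfl⟩
    · exact ⟨m, rfl⟩
    · exfalso
      rw [← zpow_natCast, ← orbitMap] at hy
      -- Computing c^(bk) in two ways on this point y of the second orbit gives y - nk = y + nb,
      -- impossible for positive b and k.
      have h1 := (h.rebase 0 m).orbitMap_right 0 k
      have h2 := orbitMap_period (e := 1) (by rw [hy, mul_one]) 0 b
      rw [mul_comm (k : ℤ), h1, orbitMap_zero] at h2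
      have hb : (0 : ℤ) < b := by exact_mod_cast h.pos_right
      have hk' : (0 : ℤ) < k := by exact_mod_cast hk
      nlinarith
  · rintro ⟨m, rfl⟩
    exact ⟨a, h.pos_left, (h.rebase m 0).pow_left⟩

theorem Xi_eq (h : HasOrbits c.1 a b x ξ) : c.Xi = Set.range (orbitMap c.1 ξ) := by
  have hn : (0 : ℤ) < n := by exact_mod_cast NeZero.pos n
  ext y
  constructor
  · rintro ⟨k, hk, hy⟩
    rcases h.exists_orbitMap y with ⟨m, rfl⟩ | ⟨m, rfl⟩
    · exfalso
      rw [← zpow_natCast, ← orbitMap] at hy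
      have h1 := (h.rebase m 0).orbitMap_left 0 k
      have h2 := orbitMap_period (e := -1) (by rw [hy]; ring) 0 a
      rw [mul_comm (k : ℤ), h1, orbitMap_zero] at h2
      have ha : (0 : ℤ) < a := by exact_mod_cast h.pos_left
      have hk' : (0 : ℤ) < k := by exact_mod_cast hk
      nlinarith
    · exact ⟨m, rfl⟩
  · rintro ⟨m, rfl⟩
    exact ⟨b, h.pos_right, (h.rebase 0 m).pow_right⟩

theorem ncard_inter_Icc (h : HasOrbits c.1 a b x ξ) (S : Set ℤ) (hS : ∀ y k : ℤ, y + n * k ∈ S ↔ y ∈ S) :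
    (S ∩ Set.Icc 1 (n : ℤ)).ncard = Nat.card {i : Fin a // orbitMap c.1 x i ∈ S} +
      Nat.card {j : Fin b // orbitMap c.1 ξ j ∈ S} := by
  classical
  have h1 := sum_transversal (n := n) (by simp [h.add_eq]) h.transversal
    (h := fun y => if y ∈ S then 1 else 0) (fun y k => by simp only [hS])
  have e : S ∩ Set.Icc 1 (n : ℤ) = ((Finset.Icc (1 : ℤ) n).filter (· ∈ S) : Finset ℤ) := by
    ext y
    simp only [Set.mem_inter_iff, Set.mem_Icc, Finset.coe_filter, Finset.mem_Icc, Set.mem_ofPred_eq]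
    tauto
  rw [e, Set.ncard_coe_finset, Finset.card_filter, ← h1, Fintype.sum_sum_type]
  simp only [Sum.elim_inl, Sum.elim_inr, Finset.card_filter,
    Nat.card_eq_fintype_card, Fintype.card_subtype]
  congr!

theorem cardX_eq (h : HasOrbits c.1 a b x ξ) : c.cardX = a := by
  rw [cardX, ncard_inter_Icc h, X_eq h]
  · have e : ∀ j : Fin b, orbitMap c.1 ξ j ∉ Set.range (orbitMap c.1 x) := by
      rintro j ⟨m, hm⟩
      exact h.not_dvd_left_right m j (by rw [hm, sub_self]; exact dvd_zero _)
    simp [e]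
  · intro y k
    rw [X_eq h]
    constructor
    · rintro ⟨m, hm⟩
      exact ⟨m + a * -k, by rw [h.orbitMap_left, hm]; ring⟩
    · rintro ⟨m, hm⟩
      exact ⟨m + a * k, by rw [h.orbitMap_left, hm]⟩

theorem cardXi_eq (h : HasOrbits c.1 a b x ξ) : c.cardXi = b := by
  rw [cardXi, ncard_inter_Icc h, Xi_eq h]
  · have e : ∀ i : Fin a, orbitMap c.1 x i ∉ Set.range (orbitMap c.1 ξ) := by
      rintro i ⟨m, hm⟩
      exact h.not_dvd_left_right i m (by rw [hm, sub_self]; exact dvd_zero _)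
    simp [e]
  · intro y k
    rw [Xi_eq h]
    constructor
    · rintro ⟨m, hm⟩
      exact ⟨m + b * k, by rw [h.orbitMap_right, hm]; ring⟩
    · rintro ⟨m, hm⟩
      exact ⟨m + b * -k, by rw [h.orbitMap_right, hm]; ring⟩

theorem exists_isRank {L : List ℕ} (hL : L.Perm (List.range' 1 n)) : ∃ ρ, IsRank L ρ n := by
  have hn : (0 : ℤ) < n := by exact_mod_cast NeZero.pos n
  have hlen : L.length = n := by rw [hL.length_eq, List.length_range']
  have hnd : L.Nodup := hL.nodup_iff.2 List.nodup_range'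
  have hmem : ∀ i, i ∈ L ↔ 1 ≤ i ∧ i ≤ n := fun i => by
    rw [hL.mem_iff, List.mem_range'_1]
    omega
  have hrep : ∀ x : ℤ, ((x - 1) % n + 1).toNat ∈ L := fun x => by
    have h1 := Int.emod_nonneg (x - 1) hn.ne'
    have h2 := Int.emod_lt_of_pos (x - 1) hn
    rw [hmem]
    omega
  refine ⟨fun x => L.idxOf ((x - 1) % n + 1).toNat, hlen, fun x => ?_, fun t ht x => ?_⟩
  · have := List.idxOf_lt_length_iff.2 (hrep x)
    dsimp only
    omega
  · have h1 := Int.emod_nonneg (x - 1) hn.ne'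
    have h2 := Int.emod_lt_of_pos (x - 1) hn
    have e := Int.emod_add_mul_ediv (x - 1) n
    have h3 := (hmem _).1 (L.getElem_mem ht)
    have h4 : L.idxOf ((x - 1) % n + 1).toNat = t ↔ ((x - 1) % n + 1).toNat = L[t] := by
      constructor
      · rintro rfl
        rw [List.getElem_idxOf]
      · intro h5
        rw [h5]
        exact hnd.idxOf_getElem _ ht
    rw [h4]
    constructor
    · intro h5
      refine ⟨(x - 1) / n, ?_⟩
      omega
    · intro h5
      have h6 : (n : ℤ) ∣ ((x - 1) % n) - (L[t] - 1 : ℤ) := by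
        have : (x - 1) % n - (L[t] - 1 : ℤ) = x - L[t] - n * ((x - 1) / n) := by linarith
        rw [this]
        exact dvd_sub h5 (dvd_mul_right _ _)
      have := dvd_sub_imp_eq h1 h2 (by omega) (by omega) h6
      omega

theorem exists_hasOrbits (c : CoxeterElement n) : ∃ a b x ξ, HasOrbits c.1 a b x ξ := by
  obtain ⟨l, hl, hc⟩ := c.2
  obtain ⟨ρ, hρ⟩ := exists_isRank ((List.reverse_perm l).trans hl)
  obtain ⟨x, ξ, h⟩ := hρ.hasOrbits
  rw [simpleProd, List.reverse_reverse, ← hc] at h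
  exact ⟨_, _, x, ξ, h⟩

/-- Apply the simple reflections in the order a, a - 1, …, 1, a + 1, …, n. Then s_x comes before
s_(x-1) exactly for x in [1, a]. At x = 1 this uses that s_0 = s_n comes last, as b > 0. -/
theorem exists_hasOrbits_of_add_eq {a b : ℕ} (ha : 0 < a) (hb : 0 < b) (hab : a + b = n) :
    ∃ (c : CoxeterElement n) (x ξ : ℤ), HasOrbits c.1 a b x ξ := by
  have hn : (0 : ℤ) < n := by exact_mod_cast NeZero.pos n
  set L : List ℕ := (List.range n).map fun t => if t < a then a - t else t + 1 with hL
  set ρ : ℤ → ℕ := fun x =>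
    if (x - 1) % n < a then a - 1 - ((x - 1) % n).toNat else ((x - 1) % n).toNat with hρ
  have hlen : L.length = n := by simp [hL]
  have hperm : L.Perm (List.range' 1 n) := by
    refine (List.perm_ext_iff_of_nodup ?_ List.nodup_range').2 fun i => ?_
    · refine List.Nodup.map_on (fun s hs t ht hst => ?_) List.nodup_range
      split_ifs at hst <;> omega
    · rw [List.mem_range'_1, hL, List.mem_map]
      constructor
      · rintro ⟨t, ht, rfl⟩
        rw [List.mem_range] at ht
        split_ifs <;> omega
      · intro hi
        by_cases h : i ≤ a
        · exact ⟨a - i, by rw [List.mem_range]; omega, by rw [if_pos (by omega)]; omega⟩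
        · exact ⟨i - 1, by rw [List.mem_range]; omega, by rw [if_neg (by omega)]; omega⟩
  have hrank : IsRank L ρ n := by
    refine ⟨hlen, fun x => ?_, fun t ht x => ?_⟩
    · have h1 := Int.emod_nonneg (x - 1) hn.ne'
      have h2 := Int.emod_lt_of_pos (x - 1) hn
      simp only [hρ]
      split_ifs <;> omega
    · have h1 := Int.emod_nonneg (x - 1) hn.ne'
      have h2 := Int.emod_lt_of_pos (x - 1) hn
      have hLt : L[t] = if t < a then a - t else t + 1 := by simp [hL]
      have h3 : (n : ℤ) ∣ x - L[t] ↔ (x - 1) % n = L[t] - 1 := by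
        have e : x - L[t] = ((x - 1) % n - (L[t] - 1 : ℤ)) + n * ((x - 1) / n) := by
          have := Int.emod_add_mul_ediv (x - 1) n
          linarith
        rw [e, Int.dvd_add_left (dvd_mul_right _ _)]
        constructor
        · exact dvd_sub_imp_eq h1 h2 (by rw [hLt]; split_ifs <;> omega)
            (by rw [hLt]; split_ifs <;> omega)
        · intro h
          rw [h, sub_self]
          exact dvd_zero _
      rw [h3, hLt]
      simp only [hρ]
      split_ifs <;> omega
  obtain ⟨x, ξ, h⟩ := hrank.hasOrbits
  have hU : ((Finset.Icc (1 : ℤ) n).filter fun x => ρ x < ρ (x - 1)) = Finset.Icc (1 : ℤ) a := by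
    ext x
    rw [Finset.mem_filter, Finset.mem_Icc, Finset.mem_Icc]
    have key : 1 ≤ x → x ≤ n → (ρ x < ρ (x - 1) ↔ x ≤ a) := by
      intro h1 h2
      have e1 : (x - 1) % n = x - 1 := Int.emod_eq_of_lt (by omega) (by omega)
      rcases eq_or_lt_of_le h1 with rfl | h3
      · have e2 : (1 - 1 - 1 : ℤ) % n = n - 1 := by
          rw [← Int.add_emod_right, Int.emod_eq_of_lt (by omega) (by omega)]
          ring
        simp only [hρ, e1, e2]
        split_ifs <;> omega
      · have e2 : (x - 1 - 1) % n = x - 1 - 1 := Int.emod_eq_of_lt (by omega) (by omega)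
        simp only [hρ, e1, e2]
        split_ifs <;> omega
    constructor
    · rintro ⟨⟨h1, h2⟩, h3⟩
      exact ⟨h1, (key h1 h2).1 h3⟩
    · rintro ⟨h1, h2⟩
      exact ⟨⟨h1, by omega⟩, (key h1 (by omega)).2 h2⟩
  have e1 : ((Finset.Icc (1 : ℤ) n).filter fun x => ρ x < ρ (x - 1)).card = a := by
    rw [hU]
    simp
  have e2 := h.add_eq
  rw [e1] at h e2
  rw [show ((Finset.Icc (1 : ℤ) n).filter fun x => ¬ ρ x < ρ (x - 1)).card = b by omega] at h
  exact ⟨⟨simpleProd n L, L.reverse, (List.reverse_perm L).trans hperm, rfl⟩, x, ξ, h⟩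

end CoxeterElement

end Orbits

/-! ### Closed cycles through all classes, multiplied by a reflection -/

section FullCycle

variable {n : ℕ} [n.AtLeastTwo]

/-- The orbit of `x` under `w` is a set of representatives of the classes modulo `n`. -/
structure IsFullCycle (w : AffineSymm n) (x : ℤ) : Prop where
  closed : orbitMap w x n = x
  transversal : ∀ s t : Fin n, (n : ℤ) ∣ orbitMap w x s - orbitMap w x t → s = t

namespace IsFullCycle

variable {w : AffineSymm n} {x : ℤ}

theorem orbitMap_add (h : IsFullCycle w x) (m k : ℤ) : orbitMap w x (m + n * k) = orbitMap w x m := by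
  rw [orbitMap_period (e := 0) (by rw [h.closed, mul_zero, add_zero])]
  ring

theorem exists_fin (h : IsFullCycle w x) (m : ℤ) :
    ∃ i : Fin n, (n : ℤ) ∣ m - i ∧ orbitMap w x m = orbitMap w x i := by
  have hn : (0 : ℤ) < n := by exact_mod_cast NeZero.pos n
  have h1 := Int.emod_nonneg m hn.ne'
  have h2 := Int.emod_lt_of_pos m hn
  have e := Int.emod_add_mul_ediv m n
  refine ⟨⟨(m % n).toNat, by omega⟩, ⟨m / n, ?_⟩, ?_⟩
  · simp only [Int.toNat_of_nonneg h1]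
    linarith
  · simp only [Int.toNat_of_nonneg h1]
    rw [← h.orbitMap_add (m % n) (m / n), e]

theorem dvd_iff (h : IsFullCycle w x) (m k : ℤ) :
    (n : ℤ) ∣ orbitMap w x m - orbitMap w x k ↔ (n : ℤ) ∣ m - k := by
  constructor
  · intro hd
    obtain ⟨i, hi, ei⟩ := h.exists_fin m
    obtain ⟨j, hj, ej⟩ := h.exists_fin k
    rw [ei, ej] at hd
    rw [← h.transversal i j hd] at hj
    simpa using dvd_sub hi hj
  · rintro ⟨q, hq⟩
    obtain rfl : m = k + n * q := by linarith
    rw [h.orbitMap_add, sub_self]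
    exact dvd_zero _

theorem rebase (h : IsFullCycle w x) (p : ℤ) : IsFullCycle w (orbitMap w x p) where
  closed := by rw [orbitMap_orbitMap, ← mul_one (n : ℤ), h.orbitMap_add]
  transversal s t hst := by
    rw [orbitMap_orbitMap, orbitMap_orbitMap, h.dvd_iff, add_sub_add_left_eq_sub] at hst
    have := dvd_sub_imp_eq (by omega) (by omega) (by omega) (by omega) hst
    exact Fin.ext (by exact_mod_cast this)

theorem cover (h : IsFullCycle w x) (y : ℤ) : ∃ (i : Fin n) (k : ℤ), y = orbitMap w x i + n * k := by
  have hb : Function.Bijective (fun s : Fin n => (orbitMap w x s : ZMod n)) := by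
    rw [Fintype.bijective_iff_injective_and_card, ZMod.card, Fintype.card_fin]
    refine ⟨fun s t hst => h.transversal s t ?_, rfl⟩
    rw [dvd_sub_comm]
    exact (ZMod.intCast_eq_intCast_iff_dvd_sub _ _ _).1 hst
  obtain ⟨i, hi⟩ := hb.surjective (y : ZMod n)
  obtain ⟨k, hk⟩ := (ZMod.intCast_eq_intCast_iff_dvd_sub _ _ _).1 hi
  exact ⟨i, k, by linarith⟩

theorem not_dvd (h : IsFullCycle w x) {i j : ℕ} (hi : i < n) (hj : j < n) (hij : i ≠ j) :
    ¬ (n : ℤ) ∣ orbitMap w x i - orbitMap w x j := by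
  rw [h.dvd_iff]
  intro hd
  have := dvd_sub_imp_eq (by omega) (by omega) (by omega) (by omega) hd
  omega

/-- The partial product (x, w^m x)⋯(x, wx) is the cycle x → wx → ⋯ → w^m x → x; induction on m adds
one point at a time. -/
theorem star_apply (h : IsFullCycle w x) (m : ℕ) (hm : m < n) (i : ℕ) (hi : i < n) :
    (((((List.range m).reverse.map fun i : ℕ => affRefl n x (orbitMap w x (i + 1 : ℕ))).prod :
      AffineSymm n)) : Equiv.Perm ℤ) (orbitMap w x i) =
      if i < m then orbitMap w x (i + 1 : ℕ) else if i = m then x else orbitMap w x i := by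
  have h0 : ∀ j : ℕ, 0 < j → j < n → ¬ (n : ℤ) ∣ orbitMap w x j - x := fun j hj hjn => by
    have := h.not_dvd hjn (NeZero.pos n) hj.ne'
    rwa [Nat.cast_zero, orbitMap_zero] at this
  induction m with
  | zero =>
    rcases Nat.eq_zero_or_pos i with rfl | hi0
    · simp [orbitMap_zero]
    · simp [hi0.ne']
  | succ m ih =>
    rw [List.range_succ, List.reverse_append, List.reverse_singleton, List.map_append,
      List.prod_append, List.map_singleton, List.prod_singleton, AffineSymm.mul_apply,
      ih (by omega)]
    rcases lt_trichotomy i m with h1 | rfl | h1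
    · rw [if_pos h1, if_pos (by omega), affRefl_apply_of_not_dvd (h0 _ (by omega) (by omega))
        (h.not_dvd (by omega) hm (by omega))]
    · rw [if_neg (by omega), if_pos rfl, if_pos (by omega),
        affRefl_apply_left (h0 _ (by omega) hm)]
    · rw [if_neg (by omega), if_neg (by omega), if_neg (by omega)]
      rcases eq_or_ne i (m + 1) with rfl | h2
      · rw [if_pos rfl, affRefl_apply_right (h0 _ (by omega) hm)]
      · rw [if_neg h2, affRefl_apply_of_not_dvd (h0 _ (by omega) hi) (h.not_dvd hi hm h2)]

/-- A cycle is the product of the reflections joining one of its points to the others. -/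
theorem star_prod (h : IsFullCycle w x) :
    ((List.range (n - 1)).reverse.map fun i : ℕ => affRefl n x (orbitMap w x (i + 1 : ℕ))).prod =
      w := by
  have hn : 0 < n := NeZero.pos n
  refine AffineSymm.ext_apply fun y => ?_
  obtain ⟨i, k, rfl⟩ := h.cover y
  rw [AffineSymm.apply_add_mul, AffineSymm.apply_add_mul, h.star_apply _ (by omega) i i.2,
    apply_orbitMap]
  congr 1
  split_ifs with h1 h2
  · push_cast
    rfl
  · rw [h2, Nat.cast_sub hn, Nat.cast_one, sub_add_cancel, h.closed]
  · omega

/-- Multiplying a cycle by a reflection joining two of its points shortens it. -/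
theorem exists_list_mul (h : IsFullCycle w x) {p q : ℤ} (hpq : ¬ (n : ℤ) ∣ q - p) :
    ∃ l : List (AffineSymm n), (∀ r ∈ l, r ∈ reflections n) ∧
      l.prod = affRefl n (orbitMap w x p) (orbitMap w x q) * w ∧ l.length + 2 = n := by
  have h' := h.rebase p
  have h0 : ∀ j : ℕ, 0 < j → j < n → ¬ (n : ℤ) ∣ orbitMap w (orbitMap w x p) j - orbitMap w x p :=
    fun j hj hjn => by
      have := h'.not_dvd hjn (NeZero.pos n) hj.ne'
      rwa [Nat.cast_zero, orbitMap_zero] at this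
  obtain ⟨i, hi, ei⟩ := h'.exists_fin (q - p)
  rw [orbitMap_orbitMap, add_sub_cancel] at ei
  have hi0 : (i : ℕ) ≠ 0 := by
    intro e
    rw [e] at hi
    exact hpq (by simpa using hi)
  obtain ⟨m, hm, hprod, hlen⟩ := exists_list_cons_of_mem (reflections_conjStable n)
    (l := (List.range (n - 1)).reverse.map fun i : ℕ =>
      affRefl n (orbitMap w x p) (orbitMap w (orbitMap w x p) (i + 1 : ℕ))) (by
        intro r hr
        obtain ⟨j, hj, rfl⟩ := List.mem_map.1 hr
        rw [List.mem_reverse, List.mem_range] at hj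
        exact affRefl_mem_reflections (h0 _ (by omega) (by omega)))
    (s := affRefl n (orbitMap w x p) (orbitMap w x q)) (by
      rw [List.mem_map]
      refine ⟨i - 1, ?_, ?_⟩
      · rw [List.mem_reverse, List.mem_range]
        omega
      · rw [ei, Nat.sub_add_cancel (by omega)])
  refine ⟨m, hm, ?_, ?_⟩
  · rw [h'.star_prod] at hprod
    have e := congrArg (affRefl n (orbitMap w x p) (orbitMap w x q) * ·) hprod
    rwa [← mul_assoc, affRefl_mul_self, one_mul] at e
  · simp at hlen
    have := i.2
    omega

/-- The reflection cuts the cycle into two arcs, which no longer close up: one has total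
displacement -nk, the other nk. A balanced f is constant on each arc, and its two values agree
because nk ≠ 0. By `exists_isBalanced` the product is then not a product of n - 2 or fewer
reflections. -/
theorem balanced_affRefl_mul (h : IsFullCycle w x) {q : ℕ} (hq : 0 < q) (hqn : q < n) {k : ℤ}
    (hk : k ≠ 0) {f : ℤ → ℚ} (hf : ∀ y, f (y + n) = f y)
    (hb : IsBalanced (affRefl n x (orbitMap w x q + n * k) * w) f) (y z : ℤ) : f y = f z := by
  have hn : (n : ℤ) ≠ 0 := by exact_mod_cast NeZero.ne n
  have h0 : ∀ j : ℕ, 0 < j → j < n → ¬ (n : ℤ) ∣ orbitMap w x j - x := fun j hj hjn => by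
    have := h.not_dvd hjn (NeZero.pos n) hj.ne'
    rwa [Nat.cast_zero, orbitMap_zero] at this
  have hd : ∀ u : ℤ, (n : ℤ) ∣ u - (orbitMap w x q + n * k) ↔ (n : ℤ) ∣ u - orbitMap w x q := by
    intro u
    rw [← sub_sub, Int.dvd_iff_dvd_of_dvd_sub]
    simp
  have hs : ¬ (n : ℤ) ∣ orbitMap w x q + n * k - x := by
    rw [dvd_sub_comm, hd, dvd_sub_comm]
    exact h0 q hq hqn
  set s := affRefl n x (orbitMap w x q + n * k) with hs_def
  have hstep : ∀ i : ℕ, i + 1 < n → i + 1 ≠ q →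
      ((s * w : AffineSymm n) : Equiv.Perm ℤ) (orbitMap w x i) = orbitMap w x (i + 1 : ℕ) := by
    intro i hi hiq
    rw [AffineSymm.mul_apply, apply_orbitMap, hs_def, ← Nat.cast_one (R := ℤ), ← Nat.cast_add,
      affRefl_apply_of_not_dvd (h0 _ (by omega) hi)]
    rw [hd]
    exact h.not_dvd hi hqn hiq
  have hstep1 : ((s * w : AffineSymm n) : Equiv.Perm ℤ) (orbitMap w x (q - 1 : ℕ)) = x - n * k := by
    rw [AffineSymm.mul_apply, apply_orbitMap, ← Nat.cast_one (R := ℤ), ← Nat.cast_add,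
      Nat.sub_add_cancel hq, hs_def]
    have h2 := AffineSymm.apply_add_mul (affRefl n x (orbitMap w x q + n * k)) (orbitMap w x q) k
    rw [affRefl_apply_right hs] at h2
    linarith
  have hstep2 : ((s * w : AffineSymm n) : Equiv.Perm ℤ) (orbitMap w x (n - 1 : ℕ)) =
      orbitMap w x q + n * k := by
    rw [AffineSymm.mul_apply, apply_orbitMap, ← Nat.cast_one (R := ℤ), ← Nat.cast_add,
      Nat.sub_add_cancel (by omega), h.closed, hs_def, affRefl_apply_left hs]
  have c1 : ∀ i : ℕ, i < q → f (orbitMap w x i) = f x := by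
    intro i
    induction i with
    | zero => intro _; rfl
    | succ i ih =>
      intro hi
      rw [← hstep i (by omega) (by omega), hb.1, ih (by omega)]
  have c2 : ∀ i : ℕ, q + i < n → f (orbitMap w x (q + i : ℕ)) = f (orbitMap w x q) := by
    intro i
    induction i with
    | zero => intro _; rfl
    | succ i ih =>
      intro hi
      rw [← add_assoc, ← hstep (q + i) (by omega) (by omega), hb.1, ih (by omega)]
  have hsum := hb.2
  rw [← sum_transversal (o := fun i : Fin n => orbitMap w x i) (by simp) h.transversal
    (fun y k => by rw [add_mul_of_add hf, disp_periodic (s * w).2.1]),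
    Fin.sum_univ_eq_sum_range (fun i : ℕ => f (orbitMap w x i) *
      (((s * w : AffineSymm n) : Equiv.Perm ℤ) (orbitMap w x i) - orbitMap w x i : ℤ)) n] at hsum
  obtain ⟨d, rfl⟩ : ∃ d, n = q + d := ⟨n - q, by omega⟩
  rw [Finset.sum_range_add] at hsum
  -- G and H list the successive points of the two arcs, with the true endpoint (translated by -nk
  -- or nk) in last place, so that the displacement sums telescope.
  set G : ℕ → ℤ := fun i => if i = q then x - (q + d : ℕ) * k else orbitMap w x i with hG
  set H : ℕ → ℤ := fun i => if i = d then orbitMap w x q + (q + d : ℕ) * k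
    else orbitMap w x (q + i : ℕ) with hH
  have e1 : ∀ i ∈ Finset.range q, f (orbitMap w x i) *
      (((s * w : AffineSymm (q + d)) : Equiv.Perm ℤ) (orbitMap w x i) - orbitMap w x i : ℤ) =
      f x * (G (i + 1) - G i : ℤ) := by
    intro i hi
    rw [Finset.mem_range] at hi
    rw [c1 i hi, hG]
    dsimp only
    rw [if_neg hi.ne]
    by_cases hiq : i + 1 = q
    · obtain rfl : i = q - 1 := by omega
      rw [if_pos hiq, hstep1]
    · rw [if_neg hiq, hstep i (by omega) hiq]
  have e2 : ∀ i ∈ Finset.range d, f (orbitMap w x (q + i : ℕ)) *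
      (((s * w : AffineSymm (q + d)) : Equiv.Perm ℤ) (orbitMap w x (q + i : ℕ)) -
        orbitMap w x (q + i : ℕ) : ℤ) = f (orbitMap w x q) * (H (i + 1) - H i : ℤ) := by
    intro i hi
    rw [Finset.mem_range] at hi
    rw [c2 i (by omega), hH]
    dsimp only
    rw [if_neg hi.ne]
    by_cases hiq : i + 1 = d
    · obtain rfl : i = d - 1 := by omega
      rw [if_pos hiq, ← Nat.add_sub_assoc (by omega), hstep2]
    · rw [if_neg hiq, hstep (q + i) (by omega) (by omega), add_assoc]
  rw [Finset.sum_congr rfl e1, Finset.sum_congr rfl e2, ← Finset.mul_sum, ← Finset.mul_sum,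
    ← Int.cast_sum, ← Int.cast_sum, Finset.sum_range_sub, Finset.sum_range_sub] at hsum
  have g1 : G q - G 0 = -((q + d : ℕ) * k) := by
    simp only [hG, if_true, if_neg hq.ne, Nat.cast_zero, orbitMap_zero]
    ring
  have g2 : H d - H 0 = (q + d : ℕ) * k := by
    have : (0 : ℕ) ≠ d := by omega
    simp only [hH, if_true, if_neg this, add_zero]
    ring
  rw [g1, g2] at hsum
  have hnk : (((q + d : ℕ) * k : ℤ) : ℚ) ≠ 0 := by exact_mod_cast mul_ne_zero hn hk
  have hαβ : f (orbitMap w x q) = f x := by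
    push_cast at hsum hnk
    have : (f (orbitMap w x q) - f x) * (((q : ℚ) + d) * k) = 0 := by linarith
    rcases mul_eq_zero.1 this with h1 | h1
    · linarith
    · exact absurd h1 hnk
  have hall : ∀ y, f y = f x := by
    intro y
    obtain ⟨i, m, rfl⟩ := h.cover y
    rw [add_mul_of_add hf]
    rcases lt_or_ge (i : ℕ) q with h1 | h1
    · exact c1 _ h1
    · obtain ⟨j, hj⟩ := Nat.exists_eq_add_of_le h1
      have := i.2
      rw [hj, c2 j (by omega), hαβ]
  rw [hall y, hall z]

end IsFullCycle

end FullCycle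

/-! ### Length of c and partners of vertical reflections -/

section Atoms

variable {n : ℕ} [n.AtLeastTwo]

namespace HasOrbits

variable {c : AffineSymm n} {a b : ℕ} {x ξ : ℤ}

/-- A balanced f takes one value on each orbit. The displacement is n over a period of X and -n over
a period of Ξ, so n(f(x) - f(ξ)) = 0. -/
theorem balanced_const (h : HasOrbits c a b x ξ) {f : ℤ → ℚ} (hf : ∀ y, f (y + n) = f y)
    (hb : IsBalanced c f) (y z : ℤ) : f y = f z := by
  have hn : (n : ℚ) ≠ 0 := by exact_mod_cast NeZero.ne n
  have hpow : ∀ y (m : ℤ), f (orbitMap c y m) = f y := by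
    intro y m
    induction m with
    | zero => rfl
    | succ i ih => rw [← apply_orbitMap, hb.1, ih]
    | pred i ih => rw [← ih, ← hb.1, apply_orbitMap, sub_add_cancel]
  have hsum := hb.2
  rw [← sum_transversal (by simp [h.add_eq]) h.transversal
    (fun y k => by rw [add_mul_of_add hf, disp_periodic c.2.1]), Fintype.sum_sum_type] at hsum
  simp only [Sum.elim_inl, Sum.elim_inr, hpow, apply_orbitMap, ← Finset.mul_sum,
    ← Int.cast_sum] at hsum
  rw [Fin.sum_univ_eq_sum_range (fun i : ℕ => orbitMap c x ((i : ℤ) + 1) - orbitMap c x i) a,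
    Fin.sum_univ_eq_sum_range (fun i : ℕ => orbitMap c ξ ((i : ℤ) + 1) - orbitMap c ξ i) b] at hsum
  have e1 := Finset.sum_range_sub (fun i : ℕ => orbitMap c x i) a
  have e2 := Finset.sum_range_sub (fun i : ℕ => orbitMap c ξ i) b
  have p1 := h.orbitMap_left 0 1
  have p2 := h.orbitMap_right 0 1
  rw [zero_add, mul_one, orbitMap_zero, mul_one] at p1 p2
  push_cast at e1 e2
  rw [e1, e2, p1, p2, orbitMap_zero, orbitMap_zero] at hsum
  have hfx : f x = f ξ := by
    push_cast at hsum
    have : (f x - f ξ) * n = 0 := by linarith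
    rcases mul_eq_zero.1 this with h1 | h1
    · linarith
    · exact absurd h1 hn
  have hall : ∀ y, f y = f x := by
    intro y
    rcases h.exists_orbitMap y with ⟨m, rfl⟩ | ⟨m, rfl⟩
    · exact hpow x m
    · rw [hpow, hfx]
  rw [hall y, hall z]

/-- If `r` exchanges the two orbits of `c`, then `r c` is a full cycle. -/
theorem orbitMap_affRefl_mul (h : HasOrbits c a b x ξ) :
    (∀ i : ℕ, i < a → orbitMap (affRefl n x ξ * c) x i = orbitMap c x i) ∧
    (∀ j : ℕ, j < b → orbitMap (affRefl n x ξ * c) x (a + j : ℕ) = orbitMap c ξ j + n) ∧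
    orbitMap (affRefl n x ξ * c) x n = x := by
  have ha := h.pos_left
  have hb := h.pos_right
  have hxξ : ¬ (n : ℤ) ∣ ξ - x := by
    rw [dvd_sub_comm]
    exact h.not_dvd_left_right 0 0
  have hstep : ∀ i : ℕ, orbitMap (affRefl n x ξ * c) x (i + 1 : ℕ) = (affRefl n x ξ : Equiv.Perm ℤ)
      ((c : Equiv.Perm ℤ) (orbitMap (affRefl n x ξ * c) x i)) := by
    intro i
    rw [← AffineSymm.mul_apply, apply_orbitMap]
    push_cast
    rfl
  have p1 := h.orbitMap_left 0 1
  have p2 := h.orbitMap_right 0 1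
  rw [zero_add, mul_one, orbitMap_zero, mul_one] at p1 p2
  have s1 : ∀ i : ℕ, i < a → orbitMap (affRefl n x ξ * c) x i = orbitMap c x i := by
    intro i
    induction i with
    | zero => intro _; rfl
    | succ i ih =>
      intro hi
      rw [hstep, ih (by omega), apply_orbitMap, ← Nat.cast_one (R := ℤ), ← Nat.cast_add,
        affRefl_apply_of_not_dvd]
      · rw [← orbitMap_zero c x, orbitMap_orbitMap, zero_add, h.left_dvd_iff]
        intro hd
        have := dvd_sub_imp_eq (n := a) (by omega) (by omega) le_rfl (by omega) hd
        omega
      · exact h.not_dvd_left_right _ 0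
  -- After a steps c would arrive at x + n, which the reflection diverts to ξ + n. The orbit then
  -- follows Ξ translated by n until it would reach ξ, and is diverted back to x.
  have s2 : ∀ j : ℕ, j < b → orbitMap (affRefl n x ξ * c) x (a + j : ℕ) = orbitMap c ξ j + n := by
    intro j
    induction j with
    | zero =>
      intro _
      have e : a + 0 = (a - 1) + 1 := by omega
      rw [e, hstep, s1 _ (by omega), apply_orbitMap, ← Nat.cast_one (R := ℤ), ← Nat.cast_add,
        Nat.sub_add_cancel ha, p1, AffineSymm.apply_add, affRefl_apply_left hxξ]
      rfl
    | succ j ih =>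
      intro hj
      rw [← add_assoc, hstep, ih (by omega), AffineSymm.apply_add, AffineSymm.apply_add,
        apply_orbitMap, ← Nat.cast_one (R := ℤ), ← Nat.cast_add, affRefl_apply_of_not_dvd]
      · rw [dvd_sub_comm]
        exact h.not_dvd_left_right 0 _
      · rw [← orbitMap_zero c ξ, orbitMap_orbitMap, zero_add, h.right_dvd_iff]
        intro hd
        have := dvd_sub_imp_eq (n := b) (by omega) (by omega) le_rfl (by omega) hd
        omega
  refine ⟨s1, s2, ?_⟩
  have e : n = (a + (b - 1)) + 1 := by have := h.add_eq; omega
  conv_lhs => rw [show (n : ℤ) = ((a + (b - 1) + 1 : ℕ) : ℤ) by rw [← e]]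
  rw [hstep, s2 _ (by omega), AffineSymm.apply_add, AffineSymm.apply_add, apply_orbitMap,
    ← Nat.cast_one (R := ℤ), ← Nat.cast_add, Nat.sub_add_cancel hb, p2, ← AffineSymm.apply_add,
    sub_add_cancel, affRefl_apply_right hxξ]

theorem isFullCycle (h : HasOrbits c a b x ξ) : IsFullCycle (affRefl n x ξ * c) x := by
  obtain ⟨s1, s2, s3⟩ := h.orbitMap_affRefl_mul
  refine ⟨s3, ?_⟩
  have hab := h.add_eq
  have key : ∀ s : Fin n, ∃ t : Fin a ⊕ Fin b, (∃ k : ℤ, orbitMap (affRefl n x ξ * c) x s =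
      Sum.elim (fun i : Fin a => orbitMap c x i) (fun j : Fin b => orbitMap c ξ j) t + n * k) ∧
      (s : ℕ) = Sum.elim (fun i : Fin a => (i : ℕ)) (fun j : Fin b => a + (j : ℕ)) t := by
    intro s
    rcases lt_or_ge (s : ℕ) a with hs | hs
    · exact ⟨Sum.inl ⟨s, hs⟩, ⟨0, by simp [s1 s hs]⟩, rfl⟩
    · obtain ⟨j, hj⟩ := Nat.exists_eq_add_of_le hs
      refine ⟨Sum.inr ⟨j, by have := s.2; omega⟩, ⟨1, ?_⟩, hj⟩
      have e := s2 j (by have := s.2; omega)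
      rw [← hj] at e
      rw [e, mul_one]
      rfl
  intro s t hst
  obtain ⟨s', ⟨k, hk⟩, es⟩ := key s
  obtain ⟨t', ⟨m, hm⟩, et⟩ := key t
  rw [hk, hm, add_sub_add_comm, ← mul_sub, Int.dvd_add_left (dvd_mul_right _ _)] at hst
  rw [h.transversal s' t' hst, ← et] at es
  exact Fin.ext es

/-- The reflections exchanging the two orbits are determined by the two points exchanged. -/
theorem vertical_eq (h : HasOrbits c a b x ξ) {p q p' q' : ℤ}
    (he : affRefl n (orbitMap c x p) (orbitMap c ξ q) =
      affRefl n (orbitMap c x p') (orbitMap c ξ q')) :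
    ∃ k : ℤ, p' = p + a * k ∧ q' = q - b * k := by
  have hd : ∀ p q : ℤ, ¬ (n : ℤ) ∣ orbitMap c ξ q - orbitMap c x p := fun p q => by
    rw [dvd_sub_comm]
    exact h.not_dvd_left_right p q
  have h1 := affRefl_apply_left (hd p' q')
  rw [← he] at h1
  by_cases h2 : (n : ℤ) ∣ orbitMap c x p' - orbitMap c x p
  · rw [h.left_dvd_iff] at h2
    obtain ⟨k, hk⟩ := h2
    obtain rfl : p' = p + a * k := by linarith
    refine ⟨k, rfl, ?_⟩
    rw [h.orbitMap_left, AffineSymm.apply_add_mul, affRefl_apply_left (hd p q)] at h1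
    have h3 := h.orbitMap_right q (-k)
    apply h.right_injective
    rw [← h1, sub_eq_add_neg, ← mul_neg, h3]
    ring
  · rw [affRefl_apply_of_not_dvd h2 (h.not_dvd_left_right _ _)] at h1
    exact absurd (by rw [h1, sub_self]; exact dvd_zero _) (h.not_dvd_left_right p' q')

end HasOrbits

namespace CoxeterElement

variable {c : CoxeterElement n} {a b : ℕ} {x ξ : ℤ}

/-- The defining expression gives at most n. Balanced functions exclude n - 2 or fewer reflections,
and the signature excludes n - 1. -/
theorem genLength_eq (c : CoxeterElement n) : genLength (reflections n) c.1 = n := by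
  obtain ⟨a, b, x, ξ, h⟩ := c.exists_hasOrbits
  obtain ⟨l, hl, hc⟩ := c.2
  have hlen : l.length = n := by rw [hl.length_eq, List.length_range']
  have hmem : ∀ r ∈ l.map fun i : ℕ => simpleRefl n i, r ∈ reflections n := by
    intro r hr
    obtain ⟨i, -, rfl⟩ := List.mem_map.1 hr
    exact simpleRefl_mem_reflections i
  have hle := genLength_le_length hmem
  rw [← hc, List.length_map, hlen] at hle
  have hsign := affSign_list_prod hmem
  obtain ⟨m, hm, hp, hk⟩ := generates_reflections.exists_list c.1
  have hsign' := affSign_list_prod hm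
  rw [hp, hc, hsign, List.length_map, hlen] at hsign'
  have hm2 : ¬ m.length + 2 ≤ n := by
    intro h2
    obtain ⟨f, hf, hb, y, z, hyz⟩ := exists_isBalanced hm h2
    rw [hp] at hb
    exact hyz (h.balanced_const hf hb y z)
  have hm1 : m.length + 1 ≠ n := by
    intro e
    have e2 : (-1 : ℤˣ) ^ (m.length + 1) = (-1) ^ m.length := by rw [e]; exact hsign'
    rw [pow_succ, mul_eq_left] at e2
    exact absurd e2 (by decide)
  omega

/-- The reflections `s` such that `r s` is a divisor of `c` of length `2`. -/
def partners (c : CoxeterElement n) (r : AffineSymm n) : Set (AffineSymm n) :=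
  {s | s ∈ reflections n ∧ r * s ∈ c.P ∧ genLength (reflections n) (r * s) = 2}

/-- As l(c) = n, being a partner only requires s(rc) to be a product of at most n - 2 reflections;
no exact length needs to be computed. -/
theorem mem_partners {r s : AffineSymm n} (hr : r ∈ reflections n) :
    s ∈ c.partners r ↔ s ∈ reflections n ∧ ∃ l : List (AffineSymm n),
      (∀ t ∈ l, t ∈ reflections n) ∧ l.prod = s * (r * c.1) ∧ l.length + 2 ≤ n := by
  have hg := generates_reflections (n := n)
  have hc := c.genLength_eq
  constructor
  · rintro ⟨hs, hd, hl⟩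
    refine ⟨hs, ?_⟩
    rw [P, mem_divisors_iff, hl, hc] at hd
    obtain ⟨l, hlm, hp, hk⟩ := hg.exists_list ((r * s)⁻¹ * c.1)
    refine ⟨l, hlm, ?_, by omega⟩
    rw [hp, mul_inv_rev, inv_eq_of_mul_eq_one_right (reflections_mul_self hr),
      inv_eq_of_mul_eq_one_right (reflections_mul_self hs), mul_assoc]
  · rintro ⟨hs, l, hlm, hp, hk⟩
    have h1 : c.1 = r * s * (s * (r * c.1)) := by
      rw [mul_assoc r s, ← mul_assoc s s, reflections_mul_self hs, one_mul, ← mul_assoc,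
        reflections_mul_self hr, one_mul]
    have h2 := genLength_le_length hlm
    rw [hp] at h2
    exact ⟨hs, hg.mul_mem_divisors hr hs h1 (by omega)⟩

theorem partners_subset (c : CoxeterElement n) {r : AffineSymm n} (hr : r ∈ reflections n) :
    c.partners r ⊆ c.P := by
  rintro s ⟨hs, hd, hl⟩
  have hg := generates_reflections (n := n)
  have h1 := hg.genLength_of_mem one_notMem_reflections hr
  have h2 := hg.genLength_of_mem one_notMem_reflections hs
  exact hg.right_mem_divisors (reflections_conjStable n) hd (by omega)

/-- With w = rc a full cycle, any reflection joins w^p x to w^q x + nk for some p ≠ q in [0, n). For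
k = 0 it shortens the cycle by `exists_list_mul`; for k ≠ 0 `balanced_affRefl_mul` forbids a product
of n - 2 reflections. -/
theorem partners_vertical (h : HasOrbits c.1 a b x ξ) :
    c.partners (affRefl n x ξ) = {s | ∃ p q : ℕ, p < q ∧ q < n ∧
      s = affRefl n (orbitMap (affRefl n x ξ * c.1) x p) (orbitMap (affRefl n x ξ * c.1) x q)} := by
  have hxξ : ¬ (n : ℤ) ∣ ξ - x := by
    rw [dvd_sub_comm]
    exact h.not_dvd_left_right 0 0
  have hcyc := h.isFullCycle
  set w := affRefl n x ξ * c.1 with hw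
  ext s
  rw [mem_partners (affRefl_mem_reflections hxξ), ← hw]
  constructor
  · rintro ⟨hs, l, hl, hp, hk⟩
    have main : ∀ (p q : ℕ) (k : ℤ), p < q → q < n →
        s = affRefl n (orbitMap w x p) (orbitMap w x q + n * k) → k = 0 := by
      intro p q k hpq hq e
      by_contra hk0
      obtain ⟨f, hf, hb, y, z, hyz⟩ := exists_isBalanced hl hk
      rw [hp, e] at hb
      have e2 : orbitMap w x q = orbitMap w (orbitMap w x p) (q - p : ℕ) := by
        rw [orbitMap_orbitMap, Nat.cast_sub hpq.le, add_sub_cancel]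
      rw [e2] at hb
      exact hyz ((hcyc.rebase p).balanced_affRefl_mul (by omega) (by omega) hk0 hf hb y z)
    obtain ⟨i, j, hij, e⟩ := mem_reflections_iff.1 hs
    obtain ⟨p, k, rfl⟩ := hcyc.cover i
    obtain ⟨q, m, rfl⟩ := hcyc.cover j
    have e1 : ∀ (u v k m : ℤ), affRefl n (u + n * k) (v + n * m) = affRefl n u (v + n * (m - k)) := by
      intro u v k m
      rw [← affRefl_shift u _ k]
      congr 1
      ring
    rcases lt_trichotomy (p : ℕ) q with hpq | hpq | hpq
    · rw [e1] at e
      have h0 := main p q _ hpq q.2 e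
      rw [h0, mul_zero, add_zero] at e
      exact ⟨p, q, hpq, q.2, e⟩
    · exfalso
      rw [hpq, add_sub_add_left_eq_sub, ← mul_sub] at hij
      exact hij (dvd_mul_right _ _)
    · rw [affRefl_comm, e1] at e
      have h0 := main q p _ hpq p.2 e
      rw [h0, mul_zero, add_zero] at e
      exact ⟨q, p, hpq, p.2, e⟩
  · rintro ⟨p, q, hpq, hq, rfl⟩
    have hd : ¬ (n : ℤ) ∣ (q : ℤ) - p := by
      intro hd
      have := dvd_sub_imp_eq (by omega) (by omega) (by omega) (by omega) hd
      omega
    obtain ⟨l, hl, hp, hk⟩ := hcyc.exists_list_mul hd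
    refine ⟨affRefl_mem_reflections ?_, l, hl, hp, hk.le⟩
    rwa [hcyc.dvd_iff]

theorem finite_partners_vertical (h : HasOrbits c.1 a b x ξ) :
    (c.partners (affRefl n x ξ)).Finite := by
  rw [partners_vertical h]
  apply ((Set.finite_Iio n).prod (Set.finite_Iio n)).image (fun p : ℕ × ℕ =>
    affRefl n (orbitMap (affRefl n x ξ * c.1) x p.1) (orbitMap (affRefl n x ξ * c.1) x p.2)) |>.subset
  rintro s ⟨p, q, hpq, hq, rfl⟩
  exact ⟨(p, q), ⟨by simp; omega, by simpa using hq⟩, rfl⟩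

end CoxeterElement

end Atoms

/-! ### Recovering {a, b} from the monoid -/

section Invariant

variable {n : ℕ} [n.AtLeastTwo]

namespace CoxeterElement

variable {c : CoxeterElement n} {a b : ℕ} {x ξ : ℤ}

/-- The reflections exchanging a point of `X` and a point of `Ξ`. -/
def verticals (c : CoxeterElement n) : Set (AffineSymm n) :=
  {r | ∃ i ∈ c.X, ∃ j ∈ c.Xi, r = affRefl n i j}

theorem conj_orbitMap (c : CoxeterElement n) {i j : ℤ} (h : ¬ (n : ℤ) ∣ j - i) (m : ℤ) :
    c.1 ^ m * affRefl n i j * (c.1 ^ m)⁻¹ = affRefl n (orbitMap c.1 i m) (orbitMap c.1 j m) :=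
  conj_affRefl _ h

theorem verticals_subset (c : CoxeterElement n) : c.verticals ⊆ reflections n := by
  obtain ⟨a, b, x, ξ, h⟩ := c.exists_hasOrbits
  rintro _ ⟨i, hi, j, hj, rfl⟩
  rw [X_eq h] at hi
  rw [Xi_eq h] at hj
  obtain ⟨p, rfl⟩ := hi
  obtain ⟨q, rfl⟩ := hj
  refine affRefl_mem_reflections ?_
  rw [dvd_sub_comm]
  exact h.not_dvd_left_right p q

/-- A product of reflections none of which exchanges the two orbits of `c` is not equal to `c`. -/
theorem exists_vertical_of_prod (c : CoxeterElement n) {l : List (AffineSymm n)}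
    (hl : ∀ r ∈ l, r ∈ reflections n) (hp : l.prod = c.1) : ∃ r ∈ l, r ∈ c.verticals := by
  classical
  obtain ⟨a, b, x, ξ, h⟩ := c.exists_hasOrbits
  by_contra hcon
  push Not at hcon
  have hdisj : ∀ m, orbitMap c.1 ξ m ∉ c.X := by
    intro m hm
    rw [X_eq h] at hm
    obtain ⟨k, hk⟩ := hm
    exact h.not_dvd_left_right k m (by rw [hk, sub_self]; exact dvd_zero _)
  -- The indicator of X is balanced for every reflection that is not vertical, hence would be
  -- balanced for c; but it is not constant.
  set f : ℤ → ℚ := fun y => if y ∈ c.X then 1 else 0 with hf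
  have hper : ∀ y, f (y + n) = f y := by
    intro y
    have : y + n ∈ c.X ↔ y ∈ c.X := by
      rw [X_eq h]
      constructor
      · rintro ⟨m, hm⟩
        exact ⟨m + a * -1, by rw [h.orbitMap_left, hm]; ring⟩
      · rintro ⟨m, hm⟩
        exact ⟨m + a * 1, by rw [h.orbitMap_left, hm]; ring⟩
    simp only [hf, this]
  have hx : ∀ m, orbitMap c.1 x m ∈ c.X := fun m => by rw [X_eq h]; exact ⟨m, rfl⟩
  have hξ : ∀ m, orbitMap c.1 ξ m ∈ c.Xi := fun m => by rw [Xi_eq h]; exact ⟨m, rfl⟩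
  have hb : IsBalanced c.1 f := by
    rw [← hp]
    refine isBalanced_list_prod hper fun r hr => ?_
    obtain ⟨i, j, -, rfl⟩ := mem_reflections_iff.1 (hl r hr)
    have hv := hcon _ hr
    apply isBalanced_affRefl hper
    rcases h.exists_orbitMap i with ⟨p, rfl⟩ | ⟨p, rfl⟩ <;>
      rcases h.exists_orbitMap j with ⟨q, rfl⟩ | ⟨q, rfl⟩
    · simp [hf, hx]
    · exact absurd ⟨_, hx p, _, hξ q, rfl⟩ hv
    · exact absurd ⟨_, hx q, _, hξ p, affRefl_comm _ _⟩ hv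
    · simp [hf, hdisj]
  have := h.balanced_const hper hb (orbitMap c.1 x 0) (orbitMap c.1 ξ 0)
  simp [hf, hx, hdisj] at this

/-- A shortest expression of c starting with r contains a vertical factor s. Moving s to the front
of the remaining factors makes it a partner of r. Conjugation by powers of c^e fixes r and c, hence
permutes the partners of r, and the conjugates of s are pairwise distinct. -/
theorem infinite_partners_of_conj (c : CoxeterElement n) {r : AffineSymm n}
    (hr : r ∈ reflections n) (hrP : r ∈ c.P) (hv : r ∉ c.verticals) {e : ℤ} (he : e ≠ 0)
    (hconj : c.1 ^ e * r * (c.1 ^ e)⁻¹ = r) : (c.partners r).Infinite := by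
  have hg := generates_reflections (n := n)
  obtain ⟨l, hl, hp, hk⟩ := hg.exists_list (r * c.1)
  have hlen : l.length + 1 = n := by
    have h1 := mem_divisors_iff.1 hrP
    rw [c.genLength_eq, hg.genLength_of_mem one_notMem_reflections hr,
      inv_eq_of_mul_eq_one_right (reflections_mul_self hr)] at h1
    omega
  obtain ⟨s, hs, hsv⟩ := c.exists_vertical_of_prod (l := r :: l) (List.forall_mem_cons.2 ⟨hr, hl⟩) (by
    rw [List.prod_cons, hp, ← mul_assoc, reflections_mul_self hr, one_mul])
  have hsl : s ∈ l := by
    rcases List.mem_cons.1 hs with rfl | h1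
    · exact absurd hsv hv
    · exact h1
  obtain ⟨m, hm, hmp, hmk⟩ := exists_list_cons_of_mem (reflections_conjStable n) hl hsl
  have hsp : s ∈ c.partners r := by
    rw [mem_partners hr]
    refine ⟨hl s hsl, m, hm, ?_, by omega⟩
    rw [← hp, ← hmp, ← mul_assoc, reflections_mul_self (hl s hsl), one_mul]
  obtain ⟨i, hi, j, hj, rfl⟩ := hsv
  obtain ⟨a, b, x, ξ, h⟩ := c.exists_hasOrbits
  rw [X_eq h] at hi
  rw [Xi_eq h] at hj
  obtain ⟨p, rfl⟩ := hi
  obtain ⟨q, rfl⟩ := hj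
  have hd : ¬ (n : ℤ) ∣ orbitMap c.1 ξ q - orbitMap c.1 x p := by
    rw [dvd_sub_comm]
    exact h.not_dvd_left_right p q
  have hpow : ∀ k : ℤ, c.1 ^ (e * k) * r * (c.1 ^ (e * k))⁻¹ = r := by
    intro k
    have h1 : Commute (c.1 ^ e) r := mul_inv_eq_iff_eq_mul.1 hconj
    have h2 := h1.zpow_left k
    rw [← zpow_mul] at h2
    exact mul_inv_eq_iff_eq_mul.2 h2
  refine Set.infinite_of_injective_forall_mem (f := fun k : ℤ =>
    c.1 ^ (e * k) * affRefl n (orbitMap c.1 x p) (orbitMap c.1 ξ q) * (c.1 ^ (e * k))⁻¹) ?_ ?_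
  · intro k k' hkk
    dsimp only at hkk
    rw [c.conj_orbitMap hd, c.conj_orbitMap hd, orbitMap_orbitMap, orbitMap_orbitMap,
      orbitMap_orbitMap, orbitMap_orbitMap] at hkk
    obtain ⟨t, h1, h2⟩ := h.vertical_eq hkk
    have ha : (0 : ℤ) < a := by exact_mod_cast h.pos_left
    have hb : (0 : ℤ) < b := by exact_mod_cast h.pos_right
    -- The same step e(k' - k) equals at along X and -bt along Ξ.
    have h3 : ((a : ℤ) + b) * t = 0 := by linarith
    have h4 : t = 0 := by
      rcases mul_eq_zero.1 h3 with h4 | h4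
      · omega
      · exact h4
    rw [h4] at h1
    have h5 : e * k' = e * k := by linarith
    exact (mul_left_cancel₀ he h5).symm
  · intro k
    obtain ⟨hs1, hs2, hs3⟩ := hsp
    set g := c.1 ^ (e * k) with hg_def
    have hgc : g * c.1 * g⁻¹ = c.1 := by
      rw [mul_inv_eq_iff_eq_mul]
      exact (Commute.refl c.1).zpow_left (e * k)
    have e1 : r * (g * affRefl n (orbitMap c.1 x p) (orbitMap c.1 ξ q) * g⁻¹) =
        g * (r * affRefl n (orbitMap c.1 x p) (orbitMap c.1 ξ q)) * g⁻¹ := by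
      have hgr : g * r * g⁻¹ = r := hpow k
      conv_lhs => rw [← hgr]
      group
    refine ⟨reflections_conjStable n g _ hs1, ?_, ?_⟩
    · rw [e1]
      exact conj_mem_divisors (reflections_conjStable n) hgc hs2
    · rw [e1, genLength_conj (reflections_conjStable n), hs3]

/-- Since c^a translates X by n and c^b translates Ξ by -n, one of them commutes with r. -/
theorem infinite_partners (c : CoxeterElement n) {r : AffineSymm n}
    (hr : r ∈ reflections n) (hrP : r ∈ c.P) (hv : r ∉ c.verticals) : (c.partners r).Infinite := by
  obtain ⟨a, b, x, ξ, h⟩ := c.exists_hasOrbits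
  obtain ⟨i, j, hij, rfl⟩ := mem_reflections_iff.1 hr
  have ha : (a : ℤ) ≠ 0 := by exact_mod_cast h.pos_left.ne'
  have hb : (b : ℤ) ≠ 0 := by exact_mod_cast h.pos_right.ne'
  rcases h.exists_orbitMap i with ⟨p, rfl⟩ | ⟨p, rfl⟩ <;>
    rcases h.exists_orbitMap j with ⟨q, rfl⟩ | ⟨q, rfl⟩
  · refine c.infinite_partners_of_conj hr hrP hv ha ?_
    rw [c.conj_orbitMap hij, orbitMap_orbitMap, orbitMap_orbitMap, ← mul_one (a : ℤ),
      h.orbitMap_left, h.orbitMap_left, affRefl_shift]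
  · exact absurd ⟨_, by rw [X_eq h]; exact ⟨p, rfl⟩, _, by rw [Xi_eq h]; exact ⟨q, rfl⟩, rfl⟩ hv
  · exact absurd ⟨_, by rw [X_eq h]; exact ⟨q, rfl⟩, _, by rw [Xi_eq h]; exact ⟨p, rfl⟩,
      affRefl_comm _ _⟩ hv
  · refine c.infinite_partners_of_conj hr hrP hv hb ?_
    rw [c.conj_orbitMap hij, orbitMap_orbitMap, orbitMap_orbitMap, ← mul_one (b : ℤ),
      h.orbitMap_right, h.orbitMap_right, sub_eq_add_neg, sub_eq_add_neg, ← mul_neg, affRefl_shift]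

theorem not_vertical_of_mem_X (h : HasOrbits c.1 a b x ξ) (p q : ℤ) :
    affRefl n (orbitMap c.1 x p) (orbitMap c.1 x q) ∉ c.verticals := by
  rintro ⟨i, hi, j, hj, e⟩
  rw [X_eq h] at hi
  rw [Xi_eq h] at hj
  obtain ⟨p', rfl⟩ := hi
  obtain ⟨q', rfl⟩ := hj
  have h1 := affRefl_apply_right (n := n) (i := orbitMap c.1 x p') (j := orbitMap c.1 ξ q') (by
    rw [dvd_sub_comm]
    exact h.not_dvd_left_right p' q')
  rw [← e, affRefl_apply_of_not_dvd] at h1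
  · exact h.not_dvd_left_right p' q' (by rw [h1, sub_self]; exact dvd_zero _)
  · rw [dvd_sub_comm]
    exact h.not_dvd_left_right _ _
  · rw [dvd_sub_comm]
    exact h.not_dvd_left_right _ _

theorem not_vertical_of_mem_Xi (h : HasOrbits c.1 a b x ξ) (p q : ℤ) :
    affRefl n (orbitMap c.1 ξ p) (orbitMap c.1 ξ q) ∉ c.verticals := by
  rintro ⟨i, hi, j, hj, e⟩
  rw [X_eq h] at hi
  rw [Xi_eq h] at hj
  obtain ⟨p', rfl⟩ := hi
  obtain ⟨q', rfl⟩ := hj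
  have h1 := affRefl_apply_left (n := n) (i := orbitMap c.1 x p') (j := orbitMap c.1 ξ q') (by
    rw [dvd_sub_comm]
    exact h.not_dvd_left_right p' q')
  rw [← e, affRefl_apply_of_not_dvd (h.not_dvd_left_right _ _) (h.not_dvd_left_right _ _)] at h1
  exact h.not_dvd_left_right p' q' (by rw [h1, sub_self]; exact dvd_zero _)

/-- The cycle rc passes through a points of X, then b points of Ξ. A vertical partner picks one of
each. -/
theorem ncard_partners_inter_verticals (h : HasOrbits c.1 a b x ξ) :
    (c.partners (affRefl n x ξ) ∩ c.verticals).ncard = a * b := by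
  obtain ⟨s1, s2, s3⟩ := h.orbitMap_affRefl_mul
  have hab := h.add_eq
  -- The cycle meets Ξ translated by n, which in the parametrization of Ξ means going back b steps.
  have shift : ∀ m, orbitMap c.1 ξ m + n = orbitMap c.1 ξ (m + b * -1) := fun m => by
    rw [h.orbitMap_right]
    ring
  have e : c.partners (affRefl n x ξ) ∩ c.verticals = Set.range (fun p : Fin a × Fin b =>
      affRefl n (orbitMap c.1 x p.1) (orbitMap c.1 ξ (p.2 + b * -1))) := by
    rw [partners_vertical h]
    ext s
    constructor
    · rintro ⟨⟨p, q, hpq, hq, rfl⟩, hv⟩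
      rcases lt_or_ge q a with h1 | h1
      · rw [s1 p (by omega), s1 q h1] at hv
        exact absurd hv (not_vertical_of_mem_X h _ _)
      · obtain ⟨j, rfl⟩ := Nat.exists_eq_add_of_le h1
        rw [s2 j (by omega), shift] at hv ⊢
        rcases lt_or_ge p a with h2 | h2
        · exact ⟨(⟨p, h2⟩, ⟨j, by omega⟩), by rw [s1 p h2]⟩
        · obtain ⟨i, rfl⟩ := Nat.exists_eq_add_of_le h2
          rw [s2 i (by omega), shift] at hv
          exact absurd hv (not_vertical_of_mem_Xi h _ _)
    · rintro ⟨⟨i, j⟩, rfl⟩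
      refine ⟨⟨i, a + j, by omega, by omega, ?_⟩, ⟨_, ?_, _, ?_, rfl⟩⟩
      · rw [s1 i i.2, s2 j j.2, shift]
      · rw [X_eq h]
        exact ⟨_, rfl⟩
      · rw [Xi_eq h]
        exact ⟨_, rfl⟩
  rw [e, ← Nat.card_coe_set_eq, Nat.card_range_of_injective]
  · simp
  · rintro ⟨i, j⟩ ⟨i', j'⟩ hij
    obtain ⟨k, h1, h2⟩ := h.vertical_eq hij
    dsimp only at h1 h2
    have e1 := dvd_sub_imp_eq (n := a) (s := (i' : ℕ)) (t := (i : ℕ)) (by omega) (by omega) (by omega)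
      (by omega) ⟨k, by linarith⟩
    have e2 := dvd_sub_imp_eq (n := b) (s := (j' : ℕ)) (t := (j : ℕ)) (by omega) (by omega) (by omega)
      (by omega) ⟨-k, by linarith⟩
    exact Prod.ext (Fin.ext (by exact_mod_cast e1.symm)) (Fin.ext (by exact_mod_cast e2.symm))

theorem atomPartners_gen {r : c.P} (hr : (r : AffineSymm n) ∈ reflections n) :
    atomPartners (DualMonoid.gen r : c.M) =
      DualMonoid.gen '' {s : c.P | (s : AffineSymm n) ∈ c.partners r} :=
  DualMonoid.atomPartners_gen generates_reflections (reflections_conjStable n)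
    one_notMem_reflections (fun _ => reflections_mul_self) hr

theorem image_partners {r : AffineSymm n} (hr : r ∈ reflections n) (S : Set (AffineSymm n)) :
    ((↑) : c.P → AffineSymm n) '' {s : c.P | (s : AffineSymm n) ∈ c.partners r ∩ S} =
      c.partners r ∩ S := by
  ext s
  constructor
  · rintro ⟨s, hs, rfl⟩
    exact hs
  · intro hs
    exact ⟨⟨s, c.partners_subset hr hs.1⟩, hs, rfl⟩

theorem mem_finiteAtoms {m : c.M} : m ∈ finiteAtoms c.M ↔
    ∃ r : c.P, (r : AffineSymm n) ∈ c.verticals ∧ DualMonoid.gen r = m := by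
  have hirr := @DualMonoid.irreducible_iff _ _ (reflections n) c.1 generates_reflections
    (reflections_conjStable n) one_notMem_reflections
  have hfin : ∀ r : c.P, (r : AffineSymm n) ∈ reflections n →
      ((atomPartners (DualMonoid.gen r : c.M)).Finite ↔ (c.partners r).Finite) := by
    intro r hr
    rw [atomPartners_gen hr, Set.finite_image_iff DualMonoid.gen_injective.injOn]
    have := image_partners (c := c) hr Set.univ
    simp only [Set.inter_univ] at this
    rw [← this, Set.finite_image_iff Subtype.val_injective.injOn, this]
  constructor
  · rintro ⟨h1, h2⟩
    obtain ⟨r, hr, rfl⟩ := hirr.1 h1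
    refine ⟨r, ?_, rfl⟩
    by_contra hv
    exact c.infinite_partners hr r.2 hv ((hfin r hr).1 h2)
  · rintro ⟨r, hv, rfl⟩
    have hr := c.verticals_subset hv
    refine ⟨hirr.2 ⟨r, hr, rfl⟩, (hfin r hr).2 ?_⟩
    obtain ⟨a, b, x, ξ, h⟩ := c.exists_hasOrbits
    obtain ⟨i, hi, j, hj, e⟩ := hv
    rw [X_eq h] at hi
    rw [Xi_eq h] at hj
    obtain ⟨p, rfl⟩ := hi
    obtain ⟨q, rfl⟩ := hj
    rw [e]
    exact finite_partners_vertical (h.rebase p q)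

theorem finiteAtoms_nonempty (c : CoxeterElement n) : (finiteAtoms c.M).Nonempty := by
  have hg := generates_reflections (n := n)
  obtain ⟨l, hl, hp, hk⟩ := hg.exists_list c.1
  obtain ⟨r, hr, hv⟩ := c.exists_vertical_of_prod hl hp
  obtain ⟨m, hm, hmp, hmk⟩ := exists_list_cons_of_mem (reflections_conjStable n) hl hr
  have h1 := genLength_le_length hm
  have h2 := hg.genLength_mul_le r m.prod
  have h3 := genLength_le_one (hl r hr)
  have hrP : r ∈ c.P := ⟨m.prod, by rw [hmp, hp], by rw [hmp, hp] at h2; omega⟩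
  exact ⟨DualMonoid.gen ⟨r, hrP⟩, mem_finiteAtoms.2 ⟨_, hv, rfl⟩⟩

theorem ncard_atomPartners_inter (c : CoxeterElement n) {m : c.M} (hm : m ∈ finiteAtoms c.M) :
    (atomPartners m ∩ finiteAtoms c.M).ncard = c.cardX * c.cardXi := by
  obtain ⟨r, hv, rfl⟩ := mem_finiteAtoms.1 hm
  have hr := c.verticals_subset hv
  obtain ⟨a, b, x, ξ, h⟩ := c.exists_hasOrbits
  rw [cardX_eq h, cardXi_eq h]
  have e : atomPartners (DualMonoid.gen r : c.M) ∩ finiteAtoms c.M =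
      DualMonoid.gen '' {s : c.P | (s : AffineSymm n) ∈ c.partners r ∩ c.verticals} := by
    rw [atomPartners_gen hr]
    ext y
    constructor
    · rintro ⟨⟨s, hs, rfl⟩, hy⟩
      obtain ⟨t, ht, e⟩ := mem_finiteAtoms.1 hy
      rw [DualMonoid.gen_injective e] at ht
      exact ⟨s, ⟨hs, ht⟩, rfl⟩
    · rintro ⟨s, ⟨hs, ht⟩, rfl⟩
      exact ⟨⟨s, hs, rfl⟩, mem_finiteAtoms.2 ⟨s, ht, rfl⟩⟩
  rw [e, Set.ncard_image_of_injective _ DualMonoid.gen_injective,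
    ← Set.ncard_image_of_injective _ Subtype.val_injective, image_partners hr]
  obtain ⟨i, hi, j, hj, e⟩ := hv
  rw [X_eq h] at hi
  rw [Xi_eq h] at hj
  obtain ⟨p, rfl⟩ := hi
  obtain ⟨q, rfl⟩ := hj
  rw [e]
  exact ncard_partners_inter_verticals (h.rebase p q)

theorem card_add_card (c : CoxeterElement n) : c.cardX + c.cardXi = n := by
  obtain ⟨a, b, x, ξ, h⟩ := c.exists_hasOrbits
  rw [cardX_eq h, cardXi_eq h, h.add_eq]

/-- The multiset of cardinalities is an invariant of the dual monoid. -/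
theorem pair_eq_of_mulEquiv {c c' : CoxeterElement n} (e : c.M ≃* c'.M) :
    ({c.cardX, c.cardXi} : Multiset ℕ) = {c'.cardX, c'.cardXi} := by
  obtain ⟨m, hm⟩ := c.finiteAtoms_nonempty
  have h1 := c.ncard_atomPartners_inter hm
  have h2 := c'.ncard_atomPartners_inter ((mem_finiteAtoms_map e m).2 hm)
  rw [ncard_atomPartners_map, h1] at h2
  have s1 := c.card_add_card
  have s2 := c'.card_add_card
  zify at h2 s1 s2
  -- Equal sums and equal products: a is a root of (T - a')(T - b').
  have h3 : ((c.cardX : ℤ) - c'.cardX) * (c.cardX - c'.cardXi) = 0 := by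
    have e1 : (c.cardXi : ℤ) = n - c.cardX := by linarith
    have e2 : (c'.cardXi : ℤ) = n - c'.cardX := by linarith
    rw [e1, e2] at h2
    rw [e2]
    linear_combination -h2
  rcases mul_eq_zero.1 h3 with h4 | h4
  · have e1 : c.cardX = c'.cardX := by omega
    have e2 : c.cardXi = c'.cardXi := by omega
    rw [e1, e2]
  · have e1 : c.cardX = c'.cardXi := by omega
    have e2 : c.cardXi = c'.cardX := by omega
    rw [e1, e2, Multiset.pair_comm]

end CoxeterElement

end Invariant

/-! ### Isomorphisms between dual monoids by relabelling ℤ -/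

section Conjugation

variable {n : ℕ}

theorem inv_add_of_sign {ε : ℤ} (hε : ε * ε = 1) {g : Equiv.Perm ℤ}
    (hg : ∀ x, g (x + n) = g x + ε * n) (x : ℤ) : g⁻¹ (x + n) = g⁻¹ x + ε * n := by
  apply g.injective
  rw [mul_comm ε, apply_add_mul_of_sign hg, hε, mul_one]
  simp

variable [n.AtLeastTwo]

/-- At g(y), the displacement of gwg⁻¹ is ε(w(y) - y) plus the variation of g - ε·id between y and
w(y). The latter function is periodic, so both contributions sum to zero. -/
theorem conj_mem_affineSymm {ε : ℤ} (hε : ε * ε = 1) {g : Equiv.Perm ℤ}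
    (hg : ∀ x, g (x + n) = g x + ε * n) (w : AffineSymm n) :
    g * (w : Equiv.Perm ℤ) * g⁻¹ ∈ AffineSymm n := by
  have hper : ∀ x, (g * (w : Equiv.Perm ℤ) * g⁻¹) (x + n) = (g * (w : Equiv.Perm ℤ) * g⁻¹) x + n := by
    intro x
    simp only [Equiv.Perm.mul_apply]
    rw [inv_add_of_sign hε hg, mul_comm ε, AffineSymm.apply_add_mul, apply_add_mul_of_sign hg, hε,
      mul_one]
  refine ⟨hper, ?_⟩
  rw [← sum_transversal (o := fun y : Finset.Icc (1 : ℤ) n => g y) (by simp) (by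
      rintro ⟨s, hs⟩ ⟨t, ht⟩ hst
      rw [dvd_apply_sub_of_sign hε hg] at hst
      rw [Finset.mem_Icc] at hs ht
      have := Int.eq_zero_of_abs_lt_dvd hst (abs_lt.2 ⟨by dsimp; omega, by dsimp; omega⟩)
      exact Subtype.ext (by dsimp at this ⊢; omega)) (disp_periodic hper),
    Finset.sum_coe_sort (Finset.Icc (1 : ℤ) n) (fun y => (g * (w : Equiv.Perm ℤ) * g⁻¹) (g y) - g y)]
  have h1 := sum_comp_periodic (NeZero.pos n) w.2.1 (g := fun y => g y - ε * y) (fun y k => by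
    rw [apply_add_mul_of_sign hg]
    ring)
  have h2 := w.2.2
  have e : ∀ y, (g * (w : Equiv.Perm ℤ) * g⁻¹) (g y) - g y =
      ((g ((w : Equiv.Perm ℤ) y) - ε * (w : Equiv.Perm ℤ) y) - (g y - ε * y)) +
        ε * ((w : Equiv.Perm ℤ) y - y) := by
    intro y
    simp only [Equiv.Perm.mul_apply, show g⁻¹ (g y) = y from g.symm_apply_apply y]
    ring
  rw [Finset.sum_congr rfl fun y _ => e y, Finset.sum_add_distrib, Finset.sum_sub_distrib, h1,
    ← Finset.mul_sum, h2]
  ring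

/-- The automorphism of `W` induced by conjugation by a permutation of `ℤ` which preserves or
reverses the translation by `n`. -/
def conjEquiv {ε : ℤ} (hε : ε * ε = 1) (g : Equiv.Perm ℤ) (hg : ∀ x, g (x + n) = g x + ε * n) :
    AffineSymm n ≃* AffineSymm n where
  toFun w := ⟨g * (w : Equiv.Perm ℤ) * g⁻¹, conj_mem_affineSymm hε hg w⟩
  invFun w := ⟨g⁻¹ * (w : Equiv.Perm ℤ) * g⁻¹⁻¹,
    conj_mem_affineSymm hε (inv_add_of_sign hε hg) w⟩
  left_inv w := Subtype.ext (by simp [mul_assoc])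
  right_inv w := Subtype.ext (by simp [mul_assoc])
  map_mul' u v := Subtype.ext (by simp [mul_assoc])

theorem conjEquiv_mem {ε : ℤ} (hε : ε * ε = 1) (g : Equiv.Perm ℤ)
    (hg : ∀ x, g (x + n) = g x + ε * n) {r : AffineSymm n} (hr : r ∈ reflections n) :
    conjEquiv hε g hg r ∈ reflections n := by
  obtain ⟨i, j, h, rfl⟩ := mem_reflections_iff.1 hr
  refine mem_reflections_iff.2 ⟨g i, g j, by rwa [dvd_apply_sub_of_sign hε hg], ?_⟩
  refine AffineSymm.ext_apply fun x => ?_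
  rw [affRefl_apply (by rwa [dvd_apply_sub_of_sign hε hg])]
  change g ((affRefl n i j : Equiv.Perm ℤ) (g⁻¹ x)) = _
  rw [affRefl_apply h, apply_reflFun_of_sign hε hg _ _ _ h]
  simp

theorem conjEquiv_mem_iff {ε : ℤ} (hε : ε * ε = 1) (g : Equiv.Perm ℤ)
    (hg : ∀ x, g (x + n) = g x + ε * n) (r : AffineSymm n) :
    conjEquiv hε g hg r ∈ reflections n ↔ r ∈ reflections n := by
  refine ⟨fun h => ?_, conjEquiv_mem hε g hg⟩
  have h2 := conjEquiv_mem hε g⁻¹ (inv_add_of_sign hε hg) h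
  convert h2
  exact ((conjEquiv hε g hg).symm_apply_apply r).symm

namespace HasOrbits

variable {c c' : AffineSymm n} {a b a' b' : ℕ} {x ξ x' ξ' : ℤ}

/-- The parametrization of `ℤ` by the two orbits of `c`. -/
noncomputable def equiv (h : HasOrbits c a b x ξ) : ℤ ⊕ ℤ ≃ ℤ :=
  Equiv.ofBijective (Sum.elim (orbitMap c x) (orbitMap c ξ)) (by
    constructor
    · rintro (m | m) (k | k) hmk
      · exact congrArg Sum.inl (h.left_injective hmk)
      · have e : orbitMap c x m = orbitMap c ξ k := hmk
        exact absurd (by rw [e, sub_self]; exact dvd_zero _) (h.not_dvd_left_right m k)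
      · have e : orbitMap c ξ m = orbitMap c x k := hmk
        exact absurd (by rw [e, sub_self]; exact dvd_zero _) (h.not_dvd_left_right k m)
      · exact congrArg Sum.inr (h.right_injective hmk)
    · intro y
      rcases h.exists_orbitMap y with ⟨m, rfl⟩ | ⟨m, rfl⟩
      · exact ⟨Sum.inl m, rfl⟩
      · exact ⟨Sum.inr m, rfl⟩)

theorem equiv_inl (h : HasOrbits c a b x ξ) (m : ℤ) : h.equiv (Sum.inl m) = orbitMap c x m := rfl

theorem equiv_inr (h : HasOrbits c a b x ξ) (m : ℤ) : h.equiv (Sum.inr m) = orbitMap c ξ m := rfl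

/-- If g matches the parametrized orbits of c with those of c', it intertwines c and c'. The periods
of the image orbits decide whether g preserves (ε = 1) or inverts (ε = -1) the translation by n. -/
theorem exists_conjEquiv (h : HasOrbits c a b x ξ) {g : Equiv.Perm ℤ} {ε y z : ℤ}
    (hε : ε * ε = 1) (hl : ∀ m, g (orbitMap c x m) = orbitMap c' y m)
    (hr : ∀ m, g (orbitMap c ξ m) = orbitMap c' z m)
    (hy : ∀ m, orbitMap c' y (m + a) = orbitMap c' y m + ε * n)
    (hz : ∀ m, orbitMap c' z (m + b) = orbitMap c' z m - ε * n) :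
    ∃ φ : AffineSymm n ≃* AffineSymm n, (∀ r, φ r ∈ reflections n ↔ r ∈ reflections n) ∧
      φ c = c' := by
  have hg : ∀ x, g (x + n) = g x + ε * n := by
    intro u
    rcases h.exists_orbitMap u with ⟨m, rfl⟩ | ⟨m, rfl⟩
    · have e := h.orbitMap_left m 1
      rw [mul_one, mul_one] at e
      rw [← e, hl, hl, hy]
    · have e := h.orbitMap_right m (-1)
      rw [mul_neg_one, mul_neg_one, sub_neg_eq_add] at e
      have e2 := hz (m + -b)
      rw [neg_add_cancel_right] at e2
      rw [← e, hr, hr, e2]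
      ring
  refine ⟨conjEquiv hε g hg, conjEquiv_mem_iff hε g hg, AffineSymm.ext_apply fun u => ?_⟩
  change g ((c : Equiv.Perm ℤ) (g⁻¹ u)) = _
  obtain ⟨v, rfl⟩ := g.surjective u
  rw [show g⁻¹ (g v) = v from g.symm_apply_apply v]
  rcases h.exists_orbitMap v with ⟨m, rfl⟩ | ⟨m, rfl⟩
  · rw [apply_orbitMap, hl, hl, apply_orbitMap]
  · rw [apply_orbitMap, hr, hr, apply_orbitMap]

theorem exists_conj (h : HasOrbits c a b x ξ) (h' : HasOrbits c' a b x' ξ') :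
    ∃ φ : AffineSymm n ≃* AffineSymm n, (∀ r, φ r ∈ reflections n ↔ r ∈ reflections n) ∧
      φ c = c' := by
  refine h.exists_conjEquiv (g := h.equiv.symm.trans h'.equiv) (ε := 1) (y := x') (z := ξ')
    (by ring) (fun m => ?_) (fun m => ?_) (fun m => ?_) (fun m => ?_)
  · rw [Equiv.trans_apply, ← h.equiv_inl, Equiv.symm_apply_apply, equiv_inl]
  · rw [Equiv.trans_apply, ← h.equiv_inr, Equiv.symm_apply_apply, equiv_inr]
  · have := h'.orbitMap_left m 1
    rw [mul_one] at this
    rw [this]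
    ring
  · have := h'.orbitMap_right m 1
    rw [mul_one] at this
    rw [this]
    ring

theorem exists_conj_swap (h : HasOrbits c a b x ξ) (h' : HasOrbits c' b a x' ξ') :
    ∃ φ : AffineSymm n ≃* AffineSymm n, (∀ r, φ r ∈ reflections n ↔ r ∈ reflections n) ∧
      φ c = c' := by
  refine h.exists_conjEquiv (g := h.equiv.symm.trans ((Equiv.sumComm ℤ ℤ).trans h'.equiv))
    (ε := -1) (y := ξ') (z := x') (by ring) (fun m => ?_) (fun m => ?_) (fun m => ?_) (fun m => ?_)
  · rw [Equiv.trans_apply, ← h.equiv_inl, Equiv.symm_apply_apply]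
    exact h'.equiv_inr m
  · rw [Equiv.trans_apply, ← h.equiv_inr, Equiv.symm_apply_apply]
    exact h'.equiv_inl m
  · have := h'.orbitMap_right m 1
    rw [mul_one] at this
    rw [this]
    ring
  · have := h'.orbitMap_left m 1
    rw [mul_one] at this
    rw [this]
    ring

end HasOrbits

theorem CoxeterElement.nonempty_mulEquiv {c c' : CoxeterElement n}
    (e : ({c.cardX, c.cardXi} : Multiset ℕ) = {c'.cardX, c'.cardXi}) :
    Nonempty (c.M ≃* c'.M) := by
  obtain ⟨a, b, x, ξ, h⟩ := c.exists_hasOrbits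
  obtain ⟨a', b', x', ξ', h'⟩ := c'.exists_hasOrbits
  rw [cardX_eq h, cardXi_eq h, cardX_eq h', cardXi_eq h'] at e
  have : (a = a' ∧ b = b') ∨ (a = b' ∧ b = a') := by
    have ha : a ∈ ({a', b'} : Multiset ℕ) := by rw [← e]; simp
    have h1 := h.add_eq
    have h2 := h'.add_eq
    have : a = a' ∨ a = b' := by simpa using ha
    omega
  rcases this with ⟨rfl, rfl⟩ | ⟨rfl, rfl⟩
  · obtain ⟨φ, hφ, hc⟩ := h.exists_conj h'
    exact DualMonoid.nonempty_mulEquiv φ hφ hc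
  · obtain ⟨φ, hφ, hc⟩ := h.exists_conj_swap h'
    exact DualMonoid.nonempty_mulEquiv φ hφ hc

end Conjugation

/-! ### Orbits of atoms under conjugation by c -/

section ConjOrbits

theorem encard_range_of_dvd {α : Type*} {F : ℤ → α} {a : ℕ} (ha : 0 < a)
    (h : ∀ k m, F k = F m ↔ (a : ℤ) ∣ k - m) : (Set.range F).encard = a := by
  have ha' : (0 : ℤ) < a := by exact_mod_cast ha
  have e : Set.range F = (fun i : Fin a => F i) '' Set.univ := by
    rw [Set.image_univ]
    ext y
    constructor
    · rintro ⟨k, rfl⟩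
      have h1 := Int.emod_nonneg k ha'.ne'
      have h2 := Int.emod_lt_of_pos k ha'
      refine ⟨⟨(k % a).toNat, by omega⟩, ?_⟩
      dsimp only
      rw [h, Int.toNat_of_nonneg h1]
      exact ⟨-(k / a), by have := Int.emod_add_mul_ediv k a; linarith⟩
    · rintro ⟨i, rfl⟩
      exact ⟨i, rfl⟩
  rw [e, Function.Injective.encard_image, Set.encard_univ, ENat.card_eq_coe_fintype_card,
    Fintype.card_fin]
  intro i j hij
  have := dvd_sub_imp_eq (by omega) (by omega) (by omega) (by omega) ((h i j).1 hij)
  exact Fin.ext (by exact_mod_cast this)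

variable {n : ℕ} [n.AtLeastTwo]

theorem HasOrbits.horizontal_eq_iff {c : AffineSymm n} {a b : ℕ} {x ξ : ℤ}
    (h : HasOrbits c a b x ξ) {p q : ℤ} (hpq : ¬ (a : ℤ) ∣ q - p) (k m : ℤ) :
    affRefl n (orbitMap c x (p + k)) (orbitMap c x (q + k)) =
      affRefl n (orbitMap c x (p + m)) (orbitMap c x (q + m)) ↔ (a : ℤ) ∣ k - m := by
  have hd : ∀ k : ℤ, ¬ (n : ℤ) ∣ orbitMap c x (q + k) - orbitMap c x (p + k) := fun k => by
    rwa [h.left_dvd_iff, add_sub_add_right_eq_sub]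
  constructor
  · intro he
    have h1 := affRefl_apply_left (hd m)
    rw [← he] at h1
    by_cases h2 : (n : ℤ) ∣ orbitMap c x (p + m) - orbitMap c x (p + k)
    · rw [h.left_dvd_iff, add_sub_add_left_eq_sub] at h2
      rwa [dvd_sub_comm]
    -- The two reflections could also agree with endpoints exchanged. Injectivity of the
    -- parametrization by ℤ then forces q - p = p - q, so p = q.
    · by_cases h3 : (n : ℤ) ∣ orbitMap c x (p + m) - orbitMap c x (q + k)
      · rw [h.left_dvd_iff] at h3
        obtain ⟨t, ht⟩ := h3
        have e : p + m = q + k + a * t := by linarith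
        rw [e, h.orbitMap_left, AffineSymm.apply_add_mul, affRefl_apply_right (hd k),
          ← h.orbitMap_left] at h1
        have h4 := h.left_injective h1
        exact absurd (by rw [show q - p = 0 by linarith]; exact dvd_zero _) hpq
      · rw [affRefl_apply_of_not_dvd h2 h3] at h1
        exact absurd (by rw [h1, sub_self]; exact dvd_zero _) (hd m)
  · rintro ⟨t, ht⟩
    obtain rfl : k = m + a * t := by linarith
    rw [← add_assoc, ← add_assoc, h.orbitMap_left, h.orbitMap_left, affRefl_shift]

namespace CoxeterElement

variable {c : CoxeterElement n}

theorem conjAut_gen (w : c.P) :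
    conjAut (reflections_conjStable n) c.1 (DualMonoid.gen w) =
      DualMonoid.gen ⟨c.1 * w * c.1⁻¹,
        conj_mem_divisors (reflections_conjStable n) (by group) w.2⟩ := rfl

theorem conjAut_zpow_gen (w : c.P) (k : ℤ) :
    ∃ v : c.P, ((conjAut (reflections_conjStable n) c.1) ^ k) (DualMonoid.gen w) = DualMonoid.gen v ∧
      (v : AffineSymm n) = c.1 ^ k * w * (c.1 ^ k)⁻¹ := by
  induction k with
  | zero => exact ⟨w, by simp, by simp⟩
  | succ i ih =>
    obtain ⟨v, h1, h2⟩ := ih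
    refine ⟨_, by rw [add_comm, zpow_one_add, MulAut.mul_apply, h1, conjAut_gen], ?_⟩
    dsimp only
    rw [h2]
    group
  | pred i ih =>
    obtain ⟨v, h1, h2⟩ := ih
    refine ⟨⟨c.1⁻¹ * v * c.1⁻¹⁻¹,
      conj_mem_divisors (reflections_conjStable n) (by group) v.2⟩, ?_, ?_⟩
    · apply (conjAut (reflections_conjStable n) c.1).injective
      rw [← MulAut.mul_apply, ← zpow_one_add, add_sub_cancel, h1, conjAut_gen]
      congr 1
      apply Subtype.ext
      dsimp only
      group
    · dsimp only
      rw [h2]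
      group

theorem conjOrbit_eq (r : c.P) {i j : ℤ} (h : ¬ (n : ℤ) ∣ j - i)
    (hr : (r : AffineSymm n) = affRefl n i j) :
    DualMonoid.toGroup (reflections n) c.1 '' c.conjOrbit (DualMonoid.gen r) =
      Set.range (fun k => affRefl n (orbitMap c.1 i k) (orbitMap c.1 j k)) := by
  ext w
  constructor
  · rintro ⟨_, ⟨k, rfl⟩, rfl⟩
    obtain ⟨v, h1, h2⟩ := conjAut_zpow_gen r k
    refine ⟨k, ?_⟩
    dsimp only
    rw [h1, DualMonoid.toGroup_gen, h2, hr, c.conj_orbitMap h]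
  · rintro ⟨k, rfl⟩
    obtain ⟨v, h1, h2⟩ := conjAut_zpow_gen r k
    refine ⟨_, ⟨k, rfl⟩, ?_⟩
    dsimp only
    rw [h1, DualMonoid.toGroup_gen, h2, hr, c.conj_orbitMap h]

/-- Every element of the orbit is a generator, and `toGroup` is injective on generators, so the
count can be done in W. -/
theorem encard_conjOrbit (r : c.P) {i j : ℤ} (h : ¬ (n : ℤ) ∣ j - i)
    (hr : (r : AffineSymm n) = affRefl n i j) :
    (c.conjOrbit (DualMonoid.gen r)).encard =
      (Set.range (fun k => affRefl n (orbitMap c.1 i k) (orbitMap c.1 j k))).encard := by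
  rw [← conjOrbit_eq r h hr, Set.InjOn.encard_image]
  rintro _ ⟨k, rfl⟩ _ ⟨m, rfl⟩ hkm
  obtain ⟨u, h1, -⟩ := conjAut_zpow_gen r k
  obtain ⟨v, h2, -⟩ := conjAut_zpow_gen r m
  rw [h1, h2] at hkm ⊢
  rw [DualMonoid.toGroup_gen, DualMonoid.toGroup_gen] at hkm
  rw [Subtype.ext hkm]

theorem encard_conjOrbit_X (r : c.P) {i j : ℤ} (h : ¬ (n : ℤ) ∣ j - i)
    (hr : (r : AffineSymm n) = affRefl n i j) (hi : i ∈ c.X) (hj : j ∈ c.X) :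
    (c.conjOrbit (DualMonoid.gen r)).encard = c.cardX := by
  obtain ⟨a, b, x, ξ, ho⟩ := c.exists_hasOrbits
  rw [X_eq ho] at hi hj
  obtain ⟨p, rfl⟩ := hi
  obtain ⟨q, rfl⟩ := hj
  rw [encard_conjOrbit r h hr, cardX_eq ho]
  rw [ho.left_dvd_iff] at h
  refine encard_range_of_dvd ho.pos_left fun k m => ?_
  simp only [orbitMap_orbitMap]
  exact ho.horizontal_eq_iff h k m

theorem encard_conjOrbit_Xi (r : c.P) {i j : ℤ} (h : ¬ (n : ℤ) ∣ j - i)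
    (hr : (r : AffineSymm n) = affRefl n i j) (hi : i ∈ c.Xi) (hj : j ∈ c.Xi) :
    (c.conjOrbit (DualMonoid.gen r)).encard = c.cardXi := by
  obtain ⟨a, b, x, ξ, ho⟩ := c.exists_hasOrbits
  rw [Xi_eq ho] at hi hj
  obtain ⟨p, rfl⟩ := hi
  obtain ⟨q, rfl⟩ := hj
  rw [encard_conjOrbit r h hr, cardXi_eq ho]
  rw [ho.right_dvd_iff] at h
  refine encard_range_of_dvd ho.pos_right fun k m => ?_
  -- For c⁻¹ the orbit Ξ plays the role of X; all exponents change sign.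
  have h1 := ho.inv.horizontal_eq_iff (p := -p) (q := -q) (by
    rwa [neg_sub_neg, dvd_sub_comm]) (-k) (-m)
  rw [neg_sub_neg, dvd_sub_comm] at h1
  simp only [orbitMap_inv, neg_add, neg_neg] at h1
  simp only [orbitMap_orbitMap]
  exact h1

theorem infinite_conjOrbit (r : c.P) {i j : ℤ} (h : ¬ (n : ℤ) ∣ j - i)
    (hr : (r : AffineSymm n) = affRefl n i j) (hi : i ∈ c.X) (hj : j ∈ c.Xi) :
    (c.conjOrbit (DualMonoid.gen r)).Infinite := by
  obtain ⟨a, b, x, ξ, ho⟩ := c.exists_hasOrbits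
  rw [X_eq ho] at hi
  rw [Xi_eq ho] at hj
  obtain ⟨p, rfl⟩ := hi
  obtain ⟨q, rfl⟩ := hj
  rw [← Set.encard_eq_top_iff, encard_conjOrbit r h hr, Set.encard_eq_top_iff]
  apply Set.infinite_range_of_injective
  intro k m hkm
  simp only [orbitMap_orbitMap] at hkm
  obtain ⟨t, h1, h2⟩ := ho.vertical_eq hkm
  have ha : (0 : ℤ) < a := by exact_mod_cast ho.pos_left
  have hb : (0 : ℤ) < b := by exact_mod_cast ho.pos_right
  have h3 : ((a : ℤ) + b) * t = 0 := by linarith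
  have h4 : t = 0 := by
    rcases mul_eq_zero.1 h3 with h4 | h4
    · omega
    · exact h4
  rw [h4] at h1
  linarith

theorem cardX_pos (c : CoxeterElement n) : 0 < c.cardX := by
  obtain ⟨a, b, x, ξ, h⟩ := c.exists_hasOrbits
  rw [cardX_eq h]
  exact h.pos_left

theorem cardXi_pos (c : CoxeterElement n) : 0 < c.cardXi := by
  obtain ⟨a, b, x, ξ, h⟩ := c.exists_hasOrbits
  rw [cardXi_eq h]
  exact h.pos_right

/-- The partition of `n` attached to a Coxeter element. -/
noncomputable def toPartition (c : CoxeterElement n) : n.Partition where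
  parts := {c.cardX, c.cardXi}
  parts_pos := by
    intro i hi
    have : i = c.cardX ∨ i = c.cardXi := by simpa using hi
    rcases this with rfl | rfl
    · exact c.cardX_pos
    · exact c.cardXi_pos
  parts_sum := by
    rw [Multiset.sum_pair]
    exact c.card_add_card

theorem exists_toPartition_eq {p : n.Partition} (hp : p.parts.card = 2) :
    ∃ c : CoxeterElement n, c.toPartition = p := by
  obtain ⟨a, b, hab⟩ := Multiset.card_eq_two.1 hp
  have ha : 0 < a := p.parts_pos (by rw [hab]; simp)
  have hb : 0 < b := p.parts_pos (by rw [hab]; simp)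
  have hs : a + b = n := by rw [← p.parts_sum, hab, Multiset.sum_pair]
  obtain ⟨c, x, ξ, h⟩ := exists_hasOrbits_of_add_eq ha hb hs
  refine ⟨c, Nat.Partition.ext ?_⟩
  change ({c.cardX, c.cardXi} : Multiset ℕ) = p.parts
  rw [hab, cardX_eq h, cardXi_eq h]

end CoxeterElement

end ConjOrbits

/-! ### Classification and sizes of the conjugation orbits -/

theorem mainTheorem8 (n : ℕ) [n.AtLeastTwo] :
    (∃ Φ : Quotient (dualIso n) → {p : n.Partition // p.parts.card = 2},
      Function.Bijective Φ ∧
      ∀ c : CoxeterElement n, (Φ (Quotient.mk (dualIso n) c)).1.parts = {c.cardX, c.cardXi}) ∧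
    (∀ c : CoxeterElement n, ∀ r : c.P, (r : AffineSymm n) ∈ reflections n →
      ∀ i j : ℤ, i ≠ j → ((r : AffineSymm n) : Equiv.Perm ℤ) i = j →
        (i ∈ c.X → j ∈ c.X → (c.conjOrbit (DualMonoid.gen r)).encard = c.cardX) ∧
        (i ∈ c.Xi → j ∈ c.Xi → (c.conjOrbit (DualMonoid.gen r)).encard = c.cardXi) ∧
        (i ∈ c.X → j ∈ c.Xi → (c.conjOrbit (DualMonoid.gen r)).Infinite)) := by
  constructor
  · refine ⟨Quotient.lift (fun c => ⟨c.toPartition, by simp [CoxeterElement.toPartition]⟩) ?_,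
      ⟨?_, ?_⟩, fun c => rfl⟩
    · rintro c c' ⟨e⟩
      exact Subtype.ext (Nat.Partition.ext (CoxeterElement.pair_eq_of_mulEquiv e))
    · intro u v
      induction u using Quotient.inductionOn with
      | _ c =>
      induction v using Quotient.inductionOn with
      | _ c' =>
      intro huv
      exact Quotient.sound (CoxeterElement.nonempty_mulEquiv
        (congrArg (fun p : {p : n.Partition // p.parts.card = 2} => p.1.parts) huv))
    · rintro ⟨p, hp⟩
      obtain ⟨c, rfl⟩ := CoxeterElement.exists_toPartition_eq hp
      exact ⟨Quotient.mk _ c, rfl⟩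
  · intro c r hr i j hij hrij
    obtain ⟨hd, hr'⟩ := eq_affRefl_of_apply hr hij hrij
    exact ⟨CoxeterElement.encard_conjOrbit_X r hd hr', CoxeterElement.encard_conjOrbit_Xi r hd hr',
      CoxeterElement.infinite_conjOrbit r hd hr'⟩
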